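/- **Setting.** Let $n\ge 1$, $0<q<1$, $t>0$, $\lambda>0$. Let $E=\bigoplus_{i=1}^n\mathbb R\epsilon_i$ be Euclidean with orthonormal basis $(\epsilon_i)$, let $\Delta=\{\pm\epsilon_i\pm\epsilon_j\ (i<j),\ \pm2\epsilon_i\}$ be the root system of type $C_n$ with positive roots $\epsilon_i\pm\epsilon_j$ $(i<j)$, $2\epsilon_i$, simple roots $\alpha_i=\epsilon_i-\epsilon_{i+1}$ $(i<n)$, $\alpha_n=2\epsilon_n$, coroots $\alpha^\vee=2\alpha/\langle\alpha,\alpha\rangle$ and reflections $s_\alpha$, $s_i=s_{\alpha_i}$; let $W$ be its Weyl group (the signed permutations) and $P^\vee=\bigoplus_i\mathbb Z\epsilon_i+\mathbb Z\cdot\tfrac12\sum_i\epsilon_i$. Functions of $y=(y_1,\dots,y_n)\in(\mathbb C^\times)^n$ are the coefficients, with $e^{\epsilon_i}=y_i$ and $e^{\delta}=q$; $V$ is the free module over the coefficients with basis $h_w$ $(w\in W)$. Put $u=-\lambda\epsilon_1$. For $\mu\in P^\vee$ let $r_{\tau(\mu)}(f\,h_w)=f(q^{-\mu}y)\,q^{\langle\mu,wu\rangle}h_w$,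 where $q^{\mu}y=(q^{\mu_1}y_1,\dots,q^{\mu_n}y_n)$. For $\alpha\in\Delta$, $m\in\mathbb Z$ let $R_{\alpha+m\delta}$ be the linear map over the coefficients with $$R_{\alpha+m\delta}h_w=\begin{cases}\dfrac{1-z}{1-tz}\,h_w+q^{m\langle\alpha^\vee,wu\rangle}\dfrac{1-t}{1-tz}\,h_{s_\alpha w},& w^{-1}\alpha>0,\\[2mm] \dfrac{t(1-z)}{1-tz}\,h_w+q^{m\langle\alpha^\vee,wu\rangle}\dfrac{z(1-t)}{1-tz}\,h_{s_\alpha w},& w^{-1}\alpha<0,\end{cases}\qquad z=q^me^\alpha$$ (that is, $t_1=t_2=t$), and put $$R_{\tau(\epsilon_i)}=R_{\epsilon_i-\epsilon_{i-1}+\delta}\cdots R_{\epsilon_i-\epsilon_1+\delta}\,R_{2\epsilon_i+\delta}\,R_{\epsilon_1+\epsilon_i}\cdots R_{\epsilon_{i-1}+\epsilon_i}\,R_{\epsilon_i+\epsilon_{i+1}}\cdots R_{\epsilon_i+\epsilon_n}\,R_{2\epsilon_i}\,R_{\epsilon_i-\epsilon_n}\cdots R_{\epsilon_i-\epsilon_{i+1}},$$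 $$R_{\tau(\frac12(\epsilon_1+\cdots+\epsilon_n))}=(R_{2\epsilon_1}R_{\epsilon_1+\epsilon_2}\cdots R_{\epsilon_1+\epsilon_n})(R_{2\epsilon_2}R_{\epsilon_2+\epsilon_3}\cdots R_{\epsilon_2+\epsilon_n})\cdots R_{2\epsilon_n}.$$ **The integrals.** With $(a)_\infty=\prod_{s\ge0}(1-aq^s)$ let $$\Phi=x^\lambda\prod_{j=1}^n\frac{(ty_j/x)_\infty(ty_j^{-1}/x)_\infty}{(y_j/x)_\infty(y_j^{-1}/x)_\infty}\frac{dx}{x},$$ whose poles outside $0$ are among the points $y_j^{\pm1}q^s$, $s\ge0$. Let $$\varphi_{w_i}=\frac{\prod_{1\le\mu<i}(1-y_\mu^{-1}/x)}{\prod_{1\le\mu\le i}(1-ty_\mu^{-1}/x)}\ (1\le i\le n),\qquad \varphi_{w_i}=\frac{\prod_{2n-i+1<\mu\le n}(1-y_\mu/x)}{\prod_{2n-i+1\le\mu\le n}(1-ty_\mu/x)}\prod_{\mu=1}^n\frac{1-y_\mu^{-1}/x}{1-ty_\mu^{-1}/x}\ (n+1\le i\le2n).$$ A *fixed cycle* $\mathcal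 C$ is a $\mathbb C$-linear combination of * the cycles $C_{j,\pm}$ $(1\le j\le n)$ encircling counterclockwise the sequence of poles $y_j^{\pm1},y_j^{\pm1}q,y_j^{\pm1}q^2,\dots$ (the sum over $s\ge0$ of small positive circles around $y_j^{\pm1}q^s$, with the branch of $x^\lambda$ that is principal at $y_j^{\pm1}$ and continued along the ray towards $0$); these may occur only if $q^{\lambda+1}t^{2n}<1$ (automatic for $t\le1$), which makes the integrals below converge; * the circle $|x|=1+\sum_j(|y_j|+|y_j|^{-1})$, which encircles all the poles counterclockwise; it may occur only if $\lambda$ is an integer; with coefficients that may be constants or, more generally, functions of $y$ invariant under $y\mapsto q^\mu y$ for all $\mu\in P^\vee$. Write $\langle\psi\rangle=\int_{\mathcal C}\psi\,\Phi$, a function of $y$. Finally let $w_1=e$, $w_{k+1}=s_k\cdots s_1$ for $1\le k\le n$, $w_{n+1+k}=s_{n-k}\cdots s_{n-1}w_{n+1}$ for $1\le k\le n-1$ (representatives of $W/W_{\epsilon_1}$, where $W_{\epsilon_1}$ is the stabilizer of $\epsilon_1$), and $\overline h_{w_i}=\sum_{g\in W_{\epsilon_1}}h_{w_ig}$. **Theorem.**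 Let $\mathcal C$ be a fixed cycle. For every generic $y$, i.e. $q^me^\alpha\ne1$ and $tq^me^\alpha\ne1$ for all $\alpha\in\Delta$, $m\in\mathbb Z$, the integrals $\langle\varphi_{w_i}\rangle$ $(1\le i\le2n)$ converge, and $$\Psi=\sum_{i=1}^{2n}\langle\varphi_{w_i}\rangle\,\overline h_{w_i}$$ satisfies, at all generic $y$, the QKZ equation of type $C_n$ with parameter $u=-\lambda\epsilon_1$ and $t_1=t_2=t$: $$r_{\tau(\epsilon_i)}^{-1}\Psi=R_{\tau(\epsilon_i)}\Psi\quad(1\le i\le n),\qquad r_{\tau(\frac12(\epsilon_1+\cdots+\epsilon_n))}^{-1}\Psi=R_{\tau(\frac12(\epsilon_1+\cdots+\epsilon_n))}\Psi.$$ -/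

import Mathlib

open scoped BigOperators

namespace QKZ

noncomputable section

/-! ### The root system of type C and its Weyl group -/

/-- The Weyl group `W(C_n)`, realised as the group of signed permutations of the coordinates:
`w` sends `ε_i` to `sign (perm i) • ε_{perm i}`. -/
@[ext]
structure WeylC (n : ℕ) where
  /-- the underlying permutation -/
  perm : Equiv.Perm (Fin n)
  /-- the sign attached to each target coordinate -/
  sign : Fin n → ℤˣ

namespace WeylC

variable {n : ℕ}

instance : Mul (WeylC n) :=
  ⟨fun w z => ⟨w.perm * z.perm, fun k => w.sign k * z.sign (w.perm.symm k)⟩⟩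

instance : One (WeylC n) := ⟨⟨1, fun _ => 1⟩⟩

instance : Inv (WeylC n) := ⟨fun w => ⟨w.perm⁻¹, fun k => w.sign (w.perm k)⟩⟩

@[simp] theorem mul_perm (w z : WeylC n) : (w * z).perm = w.perm * z.perm := rfl
@[simp] theorem mul_sign (w z : WeylC n) (k : Fin n) :
    (w * z).sign k = w.sign k * z.sign (w.perm.symm k) := rfl
@[simp] theorem one_perm : (1 : WeylC n).perm = 1 := rfl
@[simp] theorem one_sign (k : Fin n) : (1 : WeylC n).sign k = 1 := rfl
@[simp] theorem inv_perm (w : WeylC n) : (w⁻¹).perm = w.perm⁻¹ := rfl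
@[simp] theorem inv_sign (w : WeylC n) (k : Fin n) : (w⁻¹).sign k = w.sign (w.perm k) := rfl

instance : Group (WeylC n) :=
  Group.ofLeftAxioms
    (fun a b c => by
      ext k
      · simp
      · simp [mul_assoc, Equiv.Perm.mul_def])
    (fun a => by
      ext k
      · simp
      · simp [Equiv.Perm.one_def])
    (fun a => by
      ext k
      · simp
      · simp [Equiv.Perm.inv_def])

/-- Signed permutations as pairs. -/
def equivProd (n : ℕ) : WeylC n ≃ Equiv.Perm (Fin n) × (Fin n → ℤˣ) where
  toFun w := (w.perm, w.sign)
  invFun p := ⟨p.1, p.2⟩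
  left_inv _ := rfl
  right_inv _ := rfl

instance : Fintype (WeylC n) := Fintype.ofEquiv _ (equivProd n).symm

instance : DecidableEq (WeylC n) := Classical.decEq _

/-- The action of `W` on coordinate vectors (over `ℤ`: the weight lattice `P`; over `ℝ`: the
Euclidean space `E`). -/
def act {M : Type*} [AddCommGroup M] (w : WeylC n) (v : Fin n → M) : Fin n → M :=
  fun k => ((w.sign k : ℤˣ) : ℤ) • v (w.perm.symm k)

end WeylC

/-- The vector `ε_i` of the weight lattice `P = ℤ^n`, with `1 ≤ i ≤ n`. -/
def eps (n i : ℕ) : Fin n → ℤ := fun k => if (k : ℕ) + 1 = i then 1 else 0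

/-- A lattice vector seen in the Euclidean space `E = ℝ^n`. -/
def toE {n : ℕ} (v : Fin n → ℤ) : Fin n → ℝ := fun k => (v k : ℝ)

/-- The positive roots `ε_i ± ε_j` (`i < j`) and `2 ε_i`. -/
def posRoots (n : ℕ) : Set (Fin n → ℤ) :=
  {v | (∃ i j : ℕ, 1 ≤ i ∧ i < j ∧ j ≤ n ∧ (v = eps n i + eps n j ∨ v = eps n i - eps n j)) ∨
    ∃ i : ℕ, 1 ≤ i ∧ i ≤ n ∧ v = 2 • eps n i}

/-- The root system of type `C_n`. -/
def roots (n : ℕ) : Set (Fin n → ℤ) := {v | v ∈ posRoots n ∨ -v ∈ posRoots n}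

/-- The simple roots `α_i = ε_i - ε_{i+1}` for `i < n`, and `α_n = 2 ε_n`. -/
def simpleRoot (n i : ℕ) : Fin n → ℤ :=
  if i < n then eps n i - eps n (i + 1) else 2 • eps n n

/-- The coroot `α^∨ = 2 α / ⟨α, α⟩`. -/
def coroot {n : ℕ} (α : Fin n → ℤ) : Fin n → ℝ := (2 / (toE α ⬝ᵥ toE α)) • toE α

/-- `w` acts on `E` as the reflection `x ↦ x - ⟨x, α⟩ α^∨`. -/
def IsReflection {n : ℕ} (w : WeylC n) (α : Fin n → ℤ) : Prop :=
  ∀ x : Fin n → ℝ, w.act x = x - (x ⬝ᵥ toE α) • coroot α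

open Classical in
/-- The reflection `s_α` as an element of `W` (it exists for every root, see `refl_spec`). -/
def refl {n : ℕ} (α : Fin n → ℤ) : WeylC n :=
  if h : ∃ w : WeylC n, IsReflection w α then h.choose else 1

/-- An element of `W` is determined by its action on `E`. -/
theorem WeylC.act_injective {n : ℕ} {w z : WeylC n}
    (h : ∀ x : Fin n → ℝ, w.act x = z.act x) : w = z := by
  have key : ∀ k, w.perm.symm k = z.perm.symm k ∧ w.sign k = z.sign k := by
    intro k
    have h1 := congrFun (h (Pi.single (w.perm.symm k) 1)) k
    simp only [WeylC.act, Pi.single_eq_same, zsmul_eq_mul, mul_one] at h1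
    by_cases hk : w.perm.symm k = z.perm.symm k
    · refine ⟨hk, ?_⟩
      rw [← hk, Pi.single_eq_same, mul_one] at h1
      exact Units.ext (by exact_mod_cast h1)
    · rw [Pi.single_eq_of_ne (Ne.symm hk), mul_zero] at h1
      exact absurd (by exact_mod_cast h1) (w.sign k).ne_zero
  refine WeylC.ext ?_ (funext fun k => (key k).2)
  have : w.perm.symm = z.perm.symm := Equiv.ext fun k => (key k).1
  exact Equiv.symm_bijective.injective this

theorem refl_eq {n : ℕ} {α : Fin n → ℤ} {w : WeylC n} (h : IsReflection w α) : refl α = w := by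
  have h' : ∃ w : WeylC n, IsReflection w α := ⟨w, h⟩
  rw [refl, dif_pos h']
  exact WeylC.act_injective fun x => (h'.choose_spec x).trans (h x).symm

theorem toE_eps {n : ℕ} (i : Fin n) : toE (eps n (i + 1)) = Pi.single i 1 := by
  funext k
  by_cases h : k = i
  · subst h; simp [toE, eps]
  · simp [toE, eps, h, Fin.val_inj]

theorem isReflection_long {n : ℕ} (i : Fin n) :
    IsReflection ⟨1, fun k => if k = i then -1 else 1⟩ (2 • eps n (i + 1)) := by
  intro x
  have h : toE (2 • eps n (i + 1)) = (2 : ℝ) • Pi.single i 1 := by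
    rw [← toE_eps]; funext k; simp [toE]
  funext k
  rw [coroot, h]
  by_cases hk : k = i
  · subst hk; simp [WeylC.act, Equiv.Perm.one_def]; ring
  · simp [WeylC.act, hk, Equiv.Perm.one_def]

theorem isReflection_short {n : ℕ} (i j : Fin n) (hij : i ≠ j) (c : ℤˣ) :
    IsReflection ⟨Equiv.swap i j, fun k => if k = i ∨ k = j then -c else 1⟩
      (eps n (i + 1) + (c : ℤ) • eps n (j + 1)) := by
  intro x
  have h : toE (eps n (i + 1) + (c : ℤ) • eps n (j + 1)) =
      Pi.single i 1 + ((c : ℤ) : ℝ) • Pi.single j 1 := by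
    rw [← toE_eps, ← toE_eps]; funext k; simp [toE]
  have hc : ((c : ℤ) : ℝ) * ((c : ℤ) : ℝ) = 1 := by
    exact_mod_cast Int.units_coe_mul_self c
  funext k
  rw [coroot, h]
  by_cases hk : k = i
  · subst hk
    simp [WeylC.act, hij, hij.symm, hc]
    norm_num
  · by_cases hk' : k = j
    · subst hk'
      simp [WeylC.act, hij, hij.symm, hc]
      norm_num
      linear_combination x k * hc
    · simp [WeylC.act, hk, hk', Equiv.swap_apply_of_ne_of_ne]

theorem IsReflection.of_neg {n : ℕ} {w : WeylC n} {α : Fin n → ℤ} (h : IsReflection w (-α)) :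
    IsReflection w α := by
  intro x
  have e : toE (-α) = -toE α := by funext k; simp [toE]
  rw [h x, coroot, coroot, e]
  simp

/-- For every root `α` the element `s_α` acts as the reflection in `α`. -/
theorem refl_spec {n : ℕ} {α : Fin n → ℤ} (hα : α ∈ roots n) : IsReflection (refl α) α := by
  have pos : ∀ β ∈ posRoots n, ∃ w, IsReflection w β := by
    rintro β (⟨i, j, hi, hij, hj, hβ⟩ | ⟨i, hi, hin, rfl⟩)
    · obtain ⟨i, rfl⟩ := Nat.exists_eq_add_of_le' hi
      obtain ⟨j, rfl⟩ := Nat.exists_eq_add_of_le' (hi.trans hij.le)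
      have hne : (⟨i, by omega⟩ : Fin n) ≠ ⟨j, by omega⟩ := by
        intro h; have := congrArg Fin.val h; simp at this; omega
      rcases hβ with rfl | rfl
      · exact ⟨_, by simpa using isReflection_short _ _ hne 1⟩
      · exact ⟨_, by simpa [sub_eq_add_neg] using isReflection_short _ _ hne (-1)⟩
    · obtain ⟨i, rfl⟩ := Nat.exists_eq_add_of_le' hi
      exact ⟨_, isReflection_long ⟨i, by omega⟩⟩
  have hex : ∃ w, IsReflection w α := by
    rcases hα with h | h
    · exact pos α h
    · obtain ⟨w, hw⟩ := pos _ h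
      exact ⟨w, hw.of_neg⟩
  obtain ⟨w, hw⟩ := hex
  rw [refl_eq hw]
  exact hw

/-! ### The module `V` and the translations -/

/-- The torus with coordinates `y_i = e^{ε_i}`. -/
abbrev Torus (n : ℕ) : Type := Fin n → ℂˣ

/-- Coefficients: functions of `y`. -/
abbrev Coef (n : ℕ) : Type := Torus n → ℂ

/-- The free module with basis `h_w`, `w ∈ W`, over the coefficients. -/
abbrev VMod (n : ℕ) : Type := WeylC n → Coef n

/-- The basis vector `h_w`. -/
def hBasis {n : ℕ} (w : WeylC n) : VMod n := Pi.single w 1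

/-- The character `e^α`, `α ∈ P`, as a function of `y`. -/
def expo {n : ℕ} (α : Fin n → ℤ) : Coef n := fun y => ((∏ k, y k ^ α k : ℂˣ) : ℂ)

/-- The real power `q ^ a` (for `q > 0`) as a nonzero complex number. -/
def qPow (q a : ℝ) : ℂˣ := Units.mk0 (Complex.exp (a * Real.log q : ℝ)) (Complex.exp_ne_zero _)

theorem qPow_eq {q : ℝ} (hq : 0 < q) (a : ℝ) : (qPow q a : ℂ) = ((q ^ a : ℝ) : ℂ) := by
  rw [Real.rpow_def_of_pos hq, mul_comm]; simp [qPow]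

theorem qPow_add (q a b : ℝ) : qPow q (a + b) = qPow q a * qPow q b := by
  ext; simp [qPow, ← Complex.exp_add, add_mul]

theorem qPow_zero (q : ℝ) : qPow q 0 = 1 := by
  ext; simp [qPow]

/-- The point `q^μ y = (q^{μ_1} y_1, …, q^{μ_n} y_n)`. -/
def scale {n : ℕ} (q : ℝ) (μ : Fin n → ℝ) (y : Torus n) : Torus n := fun k => qPow q (μ k) * y k

theorem scale_scale {n : ℕ} (q : ℝ) (μ ν : Fin n → ℝ) (y : Torus n) :
    scale q μ (scale q ν y) = scale q (μ + ν) y := by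
  funext k; simp [scale, qPow_add, mul_assoc]

theorem scale_zero {n : ℕ} (q : ℝ) (y : Torus n) : scale q 0 y = y := by
  funext k; simp [scale, qPow_zero]

/-- The dual weight lattice `P^∨ = ℤ^n + ℤ (ε_1 + ⋯ + ε_n)/2`. -/
def coweights (n : ℕ) : Set (Fin n → ℝ) :=
  {μ | ∃ (v : Fin n → ℤ) (k : ℤ), μ = fun i => (v i : ℝ) + (k : ℝ) / 2}

/-- The translation operator `r_{τ(μ)}`, with
`r_{τ(μ)} (f h_w) = τ(μ)(f) q^{⟨μ, w u⟩} h_w` and `τ(μ) e^λ = q^{-⟨λ, μ⟩} e^λ`,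
i.e. `(τ(μ) f)(y) = f (q^{-μ} y)`. -/
def rTau {n : ℕ} (q : ℝ) (u μ : Fin n → ℝ) : VMod n ≃ₗ[ℂ] VMod n where
  toFun F := fun w y => (qPow q (μ ⬝ᵥ w.act u) : ℂ) * F w (scale q (-μ) y)
  invFun F := fun w y => (qPow q (-μ ⬝ᵥ w.act u) : ℂ) * F w (scale q μ y)
  map_add' F G := by funext w y; simp [mul_add]
  map_smul' c F := by funext w y; simp [mul_left_comm]
  left_inv F := by
    funext w y
    simp only [scale_scale, neg_add_cancel, scale_zero, ← mul_assoc, ← Units.val_mul, ← qPow_add]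
    simp [qPow_zero]
  right_inv F := by
    funext w y
    simp only [scale_scale, add_neg_cancel, scale_zero, ← mul_assoc, ← Units.val_mul, ← qPow_add]
    simp [qPow_zero]

/-! ### The `R`-matrices and the QKZ equation -/

/-- The parameter `t_α`: `t₁` on the roots `±ε_i ± ε_j`, and `t₂` on the roots `±2ε_i`. -/
def tRoot {n : ℕ} (t₁ t₂ : ℝ) (α : Fin n → ℤ) : ℝ := if α ⬝ᵥ α = 4 then t₂ else t₁

/-- `q^m e^α`. -/
def affExpo {n : ℕ} (q : ℝ) (α : Fin n → ℤ) (m : ℤ) : Coef n := fun y => (q : ℂ) ^ m * expo α y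

def coefA {n : ℕ} (q t₁ t₂ : ℝ) (α : Fin n → ℤ) (m : ℤ) : Coef n := fun y =>
  (1 - affExpo q α m y) / (1 - tRoot t₁ t₂ α * affExpo q α m y)

def coefB {n : ℕ} (q t₁ t₂ : ℝ) (α : Fin n → ℤ) (m : ℤ) : Coef n := fun y =>
  (1 - tRoot t₁ t₂ α) / (1 - tRoot t₁ t₂ α * affExpo q α m y)

def coefC {n : ℕ} (q t₁ t₂ : ℝ) (α : Fin n → ℤ) (m : ℤ) : Coef n := fun y =>
  tRoot t₁ t₂ α * (1 - affExpo q α m y) / (1 - tRoot t₁ t₂ α * affExpo q α m y)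

def coefD {n : ℕ} (q t₁ t₂ : ℝ) (α : Fin n → ℤ) (m : ℤ) : Coef n := fun y =>
  affExpo q α m y * (1 - tRoot t₁ t₂ α) / (1 - tRoot t₁ t₂ α * affExpo q α m y)

open Classical in
/-- The `R`-matrix `R_{α + mδ}`: the linear map over the coefficients given on the basis by the
two cases `w⁻¹(α) > 0` and `w⁻¹(α) < 0`. -/
def rMatrix {n : ℕ} (q t₁ t₂ : ℝ) (u : Fin n → ℝ) (α : Fin n → ℤ) (m : ℤ) :
    Module.End (Coef n) (VMod n) :=
  Fintype.linearCombination (Coef n) fun w : WeylC n =>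
    if (w⁻¹).act α ∈ posRoots n then
      coefA q t₁ t₂ α m • hBasis w +
        (qPow q (m * (coroot α ⬝ᵥ w.act u)) : ℂ) • coefB q t₁ t₂ α m • hBasis (refl α * w)
    else
      coefC q t₁ t₂ α m • hBasis w +
        (qPow q (m * (coroot α ⬝ᵥ w.act u)) : ℂ) • coefD q t₁ t₂ α m • hBasis (refl α * w)

/-- `R_{τ(ε_i)} = R_{ε_i-ε_{i-1}+δ} ⋯ R_{ε_i-ε_1+δ} R_{2ε_i+δ} R_{ε_1+ε_i} ⋯ R_{ε_{i-1}+ε_i}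
R_{ε_i+ε_{i+1}} ⋯ R_{ε_i+ε_n} R_{2ε_i} R_{ε_i-ε_n} ⋯ R_{ε_i-ε_{i+1}}`. -/
def rTransl (n : ℕ) (q t₁ t₂ : ℝ) (u : Fin n → ℝ) (i : ℕ) : Module.End (Coef n) (VMod n) :=
  ((List.range' 1 (i - 1)).reverse.map fun k => rMatrix q t₁ t₂ u (eps n i - eps n k) 1).prod *
  rMatrix q t₁ t₂ u (2 • eps n i) 1 *
  ((List.range' 1 (i - 1)).map fun k => rMatrix q t₁ t₂ u (eps n k + eps n i) 0).prod *
  ((List.range' (i + 1) (n - i)).map fun k => rMatrix q t₁ t₂ u (eps n i + eps n k) 0).prod *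
  rMatrix q t₁ t₂ u (2 • eps n i) 0 *
  ((List.range' (i + 1) (n - i)).reverse.map fun k =>
    rMatrix q t₁ t₂ u (eps n i - eps n k) 0).prod

/-- The matrix attached to the half-sum translation: the product over `i = 1, …, n`, in this order,
of `R_{2ε_i} R_{ε_i+ε_{i+1}} ⋯ R_{ε_i+ε_n}`. -/
def rHalf (n : ℕ) (q t₁ t₂ : ℝ) (u : Fin n → ℝ) : Module.End (Coef n) (VMod n) :=
  ((List.range' 1 n).map fun i =>
    rMatrix q t₁ t₂ u (2 • eps n i) 0 *
      ((List.range' (i + 1) (n - i)).map fun k =>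
        rMatrix q t₁ t₂ u (eps n i + eps n k) 0).prod).prod

/-- The vector `(ε_1 + ⋯ + ε_n)/2`. -/
def halfSum (n : ℕ) : Fin n → ℝ := fun _ => 1 / 2

/-- `F` solves the QKZ equation of type `C_n` with parameter `u`, as an identity of
functions at the points `y` of `Y`. -/
def SolvesQKZ (n : ℕ) (q t₁ t₂ : ℝ) (u : Fin n → ℝ) (Y : Set (Torus n)) (F : VMod n) : Prop :=
  (∀ i : ℕ, 1 ≤ i → i ≤ n → ∀ y ∈ Y, ∀ w : WeylC n,
    (rTau q u (toE (eps n i))).symm F w y = rTransl n q t₁ t₂ u i F w y) ∧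
  (∀ y ∈ Y, ∀ w : WeylC n,
    (rTau q u (halfSum n)).symm F w y = rHalf n q t₁ t₂ u F w y)

/-- The generic points: those lying on none of the hypersurfaces `q^m e^α = 1` and
`t q^m e^α = 1`, for `α` a root and `m ∈ ℤ`. -/
def genericPts (n : ℕ) (q t : ℝ) : Set (Torus n) :=
  {y | ∀ α ∈ roots n, ∀ m : ℤ, affExpo q α m y ≠ 1 ∧ (t : ℂ) * affExpo q α m y ≠ 1}

/-! ### The integrals -/

/-- `(a)_∞ = ∏_{s ≥ 0} (1 - a q^s)`. -/
def qPoch (q : ℝ) (a : ℂ) : ℂ := ∏' s : ℕ, (1 - a * (q : ℂ) ^ s)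

/-- The single-valued factor of the form `Φ`:
`∏_j (t y_j/x)_∞ (t y_j⁻¹/x)_∞ / ((y_j/x)_∞ (y_j⁻¹/x)_∞)`. -/
def jpProd {n : ℕ} (q t : ℝ) (y : Torus n) (x : ℂ) : ℂ :=
  ∏ j, (qPoch q (t * y j / x) * qPoch q (t * (y j : ℂ)⁻¹ / x)) /
    (qPoch q (y j / x) * qPoch q ((y j : ℂ)⁻¹ / x))

/-- The pole `y_j^{±1} q^s` of `Φ`. -/
def pole {n : ℕ} (q : ℝ) (y : Torus n) (j : Fin n) (σ : ℤˣ) (s : ℕ) : ℂ :=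
  ((y j ^ (σ : ℤ) : ℂˣ) : ℂ) * (q : ℂ) ^ s

/-- The radius of the small circle around a pole `p`: half the distance from `p` to the
other poles and to `0`. -/
def poleRadius {n : ℕ} (q : ℝ) (y : Torus n) (p : ℂ) : ℝ :=
  Metric.infDist p ((insert 0 {z | ∃ j σ s, z = pole q y j σ s}) \ {p}) / 2

/-- The branch of `x^λ` near the pole `p = y_j^{±1} q^s`. It is the principal one at
`y_j^{±1}`, it is continued along the ray from `y_j^{±1}` to `p`, and from there to the disc
`|x - p| < |p|`. -/
def branchPow {n : ℕ} (q lam : ℝ) (y : Torus n) (j : Fin n) (σ : ℤˣ) (s : ℕ) (x : ℂ) : ℂ :=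
  ((y j ^ (σ : ℤ) : ℂˣ) : ℂ) ^ (lam : ℂ) * (qPow q (lam * s) : ℂ) *
    (x / pole q y j σ s) ^ (lam : ℂ)

/-- The integrand `ψ Φ` (coefficient of `dx`) near the pole `y_j^{±1} q^s`. -/
def localForm {n : ℕ} (q t lam : ℝ) (ψ : ℂ → ℂ) (y : Torus n) (j : Fin n) (σ : ℤˣ) (s : ℕ)
    (x : ℂ) : ℂ :=
  ψ x * (branchPow q lam y j σ s x * jpProd q t y x / x)

/-- The integral of `ψ Φ` over the small positively oriented circle around `y_j^{±1} q^s`. -/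
def poleIntegral {n : ℕ} (q t lam : ℝ) (ψ : ℂ → ℂ) (y : Torus n) (j : Fin n) (σ : ℤˣ) (s : ℕ) :
    ℂ :=
  ∮ x in C(pole q y j σ s, poleRadius q y (pole q y j σ s)), localForm q t lam ψ y j σ s x

/-- The integrand `ψ Φ` on a circle around the origin (used for integral `λ` only, when `x^λ` is
single-valued). -/
def globalForm {n : ℕ} (q t lam : ℝ) (ψ : ℂ → ℂ) (y : Torus n) (x : ℂ) : ℂ :=
  ψ x * (x ^ (lam : ℂ) * jpProd q t y x / x)

/-- The radius of a circle around the origin that encloses all the poles of `Φ`. -/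
def bigRadius {n : ℕ} (y : Torus n) : ℝ := 1 + ∑ j, (‖(y j : ℂ)‖ + ‖(y j : ℂ)‖⁻¹)

/-- A fixed cycle for `Φ`: a linear combination, over `ℂ`, of
* the cycles `C_{j,±}` encircling counterclockwise the sequence of poles
  `y_j^{±1}, y_j^{±1} q, y_j^{±1} q², …` with multiplicities `mult` (the integrals `⟨φ_{w_i}⟩`
  over these infinite cycles converge when `q^{λ+1} t^{2n} < 1`; for `t ≤ 1` this always holds);
* the circle encircling counterclockwise all the poles (a closed curve for `x^λ` when `λ` is an
  integer), with multiplicity `loop`.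

That the cycle is fixed means that the multiplicities do not change under the translations
`y ↦ q^μ y`, `μ ∈ P^∨`; constants are allowed. -/
structure Cycle (n : ℕ) (q t lam : ℝ) where
  mult : Torus n → Fin n → ℤˣ → ℂ
  loop : Torus n → ℂ
  mult_scale : ∀ μ ∈ coweights n, ∀ y, mult (scale q μ y) = mult y
  loop_scale : ∀ μ ∈ coweights n, ∀ y, loop (scale q μ y) = loop y
  mult_support : (∃ y j σ, mult y j σ ≠ 0) → q ^ (lam + 1) * t ^ (2 * n) < 1
  loop_support : (∃ y, loop y ≠ 0) → ∃ k : ℤ, lam = k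

/-- `⟨ψ⟩ = ∫_C ψ Φ` at the point `y`. -/
def bracket {n : ℕ} {q t lam : ℝ} (C : Cycle n q t lam) (ψ : ℂ → ℂ) (y : Torus n) : ℂ :=
  (∑ j, ∑ σ : ℤˣ, C.mult y j σ * ∑' s : ℕ, poleIntegral q t lam ψ y j σ s) +
    C.loop y * ∮ x in C(0, bigRadius y), globalForm q t lam ψ y x

/-- The integral `∫_C ψ Φ` converges at the point `y`. -/
def BracketConverges {n : ℕ} {q t lam : ℝ} (C : Cycle n q t lam) (ψ : ℂ → ℂ) (y : Torus n) :
    Prop :=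
  (∀ j σ, C.mult y j σ ≠ 0 →
    (∀ s : ℕ, CircleIntegrable (localForm q t lam ψ y j σ s) (pole q y j σ s)
      (poleRadius q y (pole q y j σ s))) ∧
    Summable fun s : ℕ => poleIntegral q t lam ψ y j σ s) ∧
  (C.loop y ≠ 0 → CircleIntegrable (globalForm q t lam ψ y) 0 (bigRadius y))

/-! ### The vector `Ψ` -/

/-- The coset representatives: `w_1 = e` and `w_{k+1} = s_k w_k` for `1 ≤ k ≤ n`,
`w_{k+1} = s_{2n-k} w_k` for `n ≤ k ≤ 2n - 1`. -/
def wRep (n : ℕ) : ℕ → WeylC n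
  | 0 => 1
  | 1 => 1
  | k + 2 => refl (simpleRoot n (if k + 1 ≤ n then k + 1 else 2 * n - (k + 1))) * wRep n (k + 1)

/-- `h̄_{w_i} = ∑_g h_{w_i g}`, where `g` runs over the stabilizer of `ε_1` in `W`. -/
def hBar (n i : ℕ) : VMod n :=
  ∑ g : WeylC n with g.act (eps n 1) = eps n 1, hBasis (wRep n i * g)

/-- The rational functions `φ_{w_i}` of `x`, `1 ≤ i ≤ 2n`. -/
def phi {n : ℕ} (t : ℝ) (i : ℕ) (y : Torus n) (x : ℂ) : ℂ :=
  if i ≤ n then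
    (∏ μ ∈ Finset.univ.filter (fun μ : Fin n => (μ : ℕ) + 1 < i), (1 - (y μ : ℂ)⁻¹ / x)) /
      ∏ μ ∈ Finset.univ.filter (fun μ : Fin n => (μ : ℕ) + 1 ≤ i), (1 - t * ((y μ : ℂ)⁻¹ / x))
  else
    ((∏ μ ∈ Finset.univ.filter (fun μ : Fin n => 2 * n - i + 1 < (μ : ℕ) + 1), (1 - (y μ : ℂ) / x)) /
      ∏ μ ∈ Finset.univ.filter (fun μ : Fin n => 2 * n - i + 1 ≤ (μ : ℕ) + 1), (1 - t * ((y μ : ℂ) / x))) *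
    ∏ μ : Fin n, ((1 - (y μ : ℂ)⁻¹ / x) / (1 - t * ((y μ : ℂ)⁻¹ / x)))

/-- `Ψ = ∑_{1 ≤ i ≤ 2n} ⟨φ_{w_i}⟩ h̄_{w_i}`. -/
def Psi {n : ℕ} {q t lam : ℝ} (C : Cycle n q t lam) : VMod n :=
  ∑ i ∈ Finset.Icc 1 (2 * n), (fun y => bracket C (phi t i y) y : Coef n) • hBar n i

end

end QKZ

open scoped BigOperators

namespace QKZ
noncomputable section

/-! ### The infinite products -/


/-! The integrands are attached to an ordering of the `2n` parameters `e^{-c}`, where `c` runs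
through the vectors `±ε_j`. Put `d_c = e^{-c}/x` and `k(d) = (tqd)_∞/(d)_∞`. Apart from `x^λ dx/x`,
the form `Φ` is the product of all `k(d_c)(1 - t d_c)`. Multiplying by the function `φ` of index `β`
leaves the product of all `k(d_c)` times the factors `1 - d_c` for `c` before `β` and `1 - t d_c`
for `c` after `β`, in the order `ε_1, …, ε_n, -ε_n, …, -ε_1` (`phi_mul_jpProd`). The same recipe
makes sense for any ordering and any parameters.

Two operations act on such families. Exchanging two neighbours whose parameters have ratio `z`
transforms the family by a 2×2 block with the entries of an `R`-matrix (`poly_swap`). Carrying the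
last block of the ordering to the front while dividing its parameters by `q` does not change the
integrands of the other indices; those of the moved block change by the substitution `x ↦ qx`, so
their integrals acquire `q^{-λ}` (`Vals.rotate`). Both rest on elementary identities, the second on
`kern_mul`.

On the module side, `u = -λε_1` and the coefficients of `Ψ` at `h_w` depend on `wε_1` only. On
vectors of this kind an `R`-matrix acts through the signed indices (`rMatrix_label`), and after a
twist by `q^{λ⟨ν,β⟩}` it becomes an exchange of neighbours together with the mirror exchange
(`State.swap_short`, `State.swap_long`). The product `R_{τ(ε_i)}` thus carries `ε_i` to the middle,
flips it to `-ε_i`, carries it to the front, flips it back by an affine reflection realised through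
rotations (`State.affine`), and returns it to its place. The ordering is again the standard one,
with parameters taken at `q^{ε_i}y`, and the twist is that of `r_{τ(ε_i)}^{-1}`. The half-sum
product puts all `-ε_j` before all `ε_j`; one rotation and a dilation of `x` by a half power of `q`
finish this case (`rHalf_Psi`).

The integrals are handled through residues summed over full orbits `b q^ℤ`, and through circles of
any large radius (`HasBr`). Both are insensitive to the translations of `y` and to dilations of `x`,
so no deformation of contours depending on `y` is needed. Convergence is a ratio test: for any `ρ >
q t^{2n}`, consecutive residues near `0` have norm ratio at most `ρ` (`residue_ratio`), and the
branch of `x^λ` contributes `q^λ`. -/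

theorem summable_norm_geom {q : ℝ} (hq0 : 0 < q) (hq1 : q < 1) (a : ℂ) :
    Summable fun s : ℕ => ‖-(a * (q : ℂ) ^ s)‖ := by
  have : (fun s : ℕ => ‖-(a * (q : ℂ) ^ s)‖) = fun s : ℕ => ‖a‖ * q ^ s := by
    funext s
    rw [norm_neg, norm_mul, norm_pow, Complex.norm_real, Real.norm_eq_abs, abs_of_pos hq0]
  rw [this]
  exact (summable_geometric_of_lt_one hq0.le hq1).mul_left _

theorem multipliable_qPoch {q : ℝ} (hq0 : 0 < q) (hq1 : q < 1) (a : ℂ) :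
    Multipliable fun s : ℕ => 1 - a * (q : ℂ) ^ s := by
  simpa only [sub_eq_add_neg] using
    multipliable_one_add_of_summable (summable_norm_geom hq0 hq1 a)

theorem qPoch_ne_zero {q : ℝ} (hq0 : 0 < q) (hq1 : q < 1) {a : ℂ}
    (ha : ∀ s : ℕ, a * (q : ℂ) ^ s ≠ 1) : qPoch q a ≠ 0 := by
  have := tprod_one_add_ne_zero_of_summable (f := fun s : ℕ => -(a * (q : ℂ) ^ s))
    (fun s => by rw [← sub_eq_add_neg]; exact sub_ne_zero.2 (ha s).symm)
    (summable_norm_geom hq0 hq1 a)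
  simpa only [qPoch, sub_eq_add_neg] using this

theorem qPoch_eq_prod_mul {q : ℝ} (hq0 : 0 < q) (hq1 : q < 1) (a : ℂ) (k : ℕ) :
    qPoch q a = (∏ i ∈ Finset.range k, (1 - a * (q : ℂ) ^ i)) * qPoch q (a * (q : ℂ) ^ k) := by
  have h : Multipliable fun s : ℕ => 1 - a * (q : ℂ) ^ (s + k) := by
    have := multipliable_qPoch hq0 hq1 (a * (q : ℂ) ^ k)
    refine this.congr fun s => ?_
    ring
  rw [qPoch, ← Multipliable.prod_mul_tprod_nat_mul' (f := fun s => 1 - a * (q : ℂ) ^ s) h, qPoch]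
  congr 1
  refine tprod_congr fun s => ?_
  ring

theorem qPoch_eq_mul {q : ℝ} (hq0 : 0 < q) (hq1 : q < 1) (a : ℂ) :
    qPoch q a = (1 - a) * qPoch q (q * a) := by
  rw [qPoch_eq_prod_mul hq0 hq1 a 1]
  simp [mul_comm]

/-- The geometric series majorises the factors uniformly on compact sets, so the product converges
locally uniformly and its limit is entire. -/
theorem differentiable_qPoch {q : ℝ} (hq0 : 0 < q) (hq1 : q < 1) :
    Differentiable ℂ (qPoch q) := by
  have key : HasProdLocallyUniformlyOn (fun (s : ℕ) (a : ℂ) => 1 + -(a * (q : ℂ) ^ s))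
      (fun a => ∏' s : ℕ, (1 + -(a * (q : ℂ) ^ s))) Set.univ := by
    apply hasProdLocallyUniformlyOn_of_forall_compact isOpen_univ
    intro K _ hK
    obtain ⟨M, hM⟩ := hK.isBounded.exists_norm_le
    refine ((summable_geometric_of_lt_one hq0.le hq1).mul_left M).hasProdUniformlyOn_nat_one_add
      hK (.of_forall fun s x hx => ?_) (fun _ => by fun_prop)
    rw [norm_neg, norm_mul, norm_pow, Complex.norm_real, Real.norm_eq_abs, abs_of_pos hq0]
    exact mul_le_mul_of_nonneg_right (hM x hx) (by positivity)
  have := key.differentiableOn (.of_forall fun _ => by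
    simpa [Finset.prod_fn] using DifferentiableOn.finsetProd (fun _ _ => by fun_prop)) isOpen_univ
  have e : qPoch q = fun a => ∏' s : ℕ, (1 + -(a * (q : ℂ) ^ s)) := by
    funext a; simp only [qPoch, sub_eq_add_neg]
  rw [e]
  exact differentiableOn_univ.1 this

/-- The kernel `(tqd)_∞ / (d)_∞`. -/
def kern (q t : ℝ) (d : ℂ) : ℂ := qPoch q (q * (t * d)) / qPoch q d

theorem qPoch_div_qPoch {q : ℝ} (hq0 : 0 < q) (hq1 : q < 1) (t : ℝ) (d : ℂ) :
    qPoch q (t * d) / qPoch q d = kern q t d * (1 - t * d) := by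
  rw [qPoch_eq_mul hq0 hq1 (t * d), kern]; ring

/-- This follows from `(d')_∞ = (1 - d')(qd')_∞`. A shift of the argument by `q` trades a factor `1
- d'` for `1 - td`, the two kinds of factor standing before and after the chosen index in `poly`.
Both the rotations and the behaviour at `x = 0` come from this relation. -/
theorem kern_mul {q : ℝ} (hq0 : 0 < q) (hq1 : q < 1) (t : ℝ) {d d' : ℂ} (hd : d = q * d')
    (h : d' ≠ 1) : kern q t d' * (1 - d') = kern q t d * (1 - t * d) := by
  have h' : 1 - d' ≠ 0 := sub_ne_zero.2 h.symm
  rw [← qPoch_div_qPoch hq0 hq1, kern, qPoch_eq_mul hq0 hq1 d', ← hd]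
  have : (q : ℂ) * (t * d') = t * d := by rw [hd]; ring
  rw [this]
  field_simp

theorem differentiableAt_kern {q : ℝ} (hq0 : 0 < q) (hq1 : q < 1) (t : ℝ) {d : ℂ}
    (h : ∀ s : ℕ, d * (q : ℂ) ^ s ≠ 1) : DifferentiableAt ℂ (kern q t) d := by
  unfold kern
  refine DifferentiableAt.div ?_ (differentiable_qPoch hq0 hq1 d) (qPoch_ne_zero hq0 hq1 h)
  exact (differentiable_qPoch hq0 hq1 _).comp d (by fun_prop)

/-- `kern (c / x)` with its simple pole at `x = c q^s` removed. -/
def kernReg (q t : ℝ) (c : ℂ) (s : ℕ) (x : ℂ) : ℂ :=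
  x * qPoch q (q * (t * (c / x))) /
    ((∏ i ∈ Finset.range s, (1 - c / x * (q : ℂ) ^ i)) * qPoch q (c / x * (q : ℂ) ^ (s + 1)))

/-- The factor of index `s` in `(c/x)_∞` equals `(x - c q^s)/x` and is split off. -/
theorem kern_eq_kernReg {q : ℝ} (hq0 : 0 < q) (hq1 : q < 1) (t : ℝ) (c : ℂ) (s : ℕ) {x : ℂ}
    (hx : x ≠ 0) : kern q t (c / x) = (x - c * (q : ℂ) ^ s)⁻¹ * kernReg q t c s x := by
  rw [kern, kernReg, qPoch_eq_prod_mul hq0 hq1 (c / x) (s + 1), Finset.prod_range_succ]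
  have : 1 - c / x * (q : ℂ) ^ s = (x - c * (q : ℂ) ^ s) / x := by field_simp
  rw [this]
  simp only [div_eq_mul_inv, mul_inv, inv_inv]
  ring

theorem differentiableAt_kernReg {q : ℝ} (hq0 : 0 < q) (hq1 : q < 1) (t : ℝ) (c : ℂ) (s : ℕ)
    {x : ℂ} (hx : x ≠ 0) (h : ∀ i : ℕ, i ≠ s → x ≠ c * (q : ℂ) ^ i) :
    DifferentiableAt ℂ (kernReg q t c s) x := by
  have hne : ∀ i : ℕ, i ≠ s → c / x * (q : ℂ) ^ i ≠ 1 := by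
    intro i hi he
    apply h i hi
    field_simp at he
    exact he.symm
  have hdiv : DifferentiableAt ℂ (fun x : ℂ => c / x) x := by fun_prop (disch := exact hx)
  unfold kernReg
  refine DifferentiableAt.div ?_ (DifferentiableAt.mul ?_ ?_) (mul_ne_zero ?_ ?_)
  · exact differentiableAt_id.mul
      ((differentiable_qPoch hq0 hq1 _).comp x ((hdiv.const_mul _).const_mul _))
  · exact DifferentiableAt.fun_finsetProd fun i _ => (hdiv.mul_const _).const_sub _
  · exact (differentiable_qPoch hq0 hq1 _).comp x (hdiv.mul_const _)
  · refine Finset.prod_ne_zero_iff.2 fun i hi => sub_ne_zero.2 (hne i ?_).symm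
    exact (Finset.mem_range.1 hi).ne
  · refine qPoch_ne_zero hq0 hq1 fun i => ?_
    rw [mul_assoc, ← pow_add]
    exact hne _ (by omega)


/-! ### Signed indices -/

/-- The pair `(j, σ)` stands for the vector `σ ε_j`. -/
abbrev Label (n : ℕ) : Type := Fin n × ℤˣ

/-- The label of the opposite vector. -/
def opp {n : ℕ} (β : Label n) : Label n := (β.1, -β.2)

/-- The vector `σ ε_j`. -/
def vec {n : ℕ} (β : Label n) : Fin n → ℤ := Pi.single β.1 (β.2 : ℤ)

/-- The inner product of two signed coordinate vectors. -/
def ip {n : ℕ} (a b : Label n) : ℤ := if a = b then 1 else if a = opp b then -1 else 0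

@[simp] theorem opp_opp {n : ℕ} (β : Label n) : opp (opp β) = β := by simp [opp]

theorem opp_ne {n : ℕ} (β : Label n) : opp β ≠ β := by
  intro h
  have h2 : -β.2 = β.2 := congrArg Prod.snd h
  exact units_ne_neg_self _ h2.symm

theorem opp_injective {n : ℕ} : Function.Injective (opp (n := n)) :=
  Function.LeftInverse.injective opp_opp

theorem vec_opp {n : ℕ} (β : Label n) : vec (opp β) = -vec β := by
  simp [vec, opp, Pi.single_neg]

theorem vec_injective {n : ℕ} : Function.Injective (vec (n := n)) := by
  rintro ⟨i, σ⟩ ⟨j, τ⟩ h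
  by_cases hij : i = j
  · subst hij
    have := congrFun h i
    simp only [vec, Pi.single_eq_same] at this
    rw [Units.ext this]
  · have := congrFun h i
    simp only [vec, Pi.single_eq_same, Pi.single_eq_of_ne hij] at this
    exact absurd this σ.ne_zero

theorem eq_or_eq_opp {n : ℕ} {a b : Label n} (h : a.1 = b.1) : a = b ∨ a = opp b := by
  rcases Int.units_eq_one_or a.2 with ha | ha <;> rcases Int.units_eq_one_or b.2 with hb | hb <;>
    simp [Prod.ext_iff, opp, h, ha, hb]

theorem vec_dotProduct {n : ℕ} (a b : Label n) : vec a ⬝ᵥ vec b = ip a b := by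
  by_cases h : a.1 = b.1
  · rcases eq_or_eq_opp h with rfl | rfl
    · simp [ip, vec]
    · rw [ip, if_neg (opp_ne b), if_pos rfl]; simp [vec, opp]
  · have h1 : a ≠ b := fun e => h (by rw [e])
    have h2 : a ≠ opp b := fun e => h (by rw [e]; rfl)
    simp [ip, vec, h1, h2, Pi.single_eq_of_ne (Ne.symm h)]

theorem toE_dotProduct {n : ℕ} (v w : Fin n → ℤ) : toE v ⬝ᵥ toE w = ((v ⬝ᵥ w : ℤ) : ℝ) := by
  simp [toE, dotProduct]

theorem toE_injective {n : ℕ} : Function.Injective (toE (n := n)) := by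
  intro v w h
  funext k
  have := congrFun h k
  simpa [toE] using this

/-- The pairing of the root `a - b` with a signed coordinate vector. -/
def pairing {n : ℕ} (a b β : Label n) : ℤ :=
  if β = a ∨ β = opp b then 1 else if β = b ∨ β = opp a then -1 else 0

/-- The reflection in `a - b` on signed coordinate vectors. -/
def swapL {n : ℕ} (a b β : Label n) : Label n :=
  if β = a then b else if β = opp b then opp a else if β = b then a
  else if β = opp a then opp b else β

theorem ip_comm {n : ℕ} (a b : Label n) : ip a b = ip b a := by
  rw [← vec_dotProduct, ← vec_dotProduct, dotProduct_comm]

theorem ip_opp {n : ℕ} (a b : Label n) : ip (opp a) b = -ip a b := by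
  rw [← vec_dotProduct, ← vec_dotProduct, vec_opp, neg_dotProduct]

theorem ip_self {n : ℕ} (a : Label n) : ip a a = 1 := by simp [ip]

/-- Since `b = opp a` is allowed, differences `a - b` cover short and long roots alike; `1 - ip a b`
is half the squared length, and this uniform treatment persists below. -/
theorem ip_sub {n : ℕ} {a b : Label n} (β : Label n) :
    ip β a - ip β b = pairing a b β * (1 - ip a b) := by
  unfold pairing
  split_ifs with h1 h2
  · rcases h1 with rfl | rfl
    · rw [ip_self]; ring
    · rw [ip_opp, ip_opp, ip_self, ip_comm]; ring
  · rcases h2 with rfl | rfl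
    · rw [ip_self, ip_comm]; ring
    · rw [ip_opp, ip_opp, ip_self]; ring
  · push Not at h1 h2
    simp [ip, h1.1, h2.1, h2.2, h1.2]

theorem vec_swapL {n : ℕ} (a b β : Label n) :
    vec (swapL a b β) = vec β - pairing a b β • (vec a - vec b) := by
  unfold swapL pairing
  by_cases h1 : β = a
  · simp [h1]
  by_cases h2 : β = opp b
  · subst h2; simp [h1, vec_opp]; abel
  by_cases h3 : β = b
  · subst h3; simp [h1, h2]
  by_cases h4 : β = opp a
  · subst h4; simp [h1, h2, h3, vec_opp]; abel
  simp [h1, h2, h3, h4]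

theorem coroot_eq {n : ℕ} (a b : Label n) :
    coroot (vec a - vec b) = (1 / (1 - ip a b : ℝ)) • toE (vec a - vec b) := by
  have h : toE (vec a - vec b) ⬝ᵥ toE (vec a - vec b) = 2 * (1 - ip a b : ℝ) := by
    rw [toE_dotProduct, sub_dotProduct, dotProduct_sub, dotProduct_sub, vec_dotProduct,
      vec_dotProduct, vec_dotProduct, vec_dotProduct, ip_self, ip_self, ip_comm b a]
    push_cast; ring
  rw [coroot, h]
  congr 1
  rw [div_mul_eq_div_div]; norm_num

theorem ip_ne_one {n : ℕ} {a b : Label n} (h : a ≠ b) : (1 - ip a b : ℝ) ≠ 0 := by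
  have : ip a b ≠ 1 := by unfold ip; rw [if_neg h]; split_ifs <;> norm_num
  rw [sub_ne_zero]
  exact_mod_cast this.symm

theorem vec_dotProduct_toE {n : ℕ} (a b β : Label n) :
    toE (vec β) ⬝ᵥ toE (vec a - vec b) = pairing a b β * (1 - ip a b : ℝ) := by
  rw [toE_dotProduct, dotProduct_sub, vec_dotProduct, vec_dotProduct, ip_sub]; push_cast; ring

theorem coroot_dotProduct {n : ℕ} {a b : Label n} (h : a ≠ b) (β : Label n) :
    coroot (vec a - vec b) ⬝ᵥ toE (vec β) = pairing a b β := by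
  rw [coroot_eq, smul_dotProduct, dotProduct_comm, vec_dotProduct_toE, smul_eq_mul]
  have := ip_ne_one h
  field_simp

theorem toE_sub {n : ℕ} (v w : Fin n → ℤ) : toE (v - w) = toE v - toE w := by
  funext k; simp [toE]

theorem eps_eq_vec {n : ℕ} (i : Fin n) : eps n (i + 1) = vec (i, 1) := by
  apply toE_injective
  rw [toE_eps]; funext k
  by_cases h : k = i
  · subst h; simp [toE, vec]
  · simp [toE, vec, h]

theorem sub_mem_roots {n : ℕ} {a b : Label n} (h : a ≠ b) : vec a - vec b ∈ roots n := by
  have key : ∀ c d : Label n, c.1 < d.1 → vec c - vec d ∈ roots n := by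
    rintro ⟨i, σ⟩ ⟨j, τ⟩ hij
    have hij' : (i : ℕ) < j := hij
    have hpos : ∀ τ : ℤˣ, vec (i, 1) - vec (j, τ) ∈ posRoots n := by
      intro τ
      refine Or.inl ⟨i + 1, j + 1, by omega, by omega, by omega, ?_⟩
      rw [eps_eq_vec, eps_eq_vec]
      rcases Int.units_eq_one_or τ with rfl | rfl
      · exact Or.inr rfl
      · left; rw [show ((j, -1) : Label n) = opp (j, 1) from rfl, vec_opp, sub_neg_eq_add]
    rcases Int.units_eq_one_or σ with rfl | rfl
    · exact Or.inl (hpos τ)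
    · right
      have := hpos (-τ)
      rw [show ((j, -τ) : Label n) = opp (j, τ) from rfl, vec_opp] at this
      rw [show ((i, -1) : Label n) = opp (i, 1) from rfl, vec_opp]
      convert this using 1; abel
  rcases lt_trichotomy a.1 b.1 with h1 | h1 | h1
  · exact key _ _ h1
  · have hb := (eq_or_eq_opp h1).resolve_left h
    have hlong : ∀ i : Fin n, (2 : ℤ) • vec (i, 1) ∈ posRoots n := fun i =>
      Or.inr ⟨i + 1, by omega, by omega, by rw [eps_eq_vec]; norm_cast⟩
    have e : vec a - vec b = (2 : ℤ) • vec a := by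
      rw [hb, vec_opp]; rw [two_zsmul]; simp [sub_eq_add_neg]
    rw [e]
    obtain ⟨i, σ⟩ := a
    rcases Int.units_eq_one_or σ with rfl | rfl
    · exact Or.inl (hlong i)
    · right
      rw [show ((i, -1) : Label n) = opp (i, 1) from rfl, vec_opp, smul_neg, neg_neg]
      exact hlong i
  · have := key _ _ h1
    rcases this with h | h
    · right; simpa using h
    · left; simpa using h

/-! ### The Weyl group on signed indices -/

/-- The action of `W` on signed coordinate vectors. -/
def actL {n : ℕ} (w : WeylC n) (β : Label n) : Label n := (w.perm β.1, w.sign (w.perm β.1) * β.2)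

theorem act_vec {n : ℕ} (w : WeylC n) (β : Label n) : w.act (vec β) = vec (actL w β) := by
  funext k
  by_cases h : k = w.perm β.1
  · subst h; simp [WeylC.act, vec, actL]
  · have h' : w.perm.symm k ≠ β.1 := fun e => h (by rw [← e]; simp)
    simp [WeylC.act, vec, actL, h, h']

theorem act_mul {n : ℕ} {M : Type*} [AddCommGroup M] (w z : WeylC n) (v : Fin n → M) :
    (w * z).act v = w.act (z.act v) := by
  funext k
  simp [WeylC.act, mul_smul, Equiv.Perm.mul_def]

theorem act_toE {n : ℕ} (w : WeylC n) (v : Fin n → ℤ) : w.act (toE v) = toE (w.act v) := by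
  funext k; simp [WeylC.act, toE]

theorem act_sub {n : ℕ} (w : WeylC n) (u v : Fin n → ℤ) :
    w.act (u - v) = w.act u - w.act v := by
  funext k; simp [WeylC.act, mul_sub]

theorem act_one {n : ℕ} {M : Type*} [AddCommGroup M] (v : Fin n → M) :
    (1 : WeylC n).act v = v := by
  funext k; simp [WeylC.act, Equiv.Perm.one_def]

theorem actL_mul {n : ℕ} (w z : WeylC n) (β : Label n) :
    actL (w * z) β = actL w (actL z β) := by
  apply vec_injective
  rw [← act_vec, ← act_vec, ← act_vec, act_mul]

theorem actL_one {n : ℕ} (β : Label n) : actL (1 : WeylC n) β = β := by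
  apply vec_injective
  rw [← act_vec, act_one]

theorem actL_inv_actL {n : ℕ} (w : WeylC n) (β : Label n) : actL w⁻¹ (actL w β) = β := by
  rw [← actL_mul, inv_mul_cancel, actL_one]

theorem actL_opp {n : ℕ} (w : WeylC n) (β : Label n) : actL w (opp β) = opp (actL w β) := by
  simp [actL, opp]

/-- The vector `w ε_1`. -/
def label {n : ℕ} [NeZero n] (w : WeylC n) : Label n := actL w (0, 1)

theorem actL_refl {n : ℕ} {a b : Label n} (h : a ≠ b) (β : Label n) :
    actL (refl (vec a - vec b)) β = swapL a b β := by
  apply vec_injective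
  apply toE_injective
  rw [← act_vec, ← act_toE, refl_spec (sub_mem_roots h), vec_swapL, vec_dotProduct_toE, coroot_eq,
    smul_smul, toE_sub]
  have := ip_ne_one h
  rw [show (pairing a b β : ℝ) * (1 - ip a b) * (1 / (1 - ip a b)) = pairing a b β by field_simp]
  funext k; simp [toE]

theorem refl_mul_refl {n : ℕ} {a b : Label n} (h : a ≠ b) :
    refl (vec a - vec b) * refl (vec a - vec b) = 1 := by
  apply WeylC.act_injective
  intro x
  have hs := refl_spec (sub_mem_roots h)
  rw [act_mul, act_one, hs, hs x, sub_dotProduct, smul_dotProduct, coroot_eq, smul_dotProduct]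
  have h2 : toE (vec a - vec b) ⬝ᵥ toE (vec a - vec b) = 2 * (1 - ip a b : ℝ) := by
    rw [toE_sub, sub_dotProduct, ← toE_sub, vec_dotProduct_toE, vec_dotProduct_toE]
    have hp : pairing a b b = -1 := by
      rw [pairing, if_neg, if_pos (Or.inl rfl)]
      rintro (e | e)
      · exact h e.symm
      · exact opp_ne b e.symm
    rw [hp]; simp [pairing]; ring
  rw [h2]
  have := ip_ne_one h
  funext k
  simp
  field_simp
  ring

theorem label_refl_mul {n : ℕ} [NeZero n] {a b : Label n} (h : a ≠ b) (w : WeylC n) :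
    label (refl (vec a - vec b) * w) = swapL a b (label w) := by
  rw [label, actL_mul, actL_refl h]; rfl

/-! ### The `R`-matrices on vectors that depend on `w ε_1` only -/

theorem neg_notMem_posRoots {n : ℕ} {v : Fin n → ℤ} (h : v ∈ posRoots n) : -v ∉ posRoots n := by
  -- A linear functional that is positive on all positive roots: its value `n + 1 - i` on `ε_i` is
  -- positive and decreases with `i`.
  have key : ∀ v ∈ posRoots n, 0 < ∑ k : Fin n, ((n : ℤ) - k) * v k := by
    have he : ∀ i : ℕ, 1 ≤ i → i ≤ n → ∑ k : Fin n, ((n : ℤ) - k) * eps n i k = n + 1 - i := by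
      intro i hi hin
      obtain ⟨i, rfl⟩ := Nat.exists_eq_add_of_le' hi
      rw [Finset.sum_eq_single ⟨i, by omega⟩]
      · simp [eps]
      · intro k _ hk
        rw [eps, if_neg fun e => hk (Fin.ext (by simpa using e)), mul_zero]
      · simp
    rintro v (⟨i, j, hi, hij, hj, rfl | rfl⟩ | ⟨i, hi, hin, rfl⟩)
    · simp only [Pi.add_apply, mul_add, Finset.sum_add_distrib]
      rw [he i hi (by omega), he j (by omega) hj]; omega
    · simp only [Pi.sub_apply, mul_sub, Finset.sum_sub_distrib]
      rw [he i hi (by omega), he j (by omega) hj]; omega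
    · simp only [two_smul, Pi.add_apply, mul_add, Finset.sum_add_distrib]
      rw [he i hi hin]; omega
  intro h'
  have h1 := key v h
  have h2 := key _ h'
  simp only [Pi.neg_apply, mul_neg, Finset.sum_neg_distrib] at h2
  omega

theorem pos_of_fst {n : ℕ} [NeZero n] {c : Label n} (h : c ≠ (0, 1)) :
    vec (0, 1) - vec c ∈ posRoots n := by
  have h0 : (0 : Fin n) = ⟨0, Nat.pos_of_ne_zero (NeZero.ne n)⟩ := rfl
  have e0 : vec ((0 : Fin n), (1 : ℤˣ)) = eps n 1 := by rw [← eps_eq_vec]; simp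
  obtain ⟨j, τ⟩ := c
  by_cases hj : j = 0
  · subst hj
    rcases Int.units_eq_one_or τ with rfl | rfl
    · exact absurd rfl h
    · refine Or.inr ⟨1, le_rfl, Nat.pos_of_ne_zero (NeZero.ne n), ?_⟩
      rw [show ((0, -1) : Label n) = opp (0, 1) from rfl, vec_opp, e0, sub_neg_eq_add, two_smul]
  · have hj' : 0 < (j : ℕ) := Nat.pos_of_ne_zero fun e => hj (Fin.ext (by simpa using e))
    refine Or.inl ⟨1, j + 1, le_rfl, by omega, by omega, ?_⟩
    rw [e0, eps_eq_vec]
    rcases Int.units_eq_one_or τ with rfl | rfl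
    · exact Or.inr rfl
    · left; rw [show ((j, -1) : Label n) = opp (j, 1) from rfl, vec_opp, sub_neg_eq_add]

theorem posRoots_fst_nonneg {n : ℕ} [NeZero n] {v : Fin n → ℤ} (h : v ∈ posRoots n) : 0 ≤ v 0 := by
  rcases h with ⟨i, j, hi, hij, hj, rfl | rfl⟩ | ⟨i, hi, hin, rfl⟩
  · simp only [Pi.add_apply, eps]; split_ifs <;> simp
  · simp only [Pi.sub_apply, eps]
    rw [if_neg (show ¬ ((0 : Fin n) : ℕ) + 1 = j by simp; omega)]
    split_ifs <;> simp
  · simp only [Pi.smul_apply, eps]; split_ifs <;> simp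

theorem not_pos_of_snd {n : ℕ} [NeZero n] {c : Label n} (h : c ≠ (0, 1)) :
    vec c - vec (0, 1) ∉ posRoots n := by
  intro hp
  have := posRoots_fst_nonneg hp
  obtain ⟨j, τ⟩ := c
  by_cases hj : j = 0
  · subst hj
    rcases Int.units_eq_one_or τ with rfl | rfl
    · exact absurd rfl h
    · simp [vec] at this
  · rw [Pi.sub_apply, vec, vec] at this
    simp only [Pi.single_eq_of_ne (Ne.symm hj)] at this
    simp at this

/-- Here `w⁻¹` sends `a` or `-b` to `ε_1`, and `ε_1 - c` is a positive root for every other signed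
vector `c`. The sign of `w⁻¹(a - b)` is therefore decided by `wε_1` alone. -/
theorem mem_posRoots_of_pairing {n : ℕ} [NeZero n] {a b : Label n} (hab : a ≠ b) (w : WeylC n)
    (h : label w = a ∨ label w = opp b) : (w⁻¹).act (vec a - vec b) ∈ posRoots n := by
  rw [act_sub, act_vec, act_vec]
  rcases h with h | h
  · rw [← h, label, actL_inv_actL]
    refine pos_of_fst fun e => hab ?_
    rw [← h, label, ← e, ← actL_mul, mul_inv_cancel, actL_one]
  · have hb : b = opp (label w) := by rw [h, opp_opp]
    have e1 : actL w⁻¹ b = opp (0, 1) := by rw [hb, actL_opp, label, actL_inv_actL]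
    rw [e1, vec_opp, sub_neg_eq_add, add_comm, ← sub_neg_eq_add, ← vec_opp]
    refine pos_of_fst fun e => hab ?_
    have : actL w⁻¹ a = actL w⁻¹ b := by rw [e1, ← e, opp_opp]
    have := congrArg (actL w) this
    rwa [← actL_mul, ← actL_mul, mul_inv_cancel, actL_one, actL_one] at this

theorem notMem_posRoots_of_pairing {n : ℕ} [NeZero n] {a b : Label n} (hab : a ≠ b) (w : WeylC n)
    (h : label w = b ∨ label w = opp a) : (w⁻¹).act (vec a - vec b) ∉ posRoots n := by
  have := mem_posRoots_of_pairing hab.symm w h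
  rw [act_sub, act_vec, act_vec] at this ⊢
  intro h'
  have hne : actL w⁻¹ a ≠ actL w⁻¹ b := fun e => hab (by
    have := congrArg (actL w) e
    rwa [← actL_mul, ← actL_mul, mul_inv_cancel, actL_one, actL_one] at this)
  rcases h with h | h
  · have e : actL w⁻¹ b = (0, 1) := by rw [← h, label, actL_inv_actL]
    rw [e] at h' hne
    exact not_pos_of_snd hne h'
  · have ha : a = opp (label w) := by rw [h, opp_opp]
    have e1 : actL w⁻¹ a = opp (0, 1) := by rw [ha, actL_opp, label, actL_inv_actL]
    rw [e1] at h' hne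
    rw [vec_opp, ← neg_add', add_comm, neg_add', ← vec_opp] at h'
    exact not_pos_of_snd (fun e => hne (by rw [← e, opp_opp])) h'

/-- The operator on functions of `w ε_1` induced by `R_{a - b + mδ}`, where `z = q^m e^{a-b}`. -/
def labelR {n : ℕ} (t : ℝ) (tw : ℂˣ) (z : ℂ) (a b : Label n) (H : Label n → ℂ) (β : Label n) : ℂ :=
  if β = a ∨ β = opp b then
    (1 - z) / (1 - t * z) * H β + tw * (z * (1 - t) / (1 - t * z)) * H (swapL a b β)
  else if β = b ∨ β = opp a then
    t * (1 - z) / (1 - t * z) * H β + (tw⁻¹ : ℂˣ) * ((1 - t) / (1 - t * z)) * H (swapL a b β)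
  else H β

theorem tRoot_self {n : ℕ} (t : ℝ) (α : Fin n → ℤ) : tRoot t t α = t := by simp [tRoot]

open Classical in
-- Passage from the columns of the matrix to its rows: as `s_α` is an involution, only `h_w` and
-- `h_{s_α w}` contribute to the coefficient at `w`, and the off-diagonal entry is governed by the
-- sign belonging to `s_α w`.
theorem rMatrix_apply {n : ℕ} (q t₁ t₂ : ℝ) (u : Fin n → ℝ) {a b : Label n} (h : a ≠ b) (m : ℤ)
    (F : VMod n) (w : WeylC n) (y : Torus n) :
    rMatrix q t₁ t₂ u (vec a - vec b) m F w y =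
      (if (w⁻¹).act (vec a - vec b) ∈ posRoots n then coefA q t₁ t₂ (vec a - vec b) m y
        else coefC q t₁ t₂ (vec a - vec b) m y) * F w y +
      (if ((refl (vec a - vec b) * w)⁻¹).act (vec a - vec b) ∈ posRoots n then
          coefB q t₁ t₂ (vec a - vec b) m y
        else coefD q t₁ t₂ (vec a - vec b) m y) *
      (qPow q (m * (coroot (vec a - vec b) ⬝ᵥ (refl (vec a - vec b) * w).act u)) : ℂ) *
        F (refl (vec a - vec b) * w) y := by
  set s := refl (vec a - vec b) with hs
  have hss : s * s = 1 := refl_mul_refl h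
  have e : rMatrix q t₁ t₂ u (vec a - vec b) m F w y = ∑ w' : WeylC n,
      ((if (w'⁻¹).act (vec a - vec b) ∈ posRoots n then coefA q t₁ t₂ (vec a - vec b) m y
        else coefC q t₁ t₂ (vec a - vec b) m y) * F w' y * (if w = w' then 1 else 0) +
      (if (w'⁻¹).act (vec a - vec b) ∈ posRoots n then
          coefB q t₁ t₂ (vec a - vec b) m y
        else coefD q t₁ t₂ (vec a - vec b) m y) *
      (qPow q (m * (coroot (vec a - vec b) ⬝ᵥ w'.act u)) : ℂ) *
        F w' y * (if s * w = w' then 1 else 0)) := by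
    rw [rMatrix, Fintype.linearCombination_apply, Finset.sum_apply, Finset.sum_apply]
    refine Finset.sum_congr rfl fun w' _ => ?_
    have h1 : ∀ v v' : WeylC n, hBasis v v' y = if v' = v then 1 else 0 := by
      intro v v'
      by_cases hv : v' = v
      · subst hv; simp [hBasis]
      · simp [hBasis, hv]
    have h2 : (w = s * w') = (s * w = w') := by
      apply propext
      constructor
      · rintro rfl; rw [← mul_assoc, hss, one_mul]
      · rintro rfl; rw [← mul_assoc, hss, one_mul]
    split_ifs with hp
    all_goals
      simp only [Pi.smul_apply, Pi.add_apply, smul_eq_mul, Pi.mul_apply, ← hs, h1, h2]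
      split_ifs <;> ring
  rw [e, Finset.sum_add_distrib]
  simp only [mul_ite, mul_one, mul_zero, Finset.sum_ite_eq, Finset.mem_univ, if_true]

theorem swapL_cases_pos {n : ℕ} {a b β : Label n} (h : β = a ∨ β = opp b) :
    swapL a b β = b ∨ swapL a b β = opp a := by
  unfold swapL
  rcases h with rfl | rfl
  · simp
  · by_cases h : opp b = a <;> simp [h]

theorem swapL_cases_neg {n : ℕ} {a b β : Label n} (h : β = b ∨ β = opp a)
    (h' : ¬ (β = a ∨ β = opp b)) :
    swapL a b β = a ∨ swapL a b β = opp b := by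
  push Not at h'
  unfold swapL
  rw [if_neg h'.1, if_neg h'.2]
  rcases h with rfl | rfl
  · simp
  · by_cases h : opp a = b <;> simp [h]

theorem swapL_eq_self {n : ℕ} {a b β : Label n} (h : ¬ (β = a ∨ β = opp b))
    (h' : ¬ (β = b ∨ β = opp a)) : swapL a b β = β := by
  push Not at h h'
  simp [swapL, h.1, h.2, h'.1, h'.2]

/-- Whenever `wε_1` is not orthogonal to the root, it determines the signs for `w` and `s_α w`, and
the power of `q` is `q^{±λm}`. In the orthogonal case the sign is not determined, but it does not
matter. -/
theorem rMatrix_label {n : ℕ} [NeZero n] {q t lam : ℝ} {a b : Label n} (hab : a ≠ b)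
    (m : ℤ) {y : Torus n} (hy : (t : ℂ) * affExpo q (vec a - vec b) m y ≠ 1) {F : VMod n}
    {H : Label n → ℂ} (hF : ∀ w, F w y = H (label w)) (w : WeylC n) :
    rMatrix q t t ((-lam) • toE (eps n 1)) (vec a - vec b) m F w y =
      labelR t (qPow q (lam * m)) (affExpo q (vec a - vec b) m y) a b H (label w) := by
  classical
  have e0 : eps n 1 = vec ((0 : Fin n), (1 : ℤˣ)) := by rw [← eps_eq_vec]; simp
  have hu : ∀ v : WeylC n, v.act ((-lam) • toE (eps n 1)) = (-lam) • toE (vec (label v)) := by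
    intro v
    rw [e0, label, ← act_vec, ← act_toE]
    funext k; simp [WeylC.act]; ring
  have hz : (1 : ℂ) - t * affExpo q (vec a - vec b) m y ≠ 0 := sub_ne_zero.2 hy.symm
  rw [rMatrix_apply q t t _ hab, hu, dotProduct_smul, coroot_dotProduct hab, hF, hF,
    label_refl_mul hab]
  simp only [coefA, coefB, coefC, coefD, tRoot_self]
  unfold labelR
  by_cases h1 : label w = a ∨ label w = opp b
  · have h2 := swapL_cases_pos h1
    have hn := notMem_posRoots_of_pairing hab (refl (vec a - vec b) * w)
      (by rw [label_refl_mul hab]; exact h2)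
    have hp : pairing a b (swapL a b (label w)) = -1 := by
      rw [pairing, if_neg, if_pos h2]
      rintro (h3 | h3)
      · rcases h2 with h2 | h2
        · exact hab (h3.symm.trans h2)
        · exact opp_ne a (h2.symm.trans h3)
      · rcases h2 with h2 | h2
        · exact opp_ne b (h3.symm.trans h2)
        · exact hab (opp_injective (h2.symm.trans h3))
    rw [if_pos (mem_posRoots_of_pairing hab w h1), if_neg hn, if_pos h1, hp]
    rw [show (m : ℝ) * (-lam • ((-1 : ℤ) : ℝ)) = lam * m by push_cast; simp; ring]
    ring
  · by_cases h2 : label w = b ∨ label w = opp a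
    · have h3 := swapL_cases_neg h2 h1
      have hn := mem_posRoots_of_pairing hab (refl (vec a - vec b) * w)
        (by rw [label_refl_mul hab]; exact h3)
      rw [if_neg (notMem_posRoots_of_pairing hab w h2), if_pos hn, if_neg h1, if_pos h2]
      rw [pairing, if_pos h3]
      have : qPow q (m * (-lam • ((1 : ℤ) : ℝ))) = (qPow q (lam * m))⁻¹ := by
        rw [eq_inv_iff_mul_eq_one, ← qPow_add, ← qPow_zero q]
        congr 1; push_cast; simp; ring
      rw [this]
      ring
    -- Now `wε_1` is orthogonal to the root, so `w` and `s_α w` have the same label and the power of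
    -- `q` is `1`. The two coefficients add up to `1` for either sign: `(1 - z) + z(1 - t) = t(1 -
    -- z) + (1 - t) = 1 - tz`.
    · rw [if_neg h1, if_neg h2, swapL_eq_self h1 h2, pairing, if_neg h1, if_neg h2]
      have hr : label (refl (vec a - vec b) * w) = label w := by
        rw [label_refl_mul hab, swapL_eq_self h1 h2]
      have hiff : ((refl (vec a - vec b) * w)⁻¹).act (vec a - vec b) ∈ posRoots n ↔
          (w⁻¹).act (vec a - vec b) ∉ posRoots n := by
        have h4 : (refl (vec a - vec b)).act (vec a - vec b) = -(vec a - vec b) := by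
          rw [act_sub, act_vec, act_vec, actL_refl hab, actL_refl hab]
          simp [swapL, hab.symm, (opp_ne b).symm]
        have h5 : (refl (vec a - vec b))⁻¹ = refl (vec a - vec b) :=
          inv_eq_of_mul_eq_one_left (refl_mul_refl hab)
        have h6 : ∀ x : Fin n → ℤ, (w⁻¹).act (-x) = -(w⁻¹).act x := by
          intro x; funext k; simp [WeylC.act]
        rw [mul_inv_rev, h5, act_mul, h4, h6]
        rw [act_sub, act_vec, act_vec]
        have hne : actL w⁻¹ a ≠ actL w⁻¹ b := fun e => hab (by
          have := congrArg (actL w) e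
          rwa [← actL_mul, ← actL_mul, mul_inv_cancel, actL_one, actL_one] at this)
        exact ⟨fun h h' => neg_notMem_posRoots h' h, (sub_mem_roots hne).resolve_left⟩
      have hq : qPow q (m * (-lam • ((0 : ℤ) : ℝ))) = 1 := by simp [qPow_zero]
      rw [hq]
      by_cases hp : (w⁻¹).act (vec a - vec b) ∈ posRoots n
      · rw [if_pos hp, if_neg (by rw [hiff]; exact not_not.2 hp)]
        simp only [Units.val_one]; linear_combination H (label w) * mul_inv_cancel₀ hz
      · rw [if_neg hp, if_pos (hiff.2 hp)]
        simp only [Units.val_one]; linear_combination H (label w) * mul_inv_cancel₀ hz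


/-! ### Integration functionals on single-valued integrands -/

open Filter Topology

/-- `r` is the residue of `f` at `p`, where `f` has at most a simple pole. -/
def HasRes (f : ℂ → ℂ) (p r : ℂ) : Prop := Tendsto (fun x => (x - p) * f x) (𝓝[≠] p) (𝓝 r)

/-- The sum of the integrals of `x^λ f` around the points of `b q^ℤ`, with the branch of `x^λ`
that is principal at `b`. -/
def HasOrbit (q lam : ℝ) (b : ℂ) (f : ℂ → ℂ) (v : ℂ) : Prop :=
  ∃ r : ℤ → ℂ, (∀ s : ℤ, HasRes f (qPow q s * b) (r s)) ∧
    HasSum (fun s : ℤ => 2 * Real.pi * Complex.I * (b ^ (lam : ℂ) * qPow q (lam * s) * r s)) v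

/-- The integral of `x^λ f` over all large circles. -/
def HasLoop (lam : ℝ) (f : ℂ → ℂ) (v : ℂ) : Prop :=
  ∀ᶠ R : ℝ in atTop, CircleIntegrable (fun x => x ^ (lam : ℂ) * f x) 0 R ∧
    (∮ x in C(0, R), x ^ (lam : ℂ) * f x) = v

/-- The character `e^β` for a signed coordinate vector `β`. -/
def point {n : ℕ} (y : Torus n) (β : Label n) : ℂ := ((y β.1 ^ (β.2 : ℤ) : ℂˣ) : ℂ)

/-- The integral of `x^λ f` over a cycle with given multiplicities. -/
def HasBr {n : ℕ} (q lam : ℝ) (mult : Label n → ℂ) (loop : ℂ) (y : Torus n) (f : ℂ → ℂ) (v : ℂ) :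
    Prop :=
  ∃ (a : Label n → ℂ) (b : ℂ), (∀ β, mult β ≠ 0 → HasOrbit q lam (point y β) f (a β)) ∧
    (loop ≠ 0 → HasLoop lam f b) ∧ v = ∑ β, mult β * a β + loop * b

theorem HasRes.add {f g : ℂ → ℂ} {p r s : ℂ} (hf : HasRes f p r) (hg : HasRes g p s) :
    HasRes (fun x => f x + g x) p (r + s) := by
  have := Tendsto.add hf hg
  simpa only [HasRes, mul_add] using this

theorem HasRes.const_mul {f : ℂ → ℂ} {p r : ℂ} (hf : HasRes f p r) (c : ℂ) :
    HasRes (fun x => c * f x) p (c * r) := by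
  have := Tendsto.const_mul c hf
  simpa only [HasRes, mul_left_comm c] using this

/-- Identities between integrands may fail at the finitely many points where a denominator vanishes
and division returns `0`. A limit over a punctured neighbourhood does not see them. -/
theorem HasRes.congr {f g : ℂ → ℂ} {p r : ℂ} (hf : HasRes f p r) (h : {x | f x ≠ g x}.Finite) :
    HasRes g p r := by
  refine Tendsto.congr' ?_ hf
  have h1 : ({x | f x ≠ g x} \ {p})ᶜ ∈ 𝓝 p :=
    (h.subset Set.sdiff_subset).isClosed.isOpen_compl.mem_nhds (by simp)
  filter_upwards [mem_nhdsWithin_of_mem_nhds h1, self_mem_nhdsWithin] with x hx hxp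
  have : f x = g x := by
    by_contra hne
    exact hx ⟨hne, hxp⟩
  rw [this]

theorem HasRes.comp_mul {f : ℂ → ℂ} {p r c : ℂ} (hc : c ≠ 0) (hf : HasRes f (c * p) r) :
    HasRes (fun x => c * f (c * x)) p r := by
  have h1 : Tendsto (fun x => c * x) (𝓝[≠] p) (𝓝[≠] (c * p)) := by
    refine tendsto_nhdsWithin_of_tendsto_nhds_of_eventually_within _ ?_ ?_
    · exact ((continuous_const_mul c).tendsto p).mono_left nhdsWithin_le_nhds
    · filter_upwards [self_mem_nhdsWithin] with x hx
      exact fun e => hx (mul_left_cancel₀ hc e)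
  refine (Tendsto.comp hf h1).congr fun x => ?_
  simp only [Function.comp]; ring

/-- Multiplication by a positive real does not change the argument, so it is compatible with the
principal branch. -/
theorem qPow_mul_cpow (q a lam : ℝ) {b : ℂ} (hb : b ≠ 0) :
    ((qPow q a : ℂ) * b) ^ (lam : ℂ) = qPow q (a * lam) * b ^ (lam : ℂ) := by
  have h : (qPow q a : ℂ) = ((Real.exp (a * Real.log q) : ℝ) : ℂ) := by simp [qPow]
  rw [Complex.cpow_def_of_ne_zero (mul_ne_zero (Units.ne_zero _) hb), h,
    Complex.log_ofReal_mul (Real.exp_pos _) hb, Real.log_exp, add_mul, Complex.exp_add,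
    ← Complex.cpow_def_of_ne_zero hb]
  congr 1
  simp only [qPow, Units.val_mk0]
  congr 1
  push_cast; ring

theorem HasOrbit.add {q lam : ℝ} {b : ℂ} {f g : ℂ → ℂ} {v w : ℂ} (hf : HasOrbit q lam b f v)
    (hg : HasOrbit q lam b g w) : HasOrbit q lam b (fun x => f x + g x) (v + w) := by
  obtain ⟨r, h1, h2⟩ := hf
  obtain ⟨r', h1', h2'⟩ := hg
  refine ⟨fun s => r s + r' s, fun s => (h1 s).add (h1' s), ?_⟩
  simpa only [mul_add] using h2.add h2'

theorem HasOrbit.const_mul {q lam : ℝ} {b : ℂ} {f : ℂ → ℂ} {v : ℂ} (hf : HasOrbit q lam b f v)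
    (c : ℂ) : HasOrbit q lam b (fun x => c * f x) (c * v) := by
  obtain ⟨r, h1, h2⟩ := hf
  refine ⟨fun s => c * r s, fun s => (h1 s).const_mul c, ?_⟩
  simpa only [mul_left_comm c] using h2.mul_left c

theorem HasOrbit.congr {q lam : ℝ} {b : ℂ} {f g : ℂ → ℂ} {v : ℂ} (hf : HasOrbit q lam b f v)
    (h : {x | f x ≠ g x}.Finite) : HasOrbit q lam b g v := by
  obtain ⟨r, h1, h2⟩ := hf
  exact ⟨r, fun s => (h1 s).congr h, h2⟩

/-- Dilation of `x` by `q^a` turns the orbit of `b` into that of `q^{-a}b`, and the integer `k` is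
absorbed by reindexing. This is the gain from summing over all of `ℤ`, although the actual cycles
use `s ≥ 0` only. -/
theorem HasOrbit.scale {q lam : ℝ} {b : ℂ} (hb : b ≠ 0) {f : ℂ → ℂ} {v : ℂ}
    (hf : HasOrbit q lam b f v) (a : ℝ) (k : ℤ) :
    HasOrbit q lam (qPow q (k - a) * b) (fun x => qPow q a * f (qPow q a * x))
      (qPow q (-(a * lam)) * v) := by
  obtain ⟨r, h1, h2⟩ := hf
  refine ⟨fun s => r (s + k), fun s => HasRes.comp_mul (Units.ne_zero _) ?_, ?_⟩
  · convert h1 (s + k) using 1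
    rw [← mul_assoc, ← mul_assoc, ← Units.val_mul, ← Units.val_mul, ← qPow_add, ← qPow_add]
    congr 3; push_cast; ring
  · have h3 := (Equiv.addRight k).hasSum_iff.2 h2
    refine (congrArg (fun F : ℤ → ℂ => HasSum F (qPow q (-(a * lam)) * v)) (funext fun s => ?_)).mp
      (h3.mul_left (qPow q (-(a * lam)) : ℂ))
    have e : (qPow q ((k - a) * lam) : ℂ) * qPow q (lam * s) =
        qPow q (-(a * lam)) * qPow q (lam * ((s + k : ℤ) : ℝ)) := by
      rw [← Units.val_mul, ← Units.val_mul, ← qPow_add, ← qPow_add]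
      congr 2; push_cast; ring
    simp only [Function.comp, Equiv.coe_addRight]
    rw [qPow_mul_cpow q _ lam hb]
    linear_combination (2 * Real.pi * Complex.I * b ^ (lam : ℂ) * r (s + k)) * (-e)

theorem HasLoop.add {lam : ℝ} {f g : ℂ → ℂ} {v w : ℂ} (hf : HasLoop lam f v)
    (hg : HasLoop lam g w) : HasLoop lam (fun x => f x + g x) (v + w) := by
  filter_upwards [hf, hg] with R h1 h2
  simp only [mul_add]
  exact ⟨h1.1.add h2.1, by rw [circleIntegral.integral_add h1.1 h2.1, h1.2, h2.2]⟩

theorem HasLoop.const_mul {lam : ℝ} {f : ℂ → ℂ} {v : ℂ} (hf : HasLoop lam f v) (c : ℂ) :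
    HasLoop lam (fun x => c * f x) (c * v) := by
  filter_upwards [hf] with R h1
  simp only [mul_left_comm _ c]
  refine ⟨?_, by rw [circleIntegral.integral_const_mul, h1.2]⟩
  exact IntervalIntegrable.const_mul h1.1 c

theorem HasLoop.congr {lam : ℝ} {f g : ℂ → ℂ} {v : ℂ} (hf : HasLoop lam f v)
    (h : {x | f x ≠ g x}.Finite) : HasLoop lam g v := by
  obtain ⟨M, hM⟩ := h.isBounded.exists_norm_le
  filter_upwards [hf, eventually_gt_atTop M, eventually_ge_atTop 0] with R h1 h2 h0
  have key : ∀ x ∈ Metric.sphere (0 : ℂ) R, f x = g x := by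
    intro x hx
    by_contra hne
    have := hM x hne
    rw [mem_sphere_zero_iff_norm] at hx
    linarith
  refine ⟨?_, ?_⟩
  · refine (circleIntegrable_congr fun x hx => ?_).1 h1.1
    rw [abs_of_nonneg h0] at hx
    simp only [key x hx]
  · rw [← h1.2]
    exact circleIntegral.integral_congr h0 fun x hx => by simp only [key x hx]

/-- The dilation maps a large circle to another large circle, and all of these give the same
integral. -/
theorem HasLoop.scale {q lam : ℝ} {f : ℂ → ℂ} {v : ℂ} (hf : HasLoop lam f v) (a : ℝ) :
    HasLoop lam (fun x => qPow q a * f (qPow q a * x)) (qPow q (-(a * lam)) * v) := by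
  have hpos : 0 < Real.exp (a * Real.log q) := Real.exp_pos _
  have hc : (qPow q a : ℂ) = ((Real.exp (a * Real.log q) : ℝ) : ℂ) := by simp [qPow]
  have hinv : (qPow q (-(a * lam)) : ℂ) * qPow q (a * lam) = 1 := by
    rw [← Units.val_mul, ← qPow_add]; simp [qPow_zero]
  have ht : Tendsto (fun R : ℝ => Real.exp (a * Real.log q) * R) atTop atTop :=
    tendsto_id.const_mul_atTop hpos
  filter_upwards [ht.eventually hf, eventually_gt_atTop 0] with R h1 h0
  have hcm : ∀ θ, circleMap 0 (Real.exp (a * Real.log q) * R) θ = qPow q a * circleMap 0 R θ := by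
    intro θ; rw [hc]; simp [circleMap]; ring
  have key : ∀ θ, (circleMap 0 R θ) ^ (lam : ℂ) * (qPow q a * f (qPow q a * circleMap 0 R θ)) =
      (qPow q (-(a * lam)) * qPow q a) * ((circleMap 0 (Real.exp (a * Real.log q) * R) θ) ^ (lam : ℂ) *
        f (circleMap 0 (Real.exp (a * Real.log q) * R) θ)) := by
    intro θ
    rw [hcm, qPow_mul_cpow q a lam (circleMap_ne_center h0.ne')]
    linear_combination (-(circleMap 0 R θ ^ (lam : ℂ) * (qPow q a * f (qPow q a * circleMap 0 R θ)))) *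
      hinv
  refine ⟨?_, ?_⟩
  · have := IntervalIntegrable.const_mul h1.1 (qPow q (-(a * lam)) * qPow q a : ℂ)
    unfold CircleIntegrable
    simp only [key]
    exact this
  · rw [← h1.2, ← circleIntegral.integral_const_mul]
    unfold circleIntegral
    refine intervalIntegral.integral_congr fun θ _ => ?_
    simp only [smul_eq_mul, key, deriv_circleMap, hcm]
    ring

theorem point_ne_zero {n : ℕ} (y : Torus n) (β : Label n) : point y β ≠ 0 := Units.ne_zero _

section HasBr

variable {n : ℕ} {q lam : ℝ} {mult : Label n → ℂ} {loop : ℂ} {y : Torus n} {f g : ℂ → ℂ} {v w : ℂ}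

theorem HasBr.add (hf : HasBr q lam mult loop y f v) (hg : HasBr q lam mult loop y g w) :
    HasBr q lam mult loop y (fun x => f x + g x) (v + w) := by
  obtain ⟨a, b, h1, h2, rfl⟩ := hf
  obtain ⟨a', b', h1', h2', rfl⟩ := hg
  refine ⟨fun β => a β + a' β, b + b', fun β hβ => (h1 β hβ).add (h1' β hβ),
    fun h => (h2 h).add (h2' h), ?_⟩
  simp only [mul_add, Finset.sum_add_distrib]; ring

theorem HasBr.const_mul (hf : HasBr q lam mult loop y f v) (c : ℂ) :
    HasBr q lam mult loop y (fun x => c * f x) (c * v) := by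
  obtain ⟨a, b, h1, h2, rfl⟩ := hf
  refine ⟨fun β => c * a β, c * b, fun β hβ => (h1 β hβ).const_mul c,
    fun h => (h2 h).const_mul c, ?_⟩
  rw [mul_add, Finset.mul_sum]
  simp only [mul_left_comm c]

theorem HasBr.congr (hf : HasBr q lam mult loop y f v) (h : {x | f x ≠ g x}.Finite) :
    HasBr q lam mult loop y g v := by
  obtain ⟨a, b, h1, h2, rfl⟩ := hf
  exact ⟨a, b, fun β hβ => (h1 β hβ).congr h, fun hl => (h2 hl).congr h, rfl⟩

/-- Only the classes of the base points modulo `q^ℤ` matter. The case `a = 0` expresses that the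
cycle is fixed under translations, `a = ±1` serves the rotations, and `a = -1/2` the half-sum
translation. -/
theorem HasBr.scale (hf : HasBr q lam mult loop y f v) (a : ℝ) {y' : Torus n}
    (hy : ∀ β, ∃ k : ℤ, point y' β = qPow q (k - a) * point y β) :
    HasBr q lam mult loop y' (fun x => qPow q a * f (qPow q a * x)) (qPow q (-(a * lam)) * v) := by
  obtain ⟨c, b, h1, h2, rfl⟩ := hf
  refine ⟨fun β => qPow q (-(a * lam)) * c β, qPow q (-(a * lam)) * b, fun β hβ => ?_,
    fun h => (h2 h).scale a, ?_⟩
  · obtain ⟨k, hk⟩ := hy β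
    rw [hk]
    exact (h1 β hβ).scale (point_ne_zero y β) a k
  · rw [mul_add, Finset.mul_sum]
    simp only [mul_left_comm (qPow q (-(a * lam)) : ℂ)]

end HasBr


/-! ### The integrands attached to an ordering of the parameters -/

theorem prod_kern {L : Type*} {q : ℝ} (hq0 : 0 < q) (hq1 : q < 1) (t : ℝ) {d d' : L → ℂ} (S : List L)
    (h : ∀ c ∈ S, d c = q * d' c) (h' : ∀ c ∈ S, d' c ≠ 1) :
    (S.map fun c => kern q t (d' c)).prod * (S.map fun c => 1 - d' c).prod =
      (S.map fun c => kern q t (d c)).prod * (S.map fun c => 1 - t * d c).prod := by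
  rw [← List.prod_map_mul, ← List.prod_map_mul]
  congr 1
  exact List.map_congr_left fun c hc => kern_mul hq0 hq1 t (h c hc) (h' c hc)

/-! ### Rational factors attached to an ordered list: exchange and rotation. -/

section Poly

variable {L : Type*} [DecidableEq L]

/-- The numerators of the rational functions attached to a list of parameters. -/
def poly (t : ℝ) (d : L → ℂ) : List L → L → ℂ
  | [], _ => 0
  | c :: l, β => if β = c then (l.map fun e => 1 - t * d e).prod else (1 - d c) * poly t d l β

theorem poly_append_of_mem (t : ℝ) (d : L → ℂ) (P Q : List L) {β : L} (h : β ∈ P) :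
    poly t d (P ++ Q) β = poly t d P β * (Q.map fun e => 1 - t * d e).prod := by
  induction P with
  | nil => simp at h
  | cons c P ih =>
    simp only [List.cons_append, poly]
    split_ifs with hc
    · simp
    · rw [ih ((List.mem_cons.1 h).resolve_left hc)]; ring

theorem poly_append_of_notMem (t : ℝ) (d : L → ℂ) (P Q : List L) {β : L} (h : β ∉ P) :
    poly t d (P ++ Q) β = (P.map fun e => 1 - d e).prod * poly t d Q β := by
  induction P with
  | nil => simp
  | cons c P ih =>
    rw [List.mem_cons, not_or] at h
    simp only [List.cons_append, poly, if_neg h.1, ih h.2, List.map_cons, List.prod_cons]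
    ring

theorem poly_congr (t : ℝ) {d d' : L → ℂ} {P : List L} (h : ∀ c ∈ P, d c = d' c) (β : L) :
    poly t d P β = poly t d' P β := by
  induction P with
  | nil => rfl
  | cons c P ih =>
    have h1 := h c List.mem_cons_self
    have h2 : ∀ e ∈ P, d e = d' e := fun e he => h e (List.mem_cons_of_mem _ he)
    have h3 : (P.map fun e => 1 - t * d e) = P.map fun e => 1 - t * d' e :=
      List.map_congr_left fun e he => by rw [h2 e he]
    simp only [poly, ih h2, h1, h3]

/-- The transformation of values under an exchange of the neighbours `a`, `b` in the ordering. -/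
def swapVals (t : ℝ) (z : ℂ) (a b : L) (G : L → ℂ) (β : L) : ℂ :=
  if β = a then (1 - z) / (1 - t * z) * G a + z * (1 - t) / (1 - t * z) * G b
  else if β = b then t * (1 - z) / (1 - t * z) * G b + (1 - t) / (1 - t * z) * G a
  else G β

/-- Only the factors of `a` and `b` change; those of `P` and `Q` are common to both sides. With `d =
d a` the two cases are `(1-z)(1-tzd) + z(1-t)(1-d) = (1-tz)(1-zd)` and `t(1-z)(1-d) + (1-t)(1-tzd) =
(1-tz)(1-td)`. -/
theorem poly_swap (t : ℝ) {d : L → ℂ} {z : ℂ} {a b : L} (hab : a ≠ b) {P : List L} (Q : List L)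
    (ha : a ∉ P) (hb : b ∉ P) (hz : (t : ℂ) * z ≠ 1) (hd : d b = z * d a) (β : L) :
    poly t d (P ++ b :: a :: Q) β = swapVals t z a b (poly t d (P ++ a :: b :: Q)) β := by
  have hz' : (1 : ℂ) - t * z ≠ 0 := sub_ne_zero.2 hz.symm
  unfold swapVals
  split_ifs with h1 h2
  · subst h1
    simp only [poly_append_of_notMem t d _ _ ha, poly_append_of_notMem t d _ _ hb, poly, if_true,
      if_neg hab, if_neg hab.symm, List.map_cons, List.prod_cons, hd]
    linear_combination (-(P.map fun e => 1 - d e).prod * (Q.map fun e => 1 - t * d e).prod *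
      (1 - z * d β)) * mul_inv_cancel₀ hz'
  · subst h2
    simp only [poly_append_of_notMem t d _ _ ha, poly_append_of_notMem t d _ _ hb, poly, if_true,
      if_neg hab, if_neg hab.symm, List.map_cons, List.prod_cons, hd]
    linear_combination (-(P.map fun e => 1 - d e).prod * (Q.map fun e => 1 - t * d e).prod *
      (1 - t * d a)) * mul_inv_cancel₀ hz'
  · by_cases h : β ∈ P
    · rw [poly_append_of_mem t d _ _ h, poly_append_of_mem t d _ _ h]
      simp only [List.map_cons, List.prod_cons]; ring
    · rw [poly_append_of_notMem t d _ _ h, poly_append_of_notMem t d _ _ h]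
      simp only [poly, if_neg h1, if_neg h2]; ring

/-- The integrand (without the factor `x^λ`) attached to the position of `β` in the list `l`. -/
def form (q t : ℝ) (v : L → ℂ) (l : List L) (β : L) (x : ℂ) : ℂ :=
  (l.map fun c => kern q t (v c / x)).prod * poly t (fun c => v c / x) l β / x

theorem form_swap (q t : ℝ) {v : L → ℂ} {z : ℂ} {a b : L} (hab : a ≠ b) {P : List L} (Q : List L)
    (ha : a ∉ P) (hb : b ∉ P) (hz : (t : ℂ) * z ≠ 1) (hv : v b = z * v a) (β : L) (x : ℂ) :
    form q t v (P ++ b :: a :: Q) β x =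
      swapVals t z a b (fun c => form q t v (P ++ a :: b :: Q) c x) β := by
  have hp : ((P ++ b :: a :: Q).map fun c => kern q t (v c / x)).prod =
      ((P ++ a :: b :: Q).map fun c => kern q t (v c / x)).prod :=
    (((List.Perm.swap a b Q).append_left P).map _).prod_eq
  have h := poly_swap t (d := fun c => v c / x) hab Q ha hb hz (by simp only [hv]; ring) β
  unfold form
  rw [hp, h]
  unfold swapVals
  split_ifs <;> ring

/-- The block `Q` stands after `β` on the left and before `β` on the right, so `kern_mul` converts
its factors one by one. -/
theorem form_rotate_of_mem {q : ℝ} (hq0 : 0 < q) (hq1 : q < 1) (t : ℝ) {v v' : L → ℂ}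
    {P Q : List L} (hP : ∀ c ∈ P, v' c = v c) (hQ : ∀ c ∈ Q, v c = q * v' c) {β : L} (hβ : β ∈ P)
    (hβ' : β ∉ Q) {x : ℂ} (hx : x ≠ 0) (hx' : ∀ c, x ≠ v' c) :
    form q t v (P ++ Q) β x = form q t v' (Q ++ P) β x := by
  have h1 := prod_kern hq0 hq1 t (d := fun c => v c / x) (d' := fun c => v' c / x) Q
    (fun c hc => by simp only [hQ c hc]; ring)
    (fun c _ e => hx' c (by field_simp at e; exact e.symm))
  have h2 : (P.map fun c => kern q t (v' c / x)) = P.map fun c => kern q t (v c / x) :=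
    List.map_congr_left fun c hc => by rw [hP c hc]
  have h3 : poly t (fun c => v' c / x) P β = poly t (fun c => v c / x) P β :=
    poly_congr t (fun c hc => by simp only [hP c hc]) β
  unfold form
  rw [poly_append_of_mem t _ P Q hβ, poly_append_of_notMem t _ Q P hβ', h3]
  simp only [List.map_append, List.prod_append, h2]
  linear_combination (-(P.map fun c => kern q t (v c / x)).prod *
    poly t (fun c => v c / x) P β / x) * h1

/-- At the argument `qx` the moved block already has the new values `v'/x`. It is now `P` that is
shifted by `q`, while it passes from before `β` to after `β`. -/
theorem form_rotate_of_notMem {q : ℝ} (hq0 : 0 < q) (hq1 : q < 1) (t : ℝ) {v v' : L → ℂ}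
    {P Q : List L} (hP : ∀ c ∈ P, v' c = v c) (hQ : ∀ c ∈ Q, v c = q * v' c) {β : L} (hβ : β ∉ P)
    (hβ' : β ∈ Q) {x : ℂ} (hx : x ≠ 0) (hx' : ∀ c, q * x ≠ v c) :
    q * form q t v (P ++ Q) β (q * x) = form q t v' (Q ++ P) β x := by
  have hq : (q : ℂ) ≠ 0 := by exact_mod_cast hq0.ne'
  have h1 := prod_kern hq0 hq1 t (d := fun c => v' c / x) (d' := fun c => v c / (q * x)) P
    (fun c hc => by simp only [hP c hc]; field_simp)
    (fun c _ e => hx' c (by rw [div_eq_one_iff_eq (mul_ne_zero hq hx)] at e; exact e.symm))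
  have h2 : (Q.map fun c => kern q t (v c / (q * x))) = Q.map fun c => kern q t (v' c / x) :=
    List.map_congr_left fun c hc => by rw [hQ c hc, mul_div_mul_left _ _ hq]
  have h3 : poly t (fun c => v c / (q * x)) Q β = poly t (fun c => v' c / x) Q β :=
    poly_congr t (fun c hc => by simp only [hQ c hc]; rw [mul_div_mul_left _ _ hq]) β
  unfold form
  rw [poly_append_of_notMem t _ P Q hβ, poly_append_of_mem t _ Q P hβ', h3]
  simp only [List.map_append, List.prod_append, h2]
  have h4 : (q : ℂ) * ((q * x)⁻¹) = x⁻¹ := by field_simp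
  simp only [div_eq_mul_inv] at h1 ⊢
  linear_combination ((Q.map fun c => kern q t (v' c * x⁻¹)).prod *
    poly t (fun c => v' c * x⁻¹) Q β * x⁻¹) * h1 + ((P.map fun c => kern q t (v c * (q * x)⁻¹)).prod *
      (P.map fun c => 1 - v c * (q * x)⁻¹).prod * (Q.map fun c => kern q t (v' c * x⁻¹)).prod *
    poly t (fun c => v' c * x⁻¹) Q β) * h4

end Poly

/-! ### Exchange and rotation for the vectors of integrals. -/

section Vals

variable {n : ℕ} {q t lam : ℝ} {mult : Label n → ℂ} {loop : ℂ} {y : Torus n}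

/-- `G β` is the integral of the integrand attached to `β`. -/
def Vals (q t lam : ℝ) (mult : Label n → ℂ) (loop : ℂ) (y : Torus n) (v : Label n → ℂ)
    (l : List (Label n)) (G : Label n → ℂ) : Prop :=
  ∀ β, HasBr q lam mult loop y (form q t v l β) (G β)

theorem qPow_one (hq0 : 0 < q) : (qPow q 1 : ℂ) = q := by
  rw [qPow_eq hq0]; simp

theorem qPow_neg (q a : ℝ) : qPow q (-a) = (qPow q a)⁻¹ := by
  rw [eq_inv_iff_mul_eq_one, ← qPow_add]; simp [qPow_zero]

theorem Vals.swap {v : Label n → ℂ} {z : ℂ} {a b : Label n} (hab : a ≠ b) {P Q : List (Label n)}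
    {G : Label n → ℂ} (h : Vals q t lam mult loop y v (P ++ a :: b :: Q) G)
    (ha : a ∉ P) (hb : b ∉ P) (hz : (t : ℂ) * z ≠ 1) (hv : v b = z * v a) :
    Vals q t lam mult loop y v (P ++ b :: a :: Q) (swapVals t z a b G) := by
  intro β
  have e : form q t v (P ++ b :: a :: Q) β =
      fun x => swapVals t z a b (fun c => form q t v (P ++ a :: b :: Q) c x) β :=
    funext fun x => form_swap q t hab Q ha hb hz hv β x
  rw [e]
  unfold swapVals
  split_ifs
  · exact ((h a).const_mul _).add ((h b).const_mul _)
  · exact ((h b).const_mul _).add ((h a).const_mul _)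
  · exact h β

theorem finite_exceptional (v w : Label n → ℂ) :
    {x : ℂ | x = 0 ∨ (∃ c, x = v c) ∨ ∃ c, x = w c}.Finite := by
  have : {x : ℂ | x = 0 ∨ (∃ c, x = v c) ∨ ∃ c, x = w c} =
      insert 0 (Set.range v ∪ Set.range w) := by
    ext x; simp [eq_comm]
  rw [this]
  exact ((Set.finite_range v).union (Set.finite_range w)).insert 0

theorem Vals.rotate (hq0 : 0 < q) (hq1 : q < 1) {v v' : Label n → ℂ} {P Q : List (Label n)}
    {G : Label n → ℂ} (h : Vals q t lam mult loop y v (P ++ Q) G)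
    (hP : ∀ c ∈ P, v' c = v c) (hQ : ∀ c ∈ Q, v c = q * v' c)
    (hmem : ∀ c, c ∈ P ∧ c ∉ Q ∨ c ∉ P ∧ c ∈ Q) :
    Vals q t lam mult loop y v' (Q ++ P)
      (fun β => if β ∈ P then G β else qPow q (-lam) * G β) := by
  have hq : (q : ℂ) ≠ 0 := by exact_mod_cast hq0.ne'
  intro β
  rcases hmem β with ⟨h1, h2⟩ | ⟨h1, h2⟩
  · simp only [if_pos h1]
    refine (h β).congr ((finite_exceptional v' v').subset fun x hx => ?_)
    by_contra hne
    simp only [Set.mem_ofPred_eq, not_or, not_exists] at hne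
    exact hx (form_rotate_of_mem hq0 hq1 t hP hQ h1 h2 hne.1 hne.2.1)
  · simp only [if_neg h1]
    -- Substitution `x ↦ qx`: the exponent `k = 1` cancels `a = 1`, so the base points stay where
    -- they are and only `q^{-λ}` appears.
    have h3 := (h β).scale (y' := y) 1 fun β => ⟨1, by simp [qPow_zero]⟩
    rw [one_mul, qPow_one hq0] at h3
    refine h3.congr ((finite_exceptional (fun c => v c / q) v').subset fun x hx => ?_)
    by_contra hne
    simp only [Set.mem_ofPred_eq, not_or, not_exists] at hne
    refine hx (form_rotate_of_notMem hq0 hq1 t hP hQ h1 h2 hne.1 fun c e => hne.2.1 c ?_)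
    rw [← e]; field_simp

theorem Vals.unrotate (hq0 : 0 < q) (hq1 : q < 1) {v v' : Label n → ℂ} {P Q : List (Label n)}
    {G : Label n → ℂ} (h : Vals q t lam mult loop y v' (Q ++ P) G)
    (hP : ∀ c ∈ P, v' c = v c) (hQ : ∀ c ∈ Q, v c = q * v' c)
    (hmem : ∀ c, c ∈ P ∧ c ∉ Q ∨ c ∉ P ∧ c ∈ Q) :
    Vals q t lam mult loop y v (P ++ Q) (fun β => if β ∈ P then G β else qPow q lam * G β) := by
  have hq : (q : ℂ) ≠ 0 := by exact_mod_cast hq0.ne'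
  intro β
  rcases hmem β with ⟨h1, h2⟩ | ⟨h1, h2⟩
  · simp only [if_pos h1]
    refine (h β).congr ((finite_exceptional v' v').subset fun x hx => ?_)
    by_contra hne
    simp only [Set.mem_ofPred_eq, not_or, not_exists] at hne
    exact hx (form_rotate_of_mem hq0 hq1 t hP hQ h1 h2 hne.1 hne.2.1).symm
  · simp only [if_neg h1]
    have h3 := (h β).scale (y' := y) (-1) fun β => ⟨-1, by simp [qPow_zero]⟩
    rw [neg_one_mul, neg_neg, qPow_neg, Units.val_inv_eq_inv_val, qPow_one hq0] at h3
    refine h3.congr ((finite_exceptional v v').subset fun x hx => ?_)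
    by_contra hne
    simp only [Set.mem_ofPred_eq, not_or, not_exists] at hne
    apply hx
    have h4 := form_rotate_of_notMem hq0 hq1 t hP hQ h1 h2 (x := (q : ℂ)⁻¹ * x)
      (mul_ne_zero (inv_ne_zero hq) hne.1) (fun c e => hne.2.1 c (by
        rw [← e]; field_simp))
    rw [← h4, mul_inv_cancel_left₀ hq, inv_mul_cancel_left₀ hq]

end Vals


/-! ### Moving along the chain of `R`-matrices -/

/-! ### Characters and parameters at translated points. -/

section Points

variable {n : ℕ} {q : ℝ}

theorem point_opp (y : Torus n) (β : Label n) : point y (opp β) = (point y β)⁻¹ := by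
  simp [point, opp]

theorem toE_vec_dotProduct (μ : Fin n → ℝ) (β : Label n) :
    μ ⬝ᵥ toE (vec β) = μ β.1 * ((β.2 : ℤ) : ℝ) := by
  have : toE (vec β) = Pi.single β.1 ((β.2 : ℤ) : ℝ) := by
    funext k
    by_cases h : k = β.1
    · subst h; simp [toE, vec]
    · simp [toE, vec, h]
  rw [this, dotProduct_single]

theorem point_scale (q : ℝ) (μ : Fin n → ℝ) (y : Torus n) (β : Label n) :
    point (scale q μ y) β = qPow q (μ ⬝ᵥ toE (vec β)) * point y β := by
  rw [toE_vec_dotProduct]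
  obtain ⟨j, σ⟩ := β
  rcases Int.units_eq_one_or σ with rfl | rfl
  · simp [point, scale]
  · simp [point, scale, qPow_neg, mul_comm]

theorem expo_vec (β : Label n) (y : Torus n) : expo (vec β) y = point y β := by
  rw [expo, point, Finset.prod_eq_single β.1]
  · simp [vec]
  · intro k _ hk; simp [vec, hk]
  · simp

theorem expo_sub (v w : Fin n → ℤ) (y : Torus n) : expo (v - w) y = expo v y / expo w y := by
  simp [expo, zpow_sub, ← div_eq_mul_inv, Finset.prod_div_distrib]

theorem qPow_intCast (hq0 : 0 < q) (m : ℤ) : (qPow q m : ℂ) = (q : ℂ) ^ m := by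
  rw [qPow_eq hq0, Real.rpow_intCast]; push_cast; rfl

theorem affExpo_eq (hq0 : 0 < q) (a b : Label n) (m : ℤ) (y : Torus n) :
    affExpo q (vec a - vec b) m y = qPow q m * (point y a / point y b) := by
  rw [affExpo, expo_sub, expo_vec, expo_vec, qPow_intCast hq0]

/-- The parameters attached to signed indices, at the point `q^ν y`. -/
def vals (q : ℝ) (y : Torus n) (ν : Fin n → ℤ) (β : Label n) : ℂ :=
  point (scale q (toE ν) y) (opp β)

/-- The parameter of `β` at `q^ν y` is `q^{-⟨ν,β⟩}e^{-β}`. Hence the ratio of two parameters is the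
argument of an affine `R`-matrix exactly when `⟨ν, a - b⟩` is the level `m`. -/
theorem vals_eq_mul (hq0 : 0 < q) (y : Torus n) {ν : Fin n → ℤ} {a b : Label n} {m : ℤ}
    (hm : ν ⬝ᵥ (vec a - vec b) = m) :
    vals q y ν b = affExpo q (vec a - vec b) m y * vals q y ν a := by
  rw [affExpo_eq hq0, vals, vals, point_opp, point_opp, point_scale, point_scale,
    toE_dotProduct, toE_dotProduct, ← hm, dotProduct_sub]
  push_cast
  rw [sub_eq_add_neg, qPow_add, qPow_neg]
  have h1 := point_ne_zero y a
  have h2 := point_ne_zero y b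
  have h3 := Units.ne_zero (qPow q ((ν ⬝ᵥ vec a : ℤ) : ℝ))
  have h4 := Units.ne_zero (qPow q ((ν ⬝ᵥ vec b : ℤ) : ℝ))
  push_cast
  field_simp

end Points

/-! ### Mirror-symmetric orderings of the signed indices and single `R`-matrices. -/

section Chain

variable {n : ℕ}

/-- The ordering of all signed indices determined by its first half. -/
def full (h : List (Label n)) : List (Label n) := h ++ (h.map opp).reverse

/-- `h` contains exactly one of `±ε_j` for each `j`. -/
def IsHalf (h : List (Label n)) : Prop := (h.map Prod.fst).Perm (List.finRange n)

theorem IsHalf.notMem_of_append {P Q : List (Label n)} {a b : Label n} (h : IsHalf (P ++ Q))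
    (ha : a ∈ P) (hb : b ∈ Q) : a.1 ≠ b.1 := by
  have h1 := h.nodup_iff.2 (List.nodup_finRange n)
  rw [List.map_append, List.nodup_append'] at h1
  intro e
  exact h1.2.2 (List.mem_map_of_mem ha) (by rw [e]; exact List.mem_map_of_mem hb)

theorem IsHalf.perm {h h' : List (Label n)} (hh : IsHalf h)
    (e : (h'.map Prod.fst).Perm (h.map Prod.fst)) : IsHalf h' := e.trans hh

theorem IsHalf.mem_iff {h : List (Label n)} (hh : IsHalf h) (β : Label n) :
    β ∈ h ∧ opp β ∉ h ∨ β ∉ h ∧ opp β ∈ h := by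
  have h1 := hh.nodup_iff.2 (List.nodup_finRange n)
  have h2 : β.1 ∈ h.map Prod.fst := (List.Perm.mem_iff hh).2 (List.mem_finRange _)
  have h3 : ∀ a b : Label n, a ∈ h → b ∈ h → a.1 = b.1 → a = b := fun a b ha hb e =>
    List.inj_on_of_nodup_map h1 ha hb e
  obtain ⟨γ, hγ, e⟩ := List.mem_map.1 h2
  rcases eq_or_eq_opp e with rfl | rfl
  · exact Or.inl ⟨hγ, fun h' => opp_ne γ (h3 _ _ h' hγ rfl)⟩
  · exact Or.inr ⟨fun h' => opp_ne β (h3 _ _ hγ h' rfl), hγ⟩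

theorem labelR_long (t : ℝ) (tw : ℂˣ) (z : ℂ) (a : Label n) (H : Label n → ℂ) (β : Label n) :
    labelR t tw z a (opp a) H β =
      if β = a then (1 - z) / (1 - t * z) * H a + tw * (z * (1 - t) / (1 - t * z)) * H (opp a)
      else if β = opp a then
        t * (1 - z) / (1 - t * z) * H (opp a) + (tw⁻¹ : ℂˣ) * ((1 - t) / (1 - t * z)) * H a
      else H β := by
  unfold labelR
  simp only [opp_opp, or_self]
  split_ifs with h1 h2
  · subst h1; simp [swapL]
  · subst h2; simp [swapL, opp_ne]
  · rfl

variable [NeZero n] {q t lam : ℝ} {mult : Label n → ℂ} {loop : ℂ} {y : Torus n}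

/-- At the point `y` the vector `F` is given by integrals attached to the ordering `full h` of the
parameters at `q^ν y`. -/
def State (q t lam : ℝ) (mult : Label n → ℂ) (loop : ℂ) (y : Torus n) (ν : Fin n → ℤ)
    (h : List (Label n)) (F : VMod n) : Prop :=
  ∃ G, Vals q t lam mult loop y (vals q y ν) (full h) G ∧
    ∀ w, F w y = qPow q (lam * (ν ⬝ᵥ vec (label w) : ℤ)) * G (label w)

/-- The `R`-matrix `R_{a - b + mδ}` of the theorem. -/
abbrev rMat (q t lam : ℝ) (a b : Label n) (m : ℤ) : Module.End (Coef n) (VMod n) :=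
  rMatrix q t t ((-lam) • toE (eps n 1)) (vec a - vec b) m

/-- The last entry of the first half is the neighbour of its opposite in the full ordering, so one
exchange suffices. The factor `q^{λm}` in the `R`-matrix is the quotient of the twists at `a` and
`-a`. -/
theorem State.swap_long (hq0 : 0 < q) {ν : Fin n → ℤ} {P : List (Label n)} {a : Label n}
    (hy : ∀ m, (t : ℂ) * affExpo q (vec a - vec (opp a)) m y ≠ 1) {m : ℤ}
    (hm : ν ⬝ᵥ (vec a - vec (opp a)) = m) (hh : IsHalf (P ++ [a])) {F : VMod n}
    (hF : State q t lam mult loop y ν (P ++ [a]) F) :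
    State q t lam mult loop y ν (P ++ [opp a]) (rMat q t lam a (opp a) m F) := by
  obtain ⟨G, hG, hFG⟩ := hF
  have e1 : full (P ++ [a]) = P ++ a :: opp a :: (P.map opp).reverse := by simp [full]
  have e2 : full (P ++ [opp a]) = P ++ opp a :: a :: (P.map opp).reverse := by simp [full]
  have ha : a ∉ P := fun h => hh.notMem_of_append h (List.mem_singleton_self a) rfl
  have hb : opp a ∉ P := fun h => hh.notMem_of_append h (List.mem_singleton_self a) rfl
  rw [e1] at hG
  refine ⟨_, by rw [e2]; exact hG.swap (opp_ne a).symm ha hb (hy m) (vals_eq_mul hq0 y hm), ?_⟩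
  intro w
  rw [rMat, rMatrix_label (H := fun β => qPow q (lam * (ν ⬝ᵥ vec β : ℤ)) * G β) (opp_ne a).symm m
    (hy m) hFG, labelR_long, swapVals]
  have h3 : qPow q (lam * (ν ⬝ᵥ vec a : ℤ)) =
      qPow q (lam * m) * qPow q (lam * (ν ⬝ᵥ vec (opp a) : ℤ)) := by
    rw [← qPow_add, ← hm, dotProduct_sub]; congr 1; push_cast; ring
  split_ifs with h1 h2
  · rw [h1, h3]; push_cast; ring
  · have h4 := Units.ne_zero (qPow q (lam * m))
    rw [h2, h3]; push_cast; field_simp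
  · rfl

/-- The full ordering contains the neighbours `a, b` and, in its mirror half, `-b, -a`. One
`R`-matrix performs both exchanges, which involve disjoint sets of indices. -/
theorem State.swap_short (hq0 : 0 < q) {ν : Fin n → ℤ} {P Q : List (Label n)} {a b : Label n}
    (hy : ∀ m, (t : ℂ) * affExpo q (vec a - vec b) m y ≠ 1) {m : ℤ}
    (hm : ν ⬝ᵥ (vec a - vec b) = m) (hh : IsHalf (P ++ a :: b :: Q)) {F : VMod n}
    (hF : State q t lam mult loop y ν (P ++ a :: b :: Q) F) :
    State q t lam mult loop y ν (P ++ b :: a :: Q) (rMat q t lam a b m F) := by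
  obtain ⟨G, hG, hFG⟩ := hF
  have e1 : full (P ++ a :: b :: Q) =
      P ++ a :: b :: (Q ++ ((Q.map opp).reverse ++ opp b :: opp a :: (P.map opp).reverse)) := by
    simp [full]
  have e2 : full (P ++ b :: a :: Q) =
      (P ++ b :: a :: (Q ++ (Q.map opp).reverse)) ++ opp a :: opp b :: (P.map opp).reverse := by
    simp [full]
  have e3 : P ++ b :: a :: (Q ++ ((Q.map opp).reverse ++ opp b :: opp a :: (P.map opp).reverse)) =
      (P ++ b :: a :: (Q ++ (Q.map opp).reverse)) ++ opp b :: opp a :: (P.map opp).reverse := by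
    simp
  have hab : a.1 ≠ b.1 := by
    have : IsHalf ((P ++ [a]) ++ b :: Q) := by simpa using hh
    exact this.notMem_of_append (by simp) (by simp)
  have hne : a ≠ b := fun e => hab (by rw [e])
  have hne' : a ≠ opp b := fun e => hab (by rw [e]; rfl)
  have hne'' : b ≠ opp a := fun e => hab (by rw [e]; rfl)
  have haP : ∀ c ∈ P, c.1 ≠ a.1 := fun c hc => hh.notMem_of_append hc (by simp)
  have hbP : ∀ c ∈ P, c.1 ≠ b.1 := fun c hc => hh.notMem_of_append hc (by simp)
  have hhQ : IsHalf ((P ++ [a, b]) ++ Q) := by simpa using hh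
  have haQ : ∀ c ∈ Q, a.1 ≠ c.1 := fun c hc => hhQ.notMem_of_append (by simp) hc
  have hbQ : ∀ c ∈ Q, b.1 ≠ c.1 := fun c hc => hhQ.notMem_of_append (by simp) hc
  have h5 : ∀ c : Label n, c.1 = a.1 ∨ c.1 = b.1 → c ≠ a → c ≠ b →
      c ∉ P ++ b :: a :: (Q ++ (Q.map opp).reverse) := by
    intro c hc hca hcb hmem
    simp only [List.mem_append, List.mem_cons, List.mem_reverse, List.mem_map] at hmem
    rcases hmem with hmem | hmem | hmem | hmem | ⟨d, hd, rfl⟩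
    · exact hc.elim (haP c hmem) (hbP c hmem)
    · exact hcb hmem
    · exact hca hmem
    · exact hc.elim (fun e => haQ c hmem e.symm) (fun e => hbQ c hmem e.symm)
    · exact hc.elim (fun e => haQ d hd e.symm) (fun e => hbQ d hd e.symm)
  rw [e1] at hG
  have hG1 := hG.swap hne (fun h => haP a h rfl) (fun h => hbP b h rfl) (hy m)
    (vals_eq_mul hq0 y hm)
  rw [e3] at hG1
  -- Since `(-b) - (-a) = a - b`, the mirror exchange has the same level and the same `z`.
  have hm' : ν ⬝ᵥ (vec (opp b) - vec (opp a)) = m := by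
    rw [← hm, vec_opp, vec_opp]; congr 1; abel
  have haff : affExpo q (vec (opp b) - vec (opp a)) m y = affExpo q (vec a - vec b) m y := by
    rw [vec_opp, vec_opp]; congr 1; abel
  have hv' := vals_eq_mul hq0 y hm'
  rw [haff] at hv'
  have hG2 := hG1.swap (fun e => hne (opp_injective e).symm)
    (h5 _ (Or.inr rfl) hne'.symm (opp_ne b)) (h5 _ (Or.inl rfl) (opp_ne a) hne''.symm) (hy m) hv'
  rw [← e2] at hG2
  refine ⟨_, hG2, ?_⟩
  intro w
  rw [rMat, rMatrix_label (H := fun β => qPow q (lam * (ν ⬝ᵥ vec β : ℤ)) * G β) hne m (hy m) hFG]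
  have h3 : qPow q (lam * (ν ⬝ᵥ vec a : ℤ)) =
      qPow q (lam * m) * qPow q (lam * (ν ⬝ᵥ vec b : ℤ)) := by
    rw [← qPow_add, ← hm, dotProduct_sub]; congr 1; push_cast; ring
  have h3' : qPow q (lam * (ν ⬝ᵥ vec (opp b) : ℤ)) =
      qPow q (lam * m) * qPow q (lam * (ν ⬝ᵥ vec (opp a) : ℤ)) := by
    rw [← qPow_add, ← hm', dotProduct_sub]; congr 1; push_cast; ring
  have h4 := Units.ne_zero (qPow q (lam * m))
  have o1 := opp_ne a
  have o2 := opp_ne b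
  have o3 : opp b ≠ opp a := fun e => hne (opp_injective e).symm
  generalize label w = β
  unfold labelR swapVals swapL
  by_cases c1 : β = a
  · subst c1
    simp only [hne, hne', o1.symm, hne''.symm, o2, true_or, if_true, if_false, h3]
    push_cast; ring
  by_cases c2 : β = b
  · subst c2
    simp only [c1, hne'', o2.symm, or_self, true_or, if_true, if_false, h3]
    push_cast; field_simp
  by_cases c3 : β = opp b
  · subst c3
    simp only [hne'.symm, o1, hne''.symm, or_true, if_true, if_false, h3', o2]
    push_cast; ring
  by_cases c4 : β = opp a
  · subst c4
    simp only [hne'.symm, o1, hne''.symm, o3.symm, or_true, or_self, if_true, if_false, h3', o2]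
    push_cast; field_simp
  simp only [c1, c2, c3, c4, or_self, if_false]

end Chain


theorem genericPts.ne_one {n : ℕ} {q t : ℝ} {y : Torus n} (hy : y ∈ genericPts n q t)
    {a b : Label n} (h : a ≠ b) (m : ℤ) : (t : ℂ) * affExpo q (vec a - vec b) m y ≠ 1 :=
  (hy _ (sub_mem_roots h) m).2

theorem range'_split {n i : ℕ} (h1 : 1 ≤ i) (h2 : i ≤ n) :
    List.range' 1 n = List.range' 1 (i - 1) ++ i :: List.range' (i + 1) (n - i) := by
  have e : n = (i - 1) + ((n - i) + 1) := by omega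
  conv_lhs => rw [e, ← List.range'_append]
  rw [List.range'_succ]
  congr <;> omega

/-! ### The chains of `R`-matrices belonging to the translations. -/

section Chain

variable {n : ℕ} [NeZero n] {q t lam : ℝ} {mult : Label n → ℂ} {loop : ℂ} {y : Torus n}

/-- The entry `a` passes the members of `U` from left to right. The list is reversed in the product
because the operator applied first stands at the right end. -/
theorem State.move_right (hq0 : 0 < q) (hy : y ∈ genericPts n q t) {ν : Fin n → ℤ} {a : Label n}
    {m : ℤ} (U : List (Label n)) {Q : List (Label n)} :
    ∀ {P : List (Label n)}, IsHalf (P ++ a :: (U ++ Q)) →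
    (∀ u ∈ U, ν ⬝ᵥ (vec a - vec u) = m) → ∀ {F : VMod n},
    State q t lam mult loop y ν (P ++ a :: (U ++ Q)) F →
    State q t lam mult loop y ν (P ++ U ++ a :: Q)
      ((U.reverse.map fun u => rMat q t lam a u m).prod F) := by
  induction U with
  | nil => intro P _ _ F hF; simpa using hF
  | cons u U ih =>
    intro P hh hm F hF
    have hau : a.1 ≠ u.1 := by
      have : IsHalf ((P ++ [a]) ++ u :: (U ++ Q)) := by simpa using hh
      exact this.notMem_of_append (by simp) (by simp)
    have h1 := State.swap_short hq0
      (genericPts.ne_one hy (fun e => hau (by rw [e]) : a ≠ u)) (hm u (by simp)) hh hF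
    have hh' : IsHalf ((P ++ [u]) ++ a :: (U ++ Q)) := by
      refine hh.perm ?_
      simp only [List.map_append, List.map_cons, List.append_assoc,
        List.cons_append, List.nil_append]
      exact (List.Perm.swap _ _ _).append_left _
    have h2 := ih (P := P ++ [u]) hh' (fun v hv => hm v (List.mem_cons_of_mem _ hv))
      (by simpa using h1)
    simpa [Module.End.mul_apply] using h2

theorem State.move_left (hq0 : 0 < q) (hy : y ∈ genericPts n q t) {ν : Fin n → ℤ} {b : Label n}
    {m : ℤ} (U : List (Label n)) {Q : List (Label n)} :
    ∀ {P : List (Label n)}, IsHalf (P ++ U ++ b :: Q) →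
    (∀ u ∈ U, ν ⬝ᵥ (vec u - vec b) = m) → ∀ {F : VMod n},
    State q t lam mult loop y ν (P ++ U ++ b :: Q) F →
    State q t lam mult loop y ν (P ++ b :: (U ++ Q))
      ((U.map fun u => rMat q t lam u b m).prod F) := by
  induction U with
  | nil => intro P _ _ F hF; simpa using hF
  | cons u U ih =>
    intro P hh hm F hF
    have hub : u.1 ≠ b.1 := hh.notMem_of_append (by simp) (by simp)
    have h1 := ih (P := P ++ [u]) (by simpa using hh)
      (fun v hv => hm v (List.mem_cons_of_mem _ hv)) (F := F) (by simpa using hF)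
    have hh' : IsHalf (P ++ u :: b :: (U ++ Q)) := by
      refine hh.perm ?_
      simp only [List.map_append, List.map_cons, List.append_assoc, List.cons_append]
      exact ((List.perm_middle.symm).cons _).append_left _
    have h2 := State.swap_short hq0
      (genericPts.ne_one hy (fun e => hub (by rw [e]) : u ≠ b)) (hm u (by simp)) hh'
      (by simpa using h1)
    simpa [Module.End.mul_apply] using h2

/-- Here `-ε_i` is first and `ε_i` last in the full ordering. Rotating `ε_i` to the front divides
its parameter by `q` and makes the two neighbours. After their exchange `-ε_i` is first, and
rotating it to the end multiplies its parameter by `q`. The outcome is the parameters at `q^{ε_i}y`,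
and the factors `q^{∓λ}` of the rotations supply the change of twist. -/
theorem State.affine (hq0 : 0 < q) (hq1 : q < 1) (hy : y ∈ genericPts n q t) (i : Fin n)
    {P : List (Label n)} (hh : IsHalf ((i, 1) :: P)) {F : VMod n}
    (hF : State q t lam mult loop y 0 (opp (i, 1) :: P) F) :
    State q t lam mult loop y (vec (i, 1)) ((i, 1) :: P)
      (rMat q t lam (i, 1) (opp (i, 1)) 1 F) := by
  obtain ⟨G, hG, hFG⟩ := hF
  set b : Label n := (i, 1) with hb
  have hbP : ∀ c ∈ P, b.1 ≠ c.1 := fun c hc =>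
    IsHalf.notMem_of_append (P := [b]) hh (by simp) hc
  set M := P ++ (P.map opp).reverse with hM
  have hM0 : ∀ c ∈ M, b.1 ≠ c.1 := by
    intro c hc
    simp only [hM, List.mem_append, List.mem_reverse, List.mem_map] at hc
    rcases hc with hc | ⟨d, hd, rfl⟩
    · exact hbP c hc
    · exact hbP d hd
  have hbM : b ∉ M := fun h => hM0 b h rfl
  have hbM' : opp b ∉ M := fun h => hM0 _ h rfl
  have hmem : ∀ c, c ∈ M ∨ c = b ∨ c = opp b := by
    intro c
    by_cases h1 : c.1 = b.1
    · exact Or.inr (eq_or_eq_opp h1)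
    · left
      simp only [hM, List.mem_append, List.mem_reverse, List.mem_map]
      have hne : c ≠ b := fun e => h1 (by rw [e])
      have hne' : opp c ≠ b := fun e => h1 (by rw [← e]; rfl)
      rcases hh.mem_iff c with ⟨h2, _⟩ | ⟨_, h2⟩
      · exact Or.inl ((List.mem_cons.1 h2).resolve_left hne)
      · exact Or.inr ⟨opp c, (List.mem_cons.1 h2).resolve_left hne', opp_opp c⟩
  have e1 : full (opp b :: P) = (opp b :: M) ++ [b] := by simp [full, hM]
  have e2 : full (b :: P) = (b :: M) ++ [opp b] := by simp [full, hM]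
  rw [e1] at hG
  have hq : (q : ℂ) ≠ 0 := by exact_mod_cast hq0.ne'
  have hvM : ∀ c ∈ M, vals q y (vec b) c = vals q y 0 c := by
    intro c hc
    have h1 : vec b ⬝ᵥ vec (opp c) = 0 := by
      rw [vec_dotProduct, ip, if_neg, if_neg]
      · rw [opp_opp]; exact fun e => hM0 c hc (by rw [e])
      · exact fun e => hM0 c hc (by rw [e]; rfl)
    simp only [vals, point_scale, toE_dotProduct, h1, zero_dotProduct]
  have hvb : vals q y 0 b = q * vals q y (vec b) b := by
    have h1 : vec b ⬝ᵥ vec (opp b) = -1 := by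
      rw [vec_opp, dotProduct_neg, vec_dotProduct, ip_self]
    simp only [vals, point_scale, toE_dotProduct, h1, zero_dotProduct]
    simp only [Int.cast_neg, Int.cast_one, qPow_neg, Units.val_inv_eq_inv_val, qPow_one hq0,
      Int.cast_zero, qPow_zero, Units.val_one]
    field_simp
  have hvb' : vals q y (vec b) (opp b) = q * vals q y 0 (opp b) := by
    have h1 : vec b ⬝ᵥ vec b = 1 := by rw [vec_dotProduct, ip_self]
    simp only [vals, point_scale, toE_dotProduct, opp_opp, h1, zero_dotProduct]
    simp only [Int.cast_one, qPow_one hq0, Int.cast_zero, qPow_zero, Units.val_one, one_mul]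
  have hob : opp b ≠ b := opp_ne b
  -- Intermediate parameters between the two rotations: `ε_i` has been shifted already, `-ε_i` has
  -- not.
  set v' : Label n → ℂ := fun c => if c = opp b then vals q y 0 c else vals q y (vec b) c with hv'
  have hv'b : v' b = vals q y (vec b) b := by simp [hv', hob.symm]
  have hv'ob : v' (opp b) = vals q y 0 (opp b) := by simp [hv']
  have hv'M : ∀ c ∈ M, v' c = vals q y 0 c := by
    intro c hc
    simp only [hv']
    split_ifs
    · rfl
    · exact hvM c hc
  have hG1 := hG.rotate hq0 hq1 (v' := v')
    (by
      intro c hc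
      rcases List.mem_cons.1 hc with rfl | hc
      · exact hv'ob
      · exact hv'M c hc)
    (by
      intro c hc
      rw [List.mem_singleton.1 hc, hv'b, hvb])
    (by
      intro c
      rcases hmem c with h | rfl | rfl
      · exact Or.inl ⟨by simp [h], fun h' => hbM (by rwa [← List.mem_singleton.1 h'])⟩
      · exact Or.inr ⟨by simp [hob.symm, hbM], by simp⟩
      · exact Or.inl ⟨by simp, by simp [hob]⟩)
  have hz : v' (opp b) = affExpo q (vec b - vec (opp b)) 1 y * v' b := by
    -- With both parameters shifted the ratio is `q²e^{2ε_i}`. Undoing the shift of `-ε_i` removes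
    -- one `q`, which leaves the argument of `R_{2ε_i+δ}`.
    have h1 := vals_eq_mul (q := q) hq0 y (ν := vec b) (a := b) (b := opp b) (m := 2) (by
      rw [dotProduct_sub, vec_opp, dotProduct_neg, vec_dotProduct, ip_self]; norm_num)
    rw [hvb', affExpo] at h1
    rw [hv'ob, hv'b, affExpo]
    apply mul_left_cancel₀ hq
    rw [h1, zpow_ofNat, zpow_one]; ring
  have hG2 := Vals.swap (P := []) (Q := M) hob.symm hG1 (by simp) (by simp)
    (genericPts.ne_one hy hob.symm 1) hz
  have hG3 := Vals.unrotate (P := b :: M) (Q := [opp b]) (v := vals q y (vec b)) hq0 hq1 hG2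
    (by
      intro c hc
      rcases List.mem_cons.1 hc with rfl | hc
      · exact hv'b
      · rw [hvM c hc, hv'M c hc])
    (by
      intro c hc
      rw [List.mem_singleton.1 hc, hv'ob, hvb'])
    (by
      intro c
      rcases hmem c with h | rfl | rfl
      · exact Or.inl ⟨by simp [h], fun h' => hbM' (by rwa [← List.mem_singleton.1 h'])⟩
      · exact Or.inl ⟨by simp, by simp [hob.symm]⟩
      · exact Or.inr ⟨by simp [hob, hbM'], by simp⟩)
  rw [← e2] at hG3
  refine ⟨_, hG3, ?_⟩
  intro w
  have hFG' : ∀ w, F w y = G (label w) := by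
    intro w; rw [hFG]; simp [qPow_zero]
  rw [rMat, rMatrix_label hob.symm 1 (genericPts.ne_one hy hob.symm 1) hFG', labelR_long]
  have hl := Units.ne_zero (qPow q lam)
  rcases hmem (label w) with h | h | h
  · have h1 : label w ≠ b := fun e => hbM (by rwa [← e])
    have h2 : label w ≠ opp b := fun e => hbM' (by rwa [← e])
    have h3 : vec b ⬝ᵥ vec (label w) = 0 := by
      rw [vec_dotProduct, ip, if_neg h1.symm, if_neg (fun e => h2 (by rw [e, opp_opp]))]
    simp [h1, h2, h, swapVals, h3, qPow_zero]
  · have h3 : vec b ⬝ᵥ vec b = 1 := by rw [vec_dotProduct, ip_self]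
    simp [h, hbM, hob.symm, swapVals, h3, qPow_neg]
    field_simp
  · have h3 : vec b ⬝ᵥ vec (opp b) = -1 := by
      rw [vec_opp, dotProduct_neg, vec_dotProduct, ip_self]
    simp [h, hbM', hob, hob.symm, hbM, swapVals, h3, qPow_neg]
    field_simp

/-- The positive coordinate vector `ε_k`, for `1 ≤ k ≤ n`. -/
def pl (n : ℕ) [NeZero n] (k : ℕ) : Label n := (Fin.ofNat n (k - 1), 1)

theorem eps_eq_pl {k : ℕ} (h1 : 1 ≤ k) (h2 : k ≤ n) : eps n k = vec (pl n k) := by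
  rw [pl, ← eps_eq_vec, Fin.val_ofNat, Nat.mod_eq_of_lt (by omega), Nat.sub_add_cancel h1]

/-- The standard ordering. -/
def std (n : ℕ) [NeZero n] : List (Label n) := (List.range' 1 n).map (pl n)

theorem isHalf_std : IsHalf (std n) := by
  have : (std n).map Prod.fst = List.finRange n := by
    refine List.ext_getElem (by simp [std]) fun i h1 h2 => ?_
    have hi : i < n := by simpa using h2
    apply Fin.ext
    simp [std, pl, Nat.mod_eq_of_lt hi]
  rw [IsHalf, this]

theorem two_smul_eps_eq {i : ℕ} (h1 : 1 ≤ i) (h2 : i ≤ n) :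
    2 • eps n i = vec (pl n i) - vec (opp (pl n i)) := by
  rw [vec_opp, sub_neg_eq_add, ← eps_eq_pl h1 h2, two_smul]

theorem eps_add_eps_eq {i k : ℕ} (h1 : 1 ≤ i) (h2 : i ≤ n) (h3 : 1 ≤ k) (h4 : k ≤ n) :
    eps n k + eps n i = vec (pl n k) - vec (opp (pl n i)) := by
  rw [vec_opp, sub_neg_eq_add, ← eps_eq_pl h1 h2, ← eps_eq_pl h3 h4]

theorem pl_ne {i k : ℕ} (h1 : 1 ≤ i) (h2 : i ≤ n) (h3 : 1 ≤ k) (h4 : k ≤ n) (h : i ≠ k) :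
    pl n i ≠ pl n k := by
  intro e
  have := congrArg (fun β : Label n => (β.1 : ℕ)) e
  simp only [pl, Fin.val_ofNat] at this
  rw [Nat.mod_eq_of_lt (by omega), Nat.mod_eq_of_lt (by omega)] at this
  omega

/-- Read from right to left, the factors of `R_{τ(ε_i)}` describe the path of one index: `ε_i` moves
right past `U`, flips, moves left past `U` and `L`, flips back through the affine root, and moves
right past `L` at level `1`. -/
theorem State.rTransl (hq0 : 0 < q) (hq1 : q < 1) (hy : y ∈ genericPts n q t) {i : ℕ}
    (h1 : 1 ≤ i) (h2 : i ≤ n) {F : VMod n} (hF : State q t lam mult loop y 0 (std n) F) :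
    State q t lam mult loop y (eps n i) (std n)
      (rTransl n q t t ((-lam) • toE (eps n 1)) i F) := by
  set a := pl n i with ha
  set L := (List.range' 1 (i - 1)).map (pl n) with hL
  set U := (List.range' (i + 1) (n - i)).map (pl n) with hU
  have hstd : std n = L ++ a :: U := by
    rw [std, range'_split h1 h2, List.map_append, List.map_cons]
  have hh : IsHalf (L ++ a :: U) := hstd ▸ isHalf_std
  rw [hstd] at hF
  have s1 := State.move_right (ν := 0) (m := 0) hq0 hy U (P := L) (Q := []) (F := F)
    (by rwa [List.append_nil]) (by simp) (by rwa [List.append_nil])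
  have hh2 : IsHalf ((L ++ U) ++ [a]) := hh.perm (by
    simp only [List.map_append, List.map_cons, List.append_assoc, List.map_nil]
    exact (List.perm_append_singleton _ _).append_left _)
  have s2 := State.swap_long (ν := 0) (m := 0) hq0 (genericPts.ne_one hy (opp_ne a).symm) (by simp) hh2 s1
  have hh3 : IsHalf (L ++ U ++ [opp a]) := hh2.perm (by simp [opp])
  have s3 := State.move_left (ν := 0) (m := 0) hq0 hy U (P := L) (Q := []) hh3 (by simp) s2
  have hh4 : IsHalf ([] ++ L ++ opp a :: U) := hh.perm (by simp [opp])
  rw [List.append_nil] at s3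
  have s4 := State.move_left (ν := 0) (m := 0) hq0 hy L (P := []) (Q := U) hh4 (by simp) s3
  have hh5 : IsHalf (a :: (L ++ U)) := hh.perm (by
    simp only [List.map_append, List.map_cons]
    exact List.perm_middle.symm)
  have s5 := State.affine hq0 hq1 hy (Fin.ofNat n (i - 1)) (P := L ++ U) hh5 s4
  have s6 := State.move_right (m := 1) hq0 hy L (P := []) (Q := U) hh5 (by
    intro u hu
    obtain ⟨k, hk, rfl⟩ := List.mem_map.1 hu
    rw [List.mem_range'_1] at hk
    have hne : pl n i ≠ pl n k := pl_ne h1 h2 (by omega) (by omega) (by omega)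
    rw [dotProduct_sub, show ((Fin.ofNat n (i - 1), 1) : Label n) = pl n i from rfl,
      vec_dotProduct, vec_dotProduct, ip_self, ip, if_neg hne, if_neg]
    · simp
    · intro e
      have := congrArg Prod.snd e
      simp [pl, opp] at this) s5
  rw [hstd, eps_eq_pl h1 h2]
  refine (congrArg (State q t lam mult loop y (vec a) (L ++ a :: U)) ?_).mp s6
  have r1 : ((List.range' 1 (i - 1)).reverse.map fun k =>
      rMatrix q t t ((-lam) • toE (eps n 1)) (eps n i - eps n k) 1) =
      L.reverse.map fun u => rMat q t lam a u 1 := by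
    rw [hL, ← List.map_reverse, List.map_map]
    refine List.map_congr_left fun k hk => ?_
    rw [List.mem_reverse, List.mem_range'_1] at hk
    simp only [Function.comp, rMat]
    rw [eps_eq_pl h1 h2, eps_eq_pl (show 1 ≤ k by omega) (show k ≤ n by omega)]
  have r2 : ((List.range' 1 (i - 1)).map fun k =>
      rMatrix q t t ((-lam) • toE (eps n 1)) (eps n k + eps n i) 0) =
      L.map fun u => rMat q t lam u (opp a) 0 := by
    rw [hL, List.map_map]
    refine List.map_congr_left fun k hk => ?_
    rw [List.mem_range'_1] at hk
    simp only [Function.comp, rMat]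
    rw [eps_add_eps_eq h1 h2 (show 1 ≤ k by omega) (show k ≤ n by omega)]
  have r3 : ((List.range' (i + 1) (n - i)).map fun k =>
      rMatrix q t t ((-lam) • toE (eps n 1)) (eps n i + eps n k) 0) =
      U.map fun u => rMat q t lam u (opp a) 0 := by
    rw [hU, List.map_map]
    refine List.map_congr_left fun k hk => ?_
    rw [List.mem_range'_1] at hk
    simp only [Function.comp, rMat]
    rw [add_comm, eps_add_eps_eq h1 h2 (show 1 ≤ k by omega) (show k ≤ n by omega)]
  have r4 : ((List.range' (i + 1) (n - i)).reverse.map fun k =>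
      rMatrix q t t ((-lam) • toE (eps n 1)) (eps n i - eps n k) 0) =
      U.reverse.map fun u => rMat q t lam a u 0 := by
    rw [hU, ← List.map_reverse, List.map_map]
    refine List.map_congr_left fun k hk => ?_
    rw [List.mem_reverse, List.mem_range'_1] at hk
    simp only [Function.comp, rMat]
    rw [eps_eq_pl h1 h2, eps_eq_pl (show 1 ≤ k by omega) (show k ≤ n by omega)]
  rw [QKZ.rTransl, r1, r2, r3, r4, two_smul_eps_eq h1 h2]
  simp only [Module.End.mul_apply]
  rfl

/-- Induction on the number `j` of flipped indices, from the last one downwards. The first half of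
the ordering is then `ε_1, …, ε_k, -ε_n, …, -ε_{k+1}`, and the next factor moves `ε_k` past the
negative entries to the middle and flips it. -/
theorem State.rHalf_suffix (hq0 : 0 < q) (hy : y ∈ genericPts n q t) {F : VMod n}
    (hF : State q t lam mult loop y 0 (std n) F) (j : ℕ) :
    ∀ k, k + j = n → State q t lam mult loop y 0
      ((List.range' 1 k).map (pl n) ++ (((List.range' (k + 1) j).map (pl n)).map opp).reverse)
      (((List.range' (k + 1) j).map fun i =>
        rMatrix q t t ((-lam) • toE (eps n 1)) (2 • eps n i) 0 *
        ((List.range' (i + 1) (n - i)).map fun k =>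
          rMatrix q t t ((-lam) • toE (eps n 1)) (eps n i + eps n k) 0).prod).prod F) := by
  induction j with
  | zero =>
    intro k hk
    obtain rfl : k = n := by omega
    simpa [std] using hF
  | succ j ih =>
    intro k hk
    have h0 := ih (k + 1) (by omega)
    set N := (((List.range' (k + 1 + 1) j).map (pl n)).map opp).reverse with hN
    set P := (List.range' 1 k).map (pl n) with hP
    set a := pl n (k + 1) with ha
    have e0 : (List.range' 1 (k + 1)).map (pl n) = P ++ [a] := by
      rw [List.range'_concat]; simp [hP, ha, add_comm]
    rw [e0, List.append_assoc, List.singleton_append] at h0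
    have hh : IsHalf (P ++ a :: N) := by
      refine isHalf_std.perm ?_
      rw [std, range'_split (show 1 ≤ k + 1 by omega) (show k + 1 ≤ n by omega)]
      simp only [hN, hP, List.map_append, List.map_cons, List.map_reverse, List.map_map,
        Nat.add_sub_cancel, show n - (k + 1) = j by omega]
      exact ((List.reverse_perm _).cons _).append_left _
    have s1 := State.move_right (ν := 0) (m := 0) hq0 hy N (P := P) (Q := [])
      (by rwa [List.append_nil]) (by simp) (by rw [List.append_nil]; exact h0)
    have hh2 : IsHalf ((P ++ N) ++ [a]) := hh.perm (by
      simp only [List.map_append, List.map_cons, List.append_assoc, List.map_nil]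
      exact (List.perm_append_singleton _ _).append_left _)
    have s2 := State.swap_long (ν := 0) (m := 0) hq0 (genericPts.ne_one hy (opp_ne a).symm) (by simp) hh2 s1
    have e1 : P ++ (((List.range' (k + 1) (j + 1)).map (pl n)).map opp).reverse =
        (P ++ N) ++ [opp a] := by
      rw [List.range'_succ]; simp [hN, ha]
    rw [e1, List.range'_succ, List.map_cons, List.prod_cons]
    refine (congrArg (State q t lam mult loop y 0 (P ++ N ++ [opp a])) ?_).mp s2
    have r : ((List.range' (k + 1 + 1) (n - (k + 1))).map fun l =>
        rMatrix q t t ((-lam) • toE (eps n 1)) (eps n (k + 1) + eps n l) 0) =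
        N.reverse.map fun u => rMat q t lam a u 0 := by
      rw [hN, List.reverse_reverse, List.map_map, List.map_map, show n - (k + 1) = j by omega]
      refine List.map_congr_left fun l hl => ?_
      rw [List.mem_range'_1] at hl
      simp only [Function.comp, rMat]
      rw [eps_add_eps_eq (show 1 ≤ l by omega) (show l ≤ n by omega)
        (show 1 ≤ k + 1 by omega) (show k + 1 ≤ n by omega)]
    rw [r, two_smul_eps_eq (show 1 ≤ k + 1 by omega) (show k + 1 ≤ n by omega)]
    simp only [Module.End.mul_apply]
    rfl

theorem State.rHalf (hq0 : 0 < q) (hy : y ∈ genericPts n q t) {F : VMod n}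
    (hF : State q t lam mult loop y 0 (std n) F) :
    State q t lam mult loop y 0 ((std n).map opp).reverse
      (rHalf n q t t ((-lam) • toE (eps n 1)) F) := by
  have := State.rHalf_suffix hq0 hy hF n 0 (by simp)
  simpa [std, QKZ.rHalf] using this

end Chain


/-! ### Analytic properties of the integrands -/

theorem differentiableAt_list_prod {L : Type*} {f : L → ℂ → ℂ} {x : ℂ} {l : List L}
    (h : ∀ e ∈ l, DifferentiableAt ℂ (f e) x) :
    DifferentiableAt ℂ (fun x => (l.map fun e => f e x).prod) x := by
  induction l with
  | nil => simp
  | cons c l ih =>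
    simp only [List.map_cons, List.prod_cons]
    exact (h c List.mem_cons_self).mul (ih fun e he => h e (List.mem_cons_of_mem _ he))

/-! ### Regularity and residues of the integrands. -/

section Form

variable {L : Type*} [DecidableEq L]

theorem differentiableAt_poly (t : ℝ) (v : L → ℂ) (l : List L) (β : L) {x : ℂ} (hx : x ≠ 0) :
    DifferentiableAt ℂ (fun x => poly t (fun e => v e / x) l β) x := by
  have hd : ∀ e, DifferentiableAt ℂ (fun x => v e / x) x := fun e => by
    fun_prop (disch := exact hx)
  induction l with
  | nil => simp [poly]
  | cons c l ih =>
    simp only [poly]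
    split_ifs
    · exact differentiableAt_list_prod fun e _ => ((hd e).const_mul _).const_sub _
    · exact ((hd c).const_sub _).mul ih

theorem differentiableAt_kern_div {q : ℝ} (hq0 : 0 < q) (hq1 : q < 1) (t : ℝ) (c : ℂ) {x : ℂ}
    (hx : x ≠ 0) (h : ∀ i : ℕ, x ≠ c * (q : ℂ) ^ i) :
    DifferentiableAt ℂ (fun x => kern q t (c / x)) x := by
  have hd : DifferentiableAt ℂ (fun x => c / x) x := by fun_prop (disch := exact hx)
  refine (differentiableAt_kern hq0 hq1 t fun i e => h i ?_).comp x hd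
  field_simp at e
  exact e.symm

theorem differentiableAt_form {q : ℝ} (hq0 : 0 < q) (hq1 : q < 1) (t : ℝ) (v : L → ℂ)
    (l : List L) (β : L) {x : ℂ} (hx : x ≠ 0) (h : ∀ e ∈ l, ∀ i : ℕ, x ≠ v e * (q : ℂ) ^ i) :
    DifferentiableAt ℂ (form q t v l β) x :=
  ((differentiableAt_list_prod fun e he => differentiableAt_kern_div hq0 hq1 t (v e) hx (h e he)).mul
    (differentiableAt_poly t v l β hx)).div differentiableAt_id hx

/-- The integrand with its simple pole at `v c q^s` removed. -/
def formReg (q t : ℝ) (v : L → ℂ) (l : List L) (β c : L) (s : ℕ) (x : ℂ) : ℂ :=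
  kernReg q t (v c) s x * ((l.erase c).map fun e => kern q t (v e / x)).prod *
    poly t (fun e => v e / x) l β / x

theorem form_eq_formReg {q : ℝ} (hq0 : 0 < q) (hq1 : q < 1) (t : ℝ) (v : L → ℂ) {l : List L}
    (β : L) {c : L} (hc : c ∈ l) (s : ℕ) {x : ℂ} (hx : x ≠ 0) :
    form q t v l β x = (x - v c * (q : ℂ) ^ s)⁻¹ * formReg q t v l β c s x := by
  rw [form, formReg, ← List.prod_map_erase _ hc, kern_eq_kernReg hq0 hq1 t (v c) s hx]
  ring

theorem differentiableAt_formReg {q : ℝ} (hq0 : 0 < q) (hq1 : q < 1) (t : ℝ) (v : L → ℂ)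
    (l : List L) (β c : L) (s : ℕ) {x : ℂ} (hx : x ≠ 0) (h : ∀ i : ℕ, i ≠ s → x ≠ v c * (q : ℂ) ^ i)
    (h' : ∀ e ∈ l.erase c, ∀ i : ℕ, x ≠ v e * (q : ℂ) ^ i) :
    DifferentiableAt ℂ (formReg q t v l β c s) x :=
  (((differentiableAt_kernReg hq0 hq1 t (v c) s hx h).mul
    (differentiableAt_list_prod fun e he => differentiableAt_kern_div hq0 hq1 t (v e) hx (h' e he))).mul
    (differentiableAt_poly t v l β hx)).div differentiableAt_id hx

theorem hasRes_zero {f : ℂ → ℂ} {p : ℂ} (h : ContinuousAt f p) : HasRes f p 0 := by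
  have h1 : ContinuousAt (fun x => (x - p) * f x) p := by fun_prop
  have h2 := h1.tendsto.mono_left (nhdsWithin_le_nhds (s := {p}ᶜ))
  simpa [HasRes] using h2

theorem hasRes_formReg {q : ℝ} (hq0 : 0 < q) (hq1 : q < 1) (t : ℝ) (v : L → ℂ)
    {l : List L} (β : L) {c : L} (hc : c ∈ l) (s : ℕ) {p : ℂ} (hp : p = v c * (q : ℂ) ^ s)
    (hp0 : p ≠ 0) (h : ContinuousAt (formReg q t v l β c s) p) :
    HasRes (form q t v l β) p (formReg q t v l β c s p) := by
  refine (h.tendsto.mono_left nhdsWithin_le_nhds).congr' ?_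
  filter_upwards [self_mem_nhdsWithin, mem_nhdsWithin_of_mem_nhds (isOpen_ne.mem_nhds hp0)]
    with x hx hx0
  rw [form_eq_formReg hq0 hq1 t v β hc s hx0, ← hp, mul_inv_cancel_left₀]
  exact sub_ne_zero.2 hx

end Form

/-- Behaviour of a factor of the integrand under `x ↦ q x` near `x = 0`. -/
def QuasiPeriodic (q : ℝ) (f : ℂ → ℂ) (a : ℂ) : Prop :=
  ∃ M : ℂ → ℂ, Tendsto M (𝓝[≠] 0) (𝓝 a) ∧ ∀ᶠ x in 𝓝[≠] 0, f (q * x) = M x * f x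

theorem QuasiPeriodic.mul {q : ℝ} {f g : ℂ → ℂ} {a b : ℂ} (hf : QuasiPeriodic q f a)
    (hg : QuasiPeriodic q g b) : QuasiPeriodic q (fun x => f x * g x) (a * b) := by
  obtain ⟨M, h1, h2⟩ := hf
  obtain ⟨M', h1', h2'⟩ := hg
  refine ⟨fun x => M x * M' x, h1.mul h1', ?_⟩
  filter_upwards [h2, h2'] with x hx hx'
  rw [hx, hx']; ring

theorem quasiPeriodic_of_div {q : ℝ} {f : ℂ → ℂ} {c c' : ℂ} (hc' : c' ≠ 0)
    (h : ∀ᶠ x in 𝓝[≠] (0 : ℂ), f (q * x) = (x - c) / (x - c') * f x) :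
    QuasiPeriodic q f (c / c') := by
  refine ⟨fun x => (x - c) / (x - c'), ?_, h⟩
  have h1 : ContinuousAt (fun x : ℂ => (x - c) / (x - c')) 0 := by
    refine ContinuousAt.div (by fun_prop) (by fun_prop) (by simpa using hc')
  have h2 := h1.tendsto.mono_left (nhdsWithin_le_nhds (s := {0}ᶜ))
  simpa [neg_div_neg_eq] using h2

theorem eventually_ne_zero_and {c : ℂ} (hc : c ≠ 0) : ∀ᶠ x in 𝓝[≠] (0 : ℂ), x ≠ 0 ∧ x ≠ c := by
  filter_upwards [self_mem_nhdsWithin, mem_nhdsWithin_of_mem_nhds (isOpen_ne.mem_nhds hc.symm)]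
    with x hx hx' using ⟨hx, hx'⟩

theorem kern_qmul {q : ℝ} (hq0 : 0 < q) (hq1 : q < 1) (t : ℝ) {c x : ℂ} (hx : x ≠ 0)
    (hxc : x ≠ c / q) :
    kern q t (c / (q * x)) * (1 - c / (q * x)) = kern q t (c / x) * (1 - t * (c / x)) := by
  have hq : (q : ℂ) ≠ 0 := by exact_mod_cast hq0.ne'
  refine kern_mul hq0 hq1 t (by field_simp) fun e => hxc ?_
  field_simp at e ⊢
  rw [e]

/-- The multiplier is `(x - tc)/(x - c/q)`, with value `tq` at `x = 0`. In the two variants that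
follow, the additional linear factor brings the limit down to `t`. -/
theorem quasiPeriodic_kern {q : ℝ} (hq0 : 0 < q) (hq1 : q < 1) (t : ℝ) {c : ℂ} (hc : c ≠ 0) :
    QuasiPeriodic q (fun x => kern q t (c / x)) (t * q) := by
  have hq : (q : ℂ) ≠ 0 := by exact_mod_cast hq0.ne'
  have e : (t * q : ℂ) = (t * c) / (c / q) := by field_simp
  rw [e]
  refine quasiPeriodic_of_div (div_ne_zero hc hq) ?_
  filter_upwards [eventually_ne_zero_and (div_ne_zero hc hq)] with x ⟨hx, hxc⟩
  have h := kern_qmul hq0 hq1 t hx hxc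
  have h2 : x - c / q ≠ 0 := sub_ne_zero.2 hxc
  have e1 : 1 - c / (q * x) = (x - c / q) / x := by field_simp
  have e2 : 1 - t * (c / x) = (x - t * c) / x := by field_simp
  rw [e1, e2] at h
  have h3 : kern q t (c / (q * x)) * (x - c / q) = kern q t (c / x) * (x - t * c) := by
    field_simp at h ⊢
    linear_combination h
  rw [div_mul_eq_mul_div, eq_div_iff h2, h3]; ring

theorem quasiPeriodic_kern_left {q : ℝ} (hq0 : 0 < q) (hq1 : q < 1) (t : ℝ) {c : ℂ} (hc : c ≠ 0) :
    QuasiPeriodic q (fun x => kern q t (c / x) * (1 - c / x)) t := by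
  have hq : (q : ℂ) ≠ 0 := by exact_mod_cast hq0.ne'
  have key : QuasiPeriodic q (fun x => kern q t (c / x) * (1 - c / x)) ((t * c) / c) := by
    refine quasiPeriodic_of_div hc ?_
    filter_upwards [eventually_ne_zero_and (div_ne_zero hc hq), eventually_ne_zero_and hc]
      with x ⟨hx, hxc⟩ ⟨_, hxc'⟩
    rw [kern_qmul hq0 hq1 t hx hxc]
    have h2 : x - c ≠ 0 := sub_ne_zero.2 hxc'
    have e1 : 1 - c / x = (x - c) / x := by field_simp
    have e2 : 1 - t * (c / x) = (x - t * c) / x := by field_simp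
    rw [e1, e2]
    generalize x - c = w at h2
    field_simp
  rwa [mul_div_cancel_right₀ _ hc] at key

theorem quasiPeriodic_kern_right {q : ℝ} (hq0 : 0 < q) (hq1 : q < 1) (t : ℝ) {c : ℂ} (hc : c ≠ 0) :
    QuasiPeriodic q (fun x => kern q t (c / x) * (1 - t * (c / x))) t := by
  have hq : (q : ℂ) ≠ 0 := by exact_mod_cast hq0.ne'
  have e : (t : ℂ) = (t * c / q) / (c / q) := by field_simp
  have key : QuasiPeriodic q (fun x => kern q t (c / x) * (1 - t * (c / x)))
      ((t * c / q) / (c / q)) := by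
    refine quasiPeriodic_of_div (div_ne_zero hc hq) ?_
    filter_upwards [eventually_ne_zero_and (div_ne_zero hc hq)] with x ⟨hx, hxc⟩
    have h := kern_qmul hq0 hq1 t hx hxc
    have h2 : x - c / q ≠ 0 := sub_ne_zero.2 hxc
    have e1 : 1 - c / (q * x) = (x - c / q) / x := by field_simp
    have e2 : 1 - t * (c / (q * x)) = (x - t * c / q) / x := by field_simp
    rw [← h, e1, e2]
    generalize x - c / q = w at h2
    field_simp
  rwa [← e] at key

theorem quasiPeriodic_right {q : ℝ} (hq0 : 0 < q) (hq1 : q < 1) (t : ℝ) {L : Type*} {v : L → ℂ}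
    (hv : ∀ c, v c ≠ 0) (l : List L) :
    QuasiPeriodic q (fun x => (l.map fun e => kern q t (v e / x)).prod *
      (l.map fun e => 1 - t * (v e / x)).prod) ((t : ℂ) ^ l.length) := by
  induction l with
  | nil => exact ⟨fun _ => 1, by simp, by simp⟩
  | cons c l ih =>
    have h := (quasiPeriodic_kern_right hq0 hq1 t (hv c)).mul ih
    simp only [List.map_cons, List.prod_cons, List.length_cons, pow_succ']
    convert h using 1
    funext x; ring

section Form

variable {L : Type*} [DecidableEq L]

/-- Every index other than `β` carries a linear factor and contributes `t`; `β` carries none and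
contributes `tq`. -/
theorem quasiPeriodic_core {q : ℝ} (hq0 : 0 < q) (hq1 : q < 1) (t : ℝ) {v : L → ℂ}
    (hv : ∀ c, v c ≠ 0) {l : List L} {β : L} (hβ : β ∈ l) :
    QuasiPeriodic q (fun x => (l.map fun e => kern q t (v e / x)).prod *
      poly t (fun e => v e / x) l β) ((t : ℂ) ^ l.length * q) := by
  induction l with
  | nil => simp at hβ
  | cons c l ih =>
    simp only [List.map_cons, List.prod_cons, List.length_cons, pow_succ', poly]
    split_ifs with h
    · have h := (quasiPeriodic_kern hq0 hq1 t (hv c)).mul (quasiPeriodic_right hq0 hq1 t hv l)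
      convert h using 1
      · funext x; ring
      · ring
    · have h := (quasiPeriodic_kern_left hq0 hq1 t (hv c)).mul
        (ih ((List.mem_cons.1 hβ).resolve_left h))
      convert h using 1
      · funext x; ring
      · ring

theorem form_ratio {q : ℝ} (hq0 : 0 < q) (hq1 : q < 1) {t : ℝ} (ht : 0 < t) {v : L → ℂ}
    (hv : ∀ c, v c ≠ 0) {l : List L} {β : L} (hβ : β ∈ l) {ρ : ℝ} (hρ : t ^ l.length * q < ρ) :
    ∀ᶠ x in 𝓝[≠] (0 : ℂ), ‖q * form q t v l β (q * x)‖ ≤ ρ * ‖form q t v l β x‖ := by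
  have hq : (q : ℂ) ≠ 0 := by exact_mod_cast hq0.ne'
  obtain ⟨M, h1, h2⟩ := quasiPeriodic_core hq0 hq1 t hv hβ
  have h3 : ‖(t : ℂ) ^ l.length * q‖ < ρ := by
    rw [norm_mul, norm_pow, Complex.norm_real, Complex.norm_real, Real.norm_eq_abs,
      Real.norm_eq_abs, abs_of_pos ht, abs_of_pos hq0]
    exact hρ
  filter_upwards [h2, h1.norm.eventually_lt_const h3, self_mem_nhdsWithin] with x hx hM hx0
  have hx0' : x ≠ 0 := hx0
  -- The factor `q` in front cancels the one produced by the denominator `x` of the integrand.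
  have e : q * form q t v l β (q * x) = M x * form q t v l β x := by
    unfold form
    rw [hx]
    field_simp
  rw [e, norm_mul]
  exact mul_le_mul_of_nonneg_right hM.le (norm_nonneg _)

/-- The points of an orbit tend to `0`. Near a point `p` far along it, the estimate for the
integrand at `qx` and `x` is multiplied by `|x - p|` and passes to the limit `x → p`. -/
theorem residue_ratio {q : ℝ} (hq0 : 0 < q) (hq1 : q < 1) {t : ℝ} (ht : 0 < t) {v : L → ℂ}
    (hv : ∀ c, v c ≠ 0) {l : List L} {β : L} (hβ : β ∈ l) {ρ : ℝ} (hρ : t ^ l.length * q < ρ)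
    {b : ℂ} (hb : b ≠ 0) {r : ℕ → ℂ} (hr : ∀ s : ℕ, HasRes (form q t v l β) (b * (q : ℂ) ^ s) (r s)) :
    ∀ᶠ s in atTop, ‖r (s + 1)‖ ≤ ρ * ‖r s‖ := by
  have hq : (q : ℂ) ≠ 0 := by exact_mod_cast hq0.ne'
  have h1 := form_ratio hq0 hq1 ht hv hβ hρ
  rw [eventually_nhdsWithin_iff] at h1
  have h2 : Tendsto (fun s : ℕ => b * (q : ℂ) ^ s) atTop (𝓝 0) := by
    have : Tendsto (fun s : ℕ => (q : ℂ) ^ s) atTop (𝓝 0) := by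
      apply tendsto_pow_atTop_nhds_zero_of_norm_lt_one
      rwa [Complex.norm_real, Real.norm_eq_abs, abs_of_pos hq0]
    simpa using this.const_mul b
  filter_upwards [h2.eventually h1.eventually_nhds] with s hs
  have hp : b * (q : ℂ) ^ s ≠ 0 := mul_ne_zero hb (pow_ne_zero _ hq)
  have e : (q : ℂ) * (b * (q : ℂ) ^ s) = b * (q : ℂ) ^ (s + 1) := by ring
  have h3 : HasRes (fun x => q * form q t v l β (q * x)) (b * (q : ℂ) ^ s) (r (s + 1)) :=
    HasRes.comp_mul hq (by rw [e]; exact hr (s + 1))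
  refine le_of_tendsto_of_tendsto (Tendsto.norm h3) ((Tendsto.norm (hr s)).const_mul ρ) ?_
  filter_upwards [mem_nhdsWithin_of_mem_nhds hs,
    mem_nhdsWithin_of_mem_nhds (isOpen_ne.mem_nhds hp)] with x hx hx0
  rw [norm_mul, norm_mul (x - b * (q : ℂ) ^ s)]
  have := mul_le_mul_of_nonneg_left (hx hx0) (norm_nonneg (x - b * (q : ℂ) ^ s))
  linarith

end Form


/-! ### Contour integrals and residues -/

section Contours

variable {n : ℕ} {q t lam : ℝ} {y : Torus n}

theorem pole_eq (q : ℝ) (y : Torus n) (j : Fin n) (σ : ℤˣ) (s : ℕ) :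
    pole q y j σ s = point y (j, σ) * (q : ℂ) ^ s := rfl

/-- A coincidence with `β ≠ γ` would give `q^{a-b}e^{β-γ} = 1`, and `β - γ` is a root, a long one if
`γ = -β`. Hence the poles are distinct, and therefore simple. -/
theorem genericPts.separated (hq0 : 0 < q) (hq1 : q < 1) (hy : y ∈ genericPts n q t)
    {β γ : Label n} {a b : ℤ} (h : (q : ℂ) ^ a * point y β = (q : ℂ) ^ b * point y γ) :
    β = γ ∧ a = b := by
  have hq : (q : ℂ) ≠ 0 := by exact_mod_cast hq0.ne'
  have hγ := point_ne_zero y γ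
  have e : β = γ := by
    by_contra hne
    refine (hy _ (sub_mem_roots hne) (a - b)).1 ?_
    rw [affExpo, expo_sub, expo_vec, expo_vec, zpow_sub₀ hq]
    have := zpow_ne_zero b hq
    field_simp
    linear_combination h
  subst e
  refine ⟨rfl, ?_⟩
  have h1 := mul_right_cancel₀ hγ h
  have h2 : q ^ a = q ^ b := by exact_mod_cast h1
  exact zpow_right_injective₀ hq0 hq1.ne h2

theorem genericPts.separated_nat (hq0 : 0 < q) (hq1 : q < 1) (hy : y ∈ genericPts n q t)
    {β γ : Label n} {a b : ℕ} (h : point y β * (q : ℂ) ^ a = point y γ * (q : ℂ) ^ b) :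
    β = γ ∧ a = b := by
  have := genericPts.separated hq0 hq1 hy (β := β) (γ := γ) (a := a) (b := b) (by
    rw [zpow_natCast, zpow_natCast]; linear_combination h)
  exact ⟨this.1, by exact_mod_cast this.2⟩

theorem finite_large_poles (hq0 : 0 < q) (hq1 : q < 1) (y : Torus n) {ε : ℝ} (hε : 0 < ε) :
    {z : ℂ | ε < ‖z‖ ∧ ∃ j σ s, z = pole q y j σ s}.Finite := by
  have h : ∀ β : Label n, ∃ M : ℕ, ∀ s, M ≤ s → ‖point y β‖ * q ^ s < ε := by
    intro β
    have h1 : Tendsto (fun s : ℕ => ‖point y β‖ * q ^ s) atTop (𝓝 0) := by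
      simpa using (tendsto_pow_atTop_nhds_zero_of_lt_one hq0.le hq1).const_mul ‖point y β‖
    exact eventually_atTop.1 (h1.eventually_lt_const hε)
  choose M hM using h
  refine (Set.Finite.subset (Set.finite_iUnion fun β : Label n =>
    ((Finset.range (M β)).finite_toSet.image fun s => point y β * (q : ℂ) ^ s)) ?_)
  rintro z ⟨hz, j, σ, s, rfl⟩
  refine Set.mem_iUnion.2 ⟨(j, σ), s, ?_, rfl⟩
  by_contra hs
  have h2 := hM (j, σ) s (by simpa using hs)
  rw [pole_eq, norm_mul, norm_pow, Complex.norm_real, Real.norm_eq_abs, abs_of_pos hq0] at hz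
  linarith

theorem pole_ne_zero (hq0 : 0 < q) (y : Torus n) (j : Fin n) (σ : ℤˣ) (s : ℕ) :
    pole q y j σ s ≠ 0 :=
  mul_ne_zero (Units.ne_zero _) (pow_ne_zero _ (by exact_mod_cast hq0.ne'))

theorem poleRadius_spec (hq0 : 0 < q) (hq1 : q < 1) (y : Torus n) {p : ℂ} (hp : p ≠ 0) :
    0 < poleRadius q y p ∧ poleRadius q y p ≤ ‖p‖ / 2 ∧
      ∀ x ∈ Metric.closedBall p (poleRadius q y p), ∀ z,
        (z = 0 ∨ ∃ j σ s, z = pole q y j σ s) → z ≠ p → x ≠ z := by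
  set S : Set ℂ := (insert 0 {z | ∃ j σ s, z = pole q y j σ s}) \ {p} with hS
  have h0 : (0 : ℂ) ∈ S := ⟨Set.mem_insert _ _, by simpa using hp.symm⟩
  have hpos : 0 < Metric.infDist p S := by
    rw [← Metric.infDist_pos_iff_notMem_closure ⟨0, h0⟩]
    have hT := finite_large_poles hq0 hq1 y (half_pos (norm_pos_iff.2 hp))
    set T := {z : ℂ | ‖p‖ / 2 < ‖z‖ ∧ ∃ j σ s, z = pole q y j σ s}
    -- Poles accumulate only at `0`: `0` and all the other poles lie in a disc that misses `p`,
    -- together with a finite set that misses `p`.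
    have hcl : IsClosed (Metric.closedBall (0 : ℂ) (‖p‖ / 2) ∪ (T \ {p})) :=
      Metric.isClosed_closedBall.union (hT.subset Set.sdiff_subset).isClosed
    have hsub : S ⊆ Metric.closedBall (0 : ℂ) (‖p‖ / 2) ∪ (T \ {p}) := by
      rintro z ⟨hz, hzp⟩
      by_cases h : ‖z‖ ≤ ‖p‖ / 2
      · left; simpa using h
      · right
        refine ⟨⟨not_le.1 h, ?_⟩, hzp⟩
        rcases hz with rfl | hz
        · exact absurd (by rw [norm_zero]; positivity) h
        · exact hz
    intro hmem
    rcases closure_minimal hsub hcl hmem with h | h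
    · have hp' := norm_pos_iff.2 hp
      rw [mem_closedBall_zero_iff] at h
      linarith
    · exact h.2 rfl
  have hle : Metric.infDist p S ≤ ‖p‖ := by
    simpa using Metric.infDist_le_dist_of_mem (x := p) h0
  refine ⟨half_pos hpos, ?_, ?_⟩
  · unfold poleRadius; linarith
  · rintro x hx z hz hzp rfl
    have h1 : Metric.infDist p S ≤ dist p x := Metric.infDist_le_dist_of_mem ⟨hz, hzp⟩
    rw [Metric.mem_closedBall, dist_comm] at hx
    unfold poleRadius at hx
    linarith

theorem differentiableAt_branchPow (lam : ℝ) (y : Torus n) (j : Fin n) (σ : ℤˣ) (s : ℕ) {x : ℂ}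
    (h : ‖x - pole q y j σ s‖ < ‖pole q y j σ s‖) :
    DifferentiableAt ℂ (branchPow q lam y j σ s) x := by
  set p := pole q y j σ s with hp
  have hpos : 0 < ‖p‖ := (norm_nonneg _).trans_lt h
  have hp0 : p ≠ 0 := norm_pos_iff.1 hpos
  have hslit : x / p ∈ Complex.slitPlane := by
    left
    have h1 : ‖x / p - 1‖ < 1 := by
      rw [show x / p - 1 = (x - p) / p by field_simp, norm_div]
      exact (div_lt_one hpos).2 h
    have h2 := (Complex.abs_re_le_norm (x / p - 1)).trans_lt h1
    rw [Complex.sub_re, Complex.one_re] at h2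
    linarith [(abs_lt.1 h2).1]
  unfold branchPow
  rw [← hp]
  refine DifferentiableAt.const_mul ?_ _
  exact (by fun_prop : DifferentiableAt ℂ (fun x => x / p) x).cpow_const hslit

/-- Cauchy's formula on the small disc, where the branch of `x^λ` is holomorphic. The circle may
meet the finite set `S` of points where the identity fails, so the integrands are compared off a
finite set only. -/
theorem poleIntegral_spec (hq0 : 0 < q) (hq1 : q < 1) (j : Fin n) (σ : ℤˣ) (s : ℕ)
    {ψ g : ℂ → ℂ} {S : Set ℂ} (hS : S.Finite)
    (hψ : ∀ x ∉ S, ψ x * (jpProd q t y x / x) = (x - pole q y j σ s)⁻¹ * g x)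
    (hg : ∀ x ∈ Metric.closedBall (pole q y j σ s) (poleRadius q y (pole q y j σ s)),
      DifferentiableAt ℂ g x) :
    CircleIntegrable (localForm q t lam ψ y j σ s) (pole q y j σ s)
      (poleRadius q y (pole q y j σ s)) ∧
    poleIntegral q t lam ψ y j σ s =
      2 * Real.pi * Complex.I * (point y (j, σ) ^ (lam : ℂ) * qPow q (lam * s) * g (pole q y j σ s)) := by
  have hp0 := pole_ne_zero hq0 y j σ s
  obtain ⟨hr0, hr1, -⟩ := poleRadius_spec hq0 hq1 y hp0
  unfold poleIntegral
  set p := pole q y j σ s with hp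
  set r := poleRadius q y p
  have hB : ∀ x ∈ Metric.closedBall p r,
      DifferentiableAt ℂ (fun x => branchPow q lam y j σ s x * g x) x := by
    intro x hx
    refine (differentiableAt_branchPow lam y j σ s ?_).mul (hg x hx)
    rw [← hp]
    rw [Metric.mem_closedBall, dist_eq_norm] at hx
    have := norm_pos_iff.2 hp0
    linarith
  have hcong : (fun x => (x - p)⁻¹ • (branchPow q lam y j σ s x * g x))
      =ᶠ[codiscreteWithin (Metric.sphere p |r|)] localForm q t lam ψ y j σ s := by
    filter_upwards [compl_finite_mem_codiscreteWithin (s := Metric.sphere p |r|) hS] with x hx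
    have := hψ x hx
    rw [localForm, smul_eq_mul]
    linear_combination (-branchPow q lam y j σ s x) * this
  have hcont : ContinuousOn (fun x => (x - p)⁻¹ • (branchPow q lam y j σ s x * g x))
      (Metric.sphere p r) := by
    refine ContinuousOn.smul ((continuousOn_id.sub continuousOn_const).inv₀ ?_) ?_
    · intro x hx e
      rw [mem_sphere_iff_norm, show x - p = 0 from e, norm_zero] at hx
      exact hr0.ne hx
    · exact fun x hx => (hB x (Metric.sphere_subset_closedBall hx)).continuousAt.continuousWithinAt
  refine ⟨(hcont.circleIntegrable hr0.le).congr_codiscreteWithin hcong, ?_⟩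
  rw [← circleIntegral.circleIntegral_congr_codiscreteWithin hcong hr0.ne',
    DifferentiableOn.circleIntegral_sub_inv_smul
      (fun x hx => (hB x hx).differentiableWithinAt) (Metric.mem_ball_self hr0)]
  rw [smul_eq_mul, branchPow, ← hp, div_self hp0, Complex.one_cpow, mul_one]
  rfl

end Contours


/-! ### The integrands of the theorem -/

/-- The parameters of the integrals at the point `y`. -/
def par {n : ℕ} (y : Torus n) (β : Label n) : ℂ := point y (opp β)

theorem par_one {n : ℕ} (y : Torus n) (j : Fin n) : par y (j, 1) = (y j : ℂ)⁻¹ := by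
  simp [par, point, opp]

theorem par_neg_one {n : ℕ} (y : Torus n) (j : Fin n) : par y (j, -1) = y j := by
  simp [par, point, opp]

theorem par_ne_zero {n : ℕ} (y : Torus n) (β : Label n) : par y β ≠ 0 := point_ne_zero _ _

section Phi

variable {n : ℕ} [NeZero n] {q t lam : ℝ} {y : Torus n}

/-- The index `i` with `w_i ε_1 = β`. -/
def idx (β : Label n) : ℕ := if β.2 = 1 then β.1 + 1 else 2 * n - β.1

/-- Translation between the indices `1, …, n` in the lists and the indices of `Fin n`, which start
at `0`. -/
theorem prod_range'_map (F : Fin n → ℂ) (a m : ℕ) (h : a + m ≤ n) :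
    ((List.range' (a + 1) m).map fun k => F (Fin.ofNat n (k - 1))).prod =
      ∏ μ ∈ Finset.univ.filter (fun μ : Fin n => a ≤ (μ : ℕ) ∧ (μ : ℕ) < a + m), F μ := by
  induction m with
  | zero =>
    rw [Finset.filter_eq_empty_iff.2 fun μ _ => by omega]
    simp
  | succ m ih =>
    have e : Finset.univ.filter (fun μ : Fin n => a ≤ (μ : ℕ) ∧ (μ : ℕ) < a + (m + 1)) =
        insert (Fin.ofNat n (a + m)) (Finset.univ.filter
          (fun μ : Fin n => a ≤ (μ : ℕ) ∧ (μ : ℕ) < a + m)) := by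
      ext μ
      simp only [Finset.mem_filter, Finset.mem_univ, true_and, Finset.mem_insert, Fin.ext_iff,
        Fin.val_ofNat]
      rw [Nat.mod_eq_of_lt (by omega)]
      omega
    rw [e, Finset.prod_insert, List.range'_concat, List.map_append, List.prod_append,
      ih (by omega), mul_comm]
    · simp [add_comm, add_left_comm]
    · simp only [Finset.mem_filter, Fin.val_ofNat]
      rw [Nat.mod_eq_of_lt (by omega)]
      omega

theorem prod_std (f : Label n → ℂ) : ((std n).map f).prod = ∏ j, f (j, 1) := by
  have h := prod_range'_map (fun j : Fin n => f (j, 1)) 0 n (by omega)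
  rw [Finset.filter_true_of_mem (fun μ _ => by omega)] at h
  rw [← h, std, List.map_map]
  rfl

theorem prod_full_std (f : Label n → ℂ) :
    ((full (std n)).map f).prod = (∏ j, f (j, 1)) * ∏ j, f (j, -1) := by
  have h : ((std n).map (f ∘ opp)).prod = ∏ j, f (j, -1) := prod_std (f ∘ opp)
  rw [full, List.map_append, List.prod_append, prod_std, List.map_reverse, List.prod_reverse,
    List.map_map, h]

theorem jpProd_eq (hq0 : 0 < q) (hq1 : q < 1) (t : ℝ) (y : Torus n) (x : ℂ) :
    jpProd q t y x = ((full (std n)).map fun c => kern q t (par y c / x)).prod *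
      ((full (std n)).map fun c => 1 - t * (par y c / x)).prod := by
  rw [← List.prod_map_mul, prod_full_std, ← Finset.prod_mul_distrib, jpProd]
  refine Finset.prod_congr rfl fun j _ => ?_
  rw [← qPoch_div_qPoch hq0 hq1, ← qPoch_div_qPoch hq0 hq1, par_one, par_neg_one,
    mul_div_assoc, mul_div_assoc]
  ring_nf

theorem std_eq (j : Fin n) : std n = (List.range' 1 j).map (pl n) ++
    (j, 1) :: (List.range' (j + 1 + 1) (n - (j + 1))).map (pl n) := by
  have h : pl n (j + 1) = (j, 1) := by simp [pl]
  rw [std, range'_split (show 1 ≤ (j : ℕ) + 1 by omega) (show (j : ℕ) + 1 ≤ n by omega),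
    List.map_append, List.map_cons, h, Nat.add_sub_cancel]

/-- The denominator of `φ` consists of the factors `1 - td` at `β` and before it in the order `ε_1,
…, ε_n, -ε_n, …, -ε_1`. They cancel, and the factors after `β` remain. -/
theorem phi_mul_prod (t : ℝ) (y : Torus n) (β : Label n) {x : ℂ}
    (hx : ∀ c, (1 : ℂ) - t * (par y c / x) ≠ 0) :
    phi t (idx β) y x * ((full (std n)).map fun c => 1 - t * (par y c / x)).prod =
      poly t (fun c => par y c / x) (full (std n)) β := by
  obtain ⟨j, σ⟩ := β
  set L := (List.range' 1 j).map (pl n) with hL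
  set U := (List.range' (j + 1 + 1) (n - (j + 1))).map (pl n) with hU
  have hstd : std n = L ++ (j, 1) :: U := std_eq j
  have hh : IsHalf (L ++ (j, 1) :: U) := hstd ▸ isHalf_std
  have hLj : ∀ c ∈ L, c.1 ≠ j := fun c hc => hh.notMem_of_append (b := (j, 1)) hc (by simp)
  have hUj : ∀ c ∈ U, j ≠ c.1 := fun c hc => by
    have : IsHalf ((L ++ [(j, 1)]) ++ U) := by simpa using hh
    exact this.notMem_of_append (a := (j, 1)) (by simp) hc
  have fL : ∀ f : Label n → ℂ, (L.map f).prod =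
      ∏ μ ∈ Finset.univ.filter (fun μ : Fin n => (μ : ℕ) < j), f (μ, 1) := by
    intro f
    have h := prod_range'_map (fun j : Fin n => f (j, 1)) 0 j (by omega)
    rw [hL, List.map_map]
    refine Eq.trans h (Finset.prod_congr (Finset.filter_congr fun μ _ => by omega) fun _ _ => rfl)
  have fU : ∀ f : Label n → ℂ, (U.map f).prod =
      ∏ μ ∈ Finset.univ.filter (fun μ : Fin n => (j : ℕ) < μ), f (μ, 1) := by
    intro f
    have h := prod_range'_map (fun j : Fin n => f (j, 1)) (j + 1) (n - (j + 1)) (by omega)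
    rw [hU, List.map_map]
    refine Eq.trans h (Finset.prod_congr (Finset.filter_congr fun μ _ => by omega) fun _ _ => rfl)
  have hprod : ∀ l : List (Label n), (l.map fun c => 1 - (t : ℂ) * (par y c / x)).prod ≠ 0 := by
    intro l
    refine List.prod_ne_zero fun h => ?_
    obtain ⟨c, _, hc⟩ := List.mem_map.1 h
    exact hx c hc
  rcases Int.units_eq_one_or σ with rfl | rfl
  · have e : full (std n) = L ++ (j, 1) :: (U ++ ((std n).map opp).reverse) := by
      calc full (std n) = (L ++ (j, 1) :: U) ++ ((std n).map opp).reverse := by rw [← hstd]; rfl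
        _ = _ := by simp
    have hphi : phi t (idx (j, 1)) y x = (L.map fun c => 1 - par y c / x).prod /
        ((L.map fun c => 1 - (t : ℂ) * (par y c / x)).prod * (1 - t * (par y (j, 1) / x))) := by
      have e1 : Finset.univ.filter (fun μ : Fin n => (μ : ℕ) + 1 < j + 1) =
          Finset.univ.filter (fun μ : Fin n => (μ : ℕ) < j) :=
        Finset.filter_congr fun μ _ => by omega
      have e2 : Finset.univ.filter (fun μ : Fin n => (μ : ℕ) + 1 ≤ j + 1) =
          insert j (Finset.univ.filter (fun μ : Fin n => (μ : ℕ) < j)) := by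
        ext μ; simp [Fin.ext_iff]; omega
      rw [phi, idx, if_pos rfl, if_pos (by have := j.2; simp only; omega), fL, fL]
      simp only [e1, e2]
      rw [Finset.prod_insert (by simp)]
      simp only [par_one]
      rw [mul_comm (1 - (t : ℂ) * ((y j : ℂ)⁻¹ / x))]
    have hjL : (j, (1 : ℤˣ)) ∉ L := fun h => hLj _ h rfl
    rw [hphi, e, poly_append_of_notMem t _ _ _ hjL, poly, if_pos rfl]
    have h1 := hprod L
    have h2 := hx (j, 1)
    simp only [List.map_append, List.map_cons, List.prod_append, List.prod_cons]
    generalize (L.map fun c => 1 - (t : ℂ) * (par y c / x)).prod = A at h1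
    generalize 1 - (t : ℂ) * (par y (j, 1) / x) = B at h2
    field_simp
  · have e : full (std n) = (std n ++ (U.map opp).reverse) ++ (j, -1) :: (L.map opp).reverse := by
      calc full (std n) = std n ++ ((L ++ (j, 1) :: U).map opp).reverse := by rw [← hstd]; rfl
        _ = _ := by simp [opp]
    have hphi : phi t (idx (j, -1)) y x = (((U.map opp).map fun c => 1 - par y c / x).prod /
        (((U.map opp).map fun c => 1 - (t : ℂ) * (par y c / x)).prod *
          (1 - t * (par y (j, -1) / x)))) * (((std n).map fun c => 1 - par y c / x).prod /
          ((std n).map fun c => 1 - (t : ℂ) * (par y c / x)).prod) := by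
      have e0 : 2 * n - (2 * n - (j : ℕ)) + 1 = j + 1 := by omega
      have e1 : Finset.univ.filter (fun μ : Fin n => (j : ℕ) + 1 < μ + 1) =
          Finset.univ.filter (fun μ : Fin n => (j : ℕ) < μ) :=
        Finset.filter_congr fun μ _ => by omega
      have e2 : Finset.univ.filter (fun μ : Fin n => (j : ℕ) + 1 ≤ μ + 1) =
          insert j (Finset.univ.filter (fun μ : Fin n => (j : ℕ) < μ)) := by
        ext μ; simp [Fin.ext_iff]; omega
      have hi : idx ((j, -1) : Label n) = 2 * n - j := if_neg (by decide : ¬ (-1 : ℤˣ) = 1)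
      have fU' : ∀ f : Label n → ℂ, ((U.map opp).map f).prod =
          ∏ μ ∈ Finset.univ.filter (fun μ : Fin n => (j : ℕ) < μ), f (μ, -1) := by
        intro f; rw [List.map_map, fU]; rfl
      rw [phi, hi, if_neg (by have := j.2; omega), fU', fU', prod_std, prod_std]
      simp only [e0, e1, e2]
      rw [Finset.prod_insert (by simp), Finset.prod_div_distrib]
      simp only [par_one, par_neg_one]
      rw [mul_comm (1 - (t : ℂ) * ((y j : ℂ) / x))]
    have hj1 : (j, (-1 : ℤˣ)) ∉ std n := by
      rw [hstd]
      simp only [List.mem_append, List.mem_cons, not_or]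
      exact ⟨fun h => hLj _ h rfl, by simp, fun h => hUj _ h rfl⟩
    have hj2 : (j, (-1 : ℤˣ)) ∉ std n ++ (U.map opp).reverse := by
      simp only [List.mem_append, List.mem_reverse, List.mem_map, not_or]
      refine ⟨hj1, ?_⟩
      rintro ⟨d, hd, hd'⟩
      exact hUj d hd (congrArg Prod.fst hd').symm
    rw [hphi, e, poly_append_of_notMem t _ _ _ hj2, poly, if_pos rfl]
    have h1 := hprod (std n)
    have h2 := hx (j, -1)
    have h3 := hprod (U.map opp)
    simp only [List.map_append, List.map_cons, List.prod_append, List.prod_cons,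
      List.map_reverse, List.prod_reverse]
    generalize ((std n).map fun c => 1 - (t : ℂ) * (par y c / x)).prod = A at h1
    generalize 1 - (t : ℂ) * (par y (j, -1) / x) = B at h2
    generalize ((U.map opp).map fun c => 1 - (t : ℂ) * (par y c / x)).prod = D at h3
    field_simp

/-- At the points `x = t e^{-c}`, a zero of `Φ` may meet a zero denominator of `φ`, where division
returns `0`; these removable points are excluded. -/
theorem phi_mul_jpProd (hq0 : 0 < q) (hq1 : q < 1) (t : ℝ) (y : Torus n) (β : Label n) {x : ℂ}
    (hx0 : x ≠ 0) (hx : ∀ c, x ≠ t * par y c) :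
    phi t (idx β) y x * (jpProd q t y x / x) = form q t (par y) (full (std n)) β x := by
  have h := phi_mul_prod t y β (x := x) fun c e => hx c (by
    field_simp at e
    linear_combination e)
  rw [jpProd_eq hq0 hq1, form, ← h]
  ring

theorem mem_full_std (β : Label n) : β ∈ full (std n) := by
  simp only [full, List.mem_append, List.mem_reverse, List.mem_map]
  rcases (isHalf_std (n := n)).mem_iff β with ⟨h, _⟩ | ⟨_, h⟩
  · exact Or.inl h
  · exact Or.inr ⟨_, h, opp_opp β⟩

theorem length_full_std : (full (std n)).length = 2 * n := by
  simp [full, std, two_mul]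

theorem nodup_full_std : (full (std n)).Nodup := by
  have h1 : (std n).Nodup :=
    (List.Perm.nodup_iff (isHalf_std (n := n)) |>.2 (List.nodup_finRange n)).of_map
  rw [full, List.nodup_append']
  refine ⟨h1, List.nodup_reverse.2 (h1.map opp_injective), ?_⟩
  intro c hc hc'
  simp only [List.mem_reverse, List.mem_map] at hc'
  obtain ⟨d, hd, rfl⟩ := hc'
  rcases (isHalf_std (n := n)).mem_iff d with ⟨_, h⟩ | ⟨h, _⟩
  · exact h hc
  · exact h hd

end Phi


/-! ### Convergence of the integrals -/

theorem ne_of_mem_erase {L : Type*} [DecidableEq L] {l : List L} {c e : L} (hl : l.Nodup)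
    (he : e ∈ l.erase c) : e ≠ c :=
  (hl.mem_erase_iff.1 he).1

theorem par_opp {n : ℕ} (y : Torus n) (β : Label n) : par y (opp β) = point y β := by
  rw [par, opp_opp]

theorem norm_par_lt_bigRadius {n : ℕ} (y : Torus n) (β : Label n) : ‖par y β‖ < bigRadius y := by
  have h : ∀ j : Fin n, ‖(y j : ℂ)‖ + ‖(y j : ℂ)‖⁻¹ ≤ ∑ j, (‖(y j : ℂ)‖ + ‖(y j : ℂ)‖⁻¹) :=
    fun j => Finset.single_le_sum (f := fun j => ‖(y j : ℂ)‖ + ‖(y j : ℂ)‖⁻¹)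
      (fun _ _ => by positivity) (Finset.mem_univ j)
  obtain ⟨j, σ⟩ := β
  have h1 := h j
  have h2 : 0 ≤ ‖(y j : ℂ)‖ := norm_nonneg _
  have h3 : 0 ≤ ‖(y j : ℂ)‖⁻¹ := by positivity
  unfold bigRadius
  rcases Int.units_eq_one_or σ with rfl | rfl
  · rw [par_one, norm_inv]; linarith
  · rw [par_neg_one]; linarith

/-! ### Convergence, and the integrals as values of `HasBr`. -/

section Base

variable {n : ℕ} [NeZero n] {q t lam : ℝ} {y : Torus n}

theorem differentiableAt_formReg_par (hq0 : 0 < q) (hq1 : q < 1) (hy : y ∈ genericPts n q t)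
    (β γ : Label n) (s : ℕ) {x : ℂ} (hx : x ∈ Metric.closedBall (pole q y γ.1 γ.2 s)
      (poleRadius q y (pole q y γ.1 γ.2 s))) :
    DifferentiableAt ℂ (formReg q t (par y) (full (std n)) β (opp γ) s) x := by
  have hp0 := pole_ne_zero hq0 y γ.1 γ.2 s
  obtain ⟨hr0, hr1, hr⟩ := poleRadius_spec hq0 hq1 y hp0
  have key : ∀ (e : Label n) (i : ℕ), ¬ (e = opp γ ∧ i = s) → x ≠ par y e * (q : ℂ) ^ i := by
    intro e i hne
    refine hr x hx _ (Or.inr ⟨(opp e).1, (opp e).2, i, rfl⟩) fun h => ?_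
    obtain ⟨h1, h2⟩ := genericPts.separated_nat hq0 hq1 hy (β := opp e) (γ := γ) h
    exact hne ⟨by rw [← h1, opp_opp], h2⟩
  refine differentiableAt_formReg hq0 hq1 t _ _ _ _ _ (hr x hx 0 (Or.inl rfl) hp0.symm)
    (fun i hi => key _ _ fun h => hi h.2) (fun e he i => key e i fun h => ?_)
  exact ne_of_mem_erase nodup_full_std he h.1

/-- The residue of the integrand attached to `β` at the pole `q^s e^γ`. -/
def resid (q t : ℝ) (y : Torus n) (β γ : Label n) (s : ℕ) : ℂ :=
  formReg q t (par y) (full (std n)) β (opp γ) s (pole q y γ.1 γ.2 s)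

theorem hasRes_resid (hq0 : 0 < q) (hq1 : q < 1) (hy : y ∈ genericPts n q t)
    (β γ : Label n) (s : ℕ) :
    HasRes (form q t (par y) (full (std n)) β) (point y γ * (q : ℂ) ^ s) (resid q t y β γ s) := by
  have hp0 := pole_ne_zero hq0 y γ.1 γ.2 s
  refine hasRes_formReg hq0 hq1 t (par y) β (mem_full_std (opp γ)) s (by rw [par_opp]) hp0 ?_
  exact (differentiableAt_formReg_par hq0 hq1 hy β γ s (Metric.mem_closedBall_self
    (poleRadius_spec hq0 hq1 y hp0).1.le)).continuousAt

theorem poleIntegral_phi (hq0 : 0 < q) (hq1 : q < 1) (hy : y ∈ genericPts n q t)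
    (β γ : Label n) (s : ℕ) :
    CircleIntegrable (localForm q t lam (phi t (idx β) y) y γ.1 γ.2 s) (pole q y γ.1 γ.2 s)
      (poleRadius q y (pole q y γ.1 γ.2 s)) ∧
    poleIntegral q t lam (phi t (idx β) y) y γ.1 γ.2 s =
      2 * Real.pi * Complex.I * (point y γ ^ (lam : ℂ) * qPow q (lam * s) * resid q t y β γ s) := by
  refine poleIntegral_spec hq0 hq1 γ.1 γ.2 s
    (finite_exceptional (fun c => t * par y c) (fun c => t * par y c)) (fun x hx => ?_)
    (fun x hx => differentiableAt_formReg_par hq0 hq1 hy β γ s hx)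
  simp only [Set.mem_ofPred_eq, not_or, not_exists] at hx
  rw [phi_mul_jpProd hq0 hq1 t y β hx.1 hx.2.1,
    form_eq_formReg hq0 hq1 t (par y) β (mem_full_std (opp γ)) s hx.1, par_opp]
  rfl

theorem norm_qPow (hq0 : 0 < q) (a : ℝ) : ‖(qPow q a : ℂ)‖ = q ^ a := by
  rw [qPow_eq hq0, Complex.norm_real, Real.norm_eq_abs, abs_of_pos (Real.rpow_pos_of_pos hq0 a)]

theorem summable_poleIntegral (hq0 : 0 < q) (hq1 : q < 1) (ht : 0 < t)
    (hy : y ∈ genericPts n q t) (h : q ^ (lam + 1) * t ^ (2 * n) < 1) (β γ : Label n) :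
    Summable fun s : ℕ => poleIntegral q t lam (phi t (idx β) y) y γ.1 γ.2 s := by
  have hql : 0 < q ^ lam := Real.rpow_pos_of_pos hq0 lam
  -- A bound slightly above the limiting ratio `q t^{2n}` of the residues which, multiplied by the
  -- ratio `q^λ` of the branch factors, still stays below `1`.
  obtain ⟨ρ, h1, h2⟩ : ∃ ρ, t ^ (2 * n) * q < ρ ∧ ρ < (q ^ lam)⁻¹ := by
    apply exists_between
    rw [lt_inv_comm₀ (by positivity) hql, lt_inv_comm₀ hql (by positivity)]
    rw [Real.rpow_add hq0, Real.rpow_one] at h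
    rw [← one_div, lt_div_iff₀ hql]
    linarith
  have h3 := residue_ratio hq0 hq1 ht (par_ne_zero y) (mem_full_std β)
    (by rwa [length_full_std]) (point_ne_zero y γ) (hasRes_resid hq0 hq1 hy β γ)
  refine summable_of_ratio_norm_eventually_le (r := q ^ lam * ρ) ?_ ?_
  · rw [lt_inv_comm₀ ((by positivity : 0 < t ^ (2 * n) * q).trans h1) hql] at h2
    have hρ := (by positivity : 0 < t ^ (2 * n) * q).trans h1
    rwa [← one_div, lt_div_iff₀ hρ] at h2
  · filter_upwards [h3] with s hs
    rw [(poleIntegral_phi hq0 hq1 hy β γ s).2, (poleIntegral_phi hq0 hq1 hy β γ (s + 1)).2,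
      show lam * ((s + 1 : ℕ) : ℝ) = lam + lam * s by push_cast; ring, qPow_add, Units.val_mul]
    simp only [norm_mul, norm_qPow hq0]
    set A := ‖(2 : ℂ)‖ * ‖(Real.pi : ℂ)‖ * ‖Complex.I‖
    set B := ‖point y γ ^ (lam : ℂ)‖
    have hB : 0 ≤ A * B * q ^ lam * q ^ (lam * s) := by positivity
    have := mul_le_mul_of_nonneg_left hs hB
    linarith

theorem hasOrbit_phi (hq0 : 0 < q) (hq1 : q < 1) (ht : 0 < t)
    (hy : y ∈ genericPts n q t) (h : q ^ (lam + 1) * t ^ (2 * n) < 1) (β γ : Label n) :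
    HasOrbit q lam (point y γ) (form q t (par y) (full (std n)) β)
      (∑' s : ℕ, poleIntegral q t lam (phi t (idx β) y) y γ.1 γ.2 s) := by
  have hq : (q : ℂ) ≠ 0 := by exact_mod_cast hq0.ne'
  refine ⟨fun s => if 0 ≤ s then resid q t y β γ s.toNat else 0, fun s => ?_, ?_⟩
  · rw [qPow_intCast hq0, mul_comm]
    dsimp only
    split_ifs with hs
    · lift s to ℕ using hs
      simpa using hasRes_resid hq0 hq1 hy β γ s
    -- For `s < 0` the point `q^s e^γ` is not a pole, so the sum over `ℤ` reduces to the sum over `s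
    -- ≥ 0`.
    · refine hasRes_zero (differentiableAt_form hq0 hq1 t _ _ _
        (mul_ne_zero (point_ne_zero y γ) (zpow_ne_zero _ hq)) fun e _ i e' => hs ?_).continuousAt
      have := genericPts.separated hq0 hq1 hy (β := γ) (γ := opp e) (a := s) (b := i) (by
        rw [zpow_natCast, mul_comm, e', mul_comm]; rfl)
      omega
  · have h1 := (summable_poleIntegral hq0 hq1 ht hy h β γ).hasSum
    refine (Function.Injective.hasSum_iff (Nat.cast_injective (R := ℤ)) fun s hs => ?_).1 ?_
    · have : ¬ 0 ≤ s := fun h0 => hs ⟨s.toNat, by simp [h0]⟩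
      simp [this]
    · convert h1 using 2 with s
      rw [(poleIntegral_phi hq0 hq1 hy β γ s).2]
      simp

theorem bigRadius_pos (y : Torus n) : 0 < bigRadius y :=
  (norm_nonneg _).trans_lt (norm_par_lt_bigRadius y (0, 1))

theorem differentiableAt_form_of_bigRadius_le (hq0 : 0 < q) (hq1 : q < 1) (hlam : ∃ k : ℤ, lam = k)
    (β : Label n) {x : ℂ} (hx : bigRadius y ≤ ‖x‖) :
    DifferentiableAt ℂ (fun x => x ^ (lam : ℂ) * form q t (par y) (full (std n)) β x) x := by
  obtain ⟨k, rfl⟩ := hlam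
  have hx0 : x ≠ 0 := norm_pos_iff.1 ((bigRadius_pos y).trans_le hx)
  have e : (fun x : ℂ => x ^ (((k : ℤ) : ℝ) : ℂ)) = fun x => x ^ k := by
    funext x
    rw [Complex.ofReal_intCast, Complex.cpow_intCast]
  refine DifferentiableAt.mul ?_ (differentiableAt_form hq0 hq1 t _ _ _ hx0 fun c _ i h => ?_)
  · rw [e]
    exact differentiableAt_zpow.2 (Or.inl hx0)
  · have h1 := norm_par_lt_bigRadius y c
    have h2 : ‖x‖ ≤ ‖par y c‖ := by
      rw [h, norm_mul, norm_pow, Complex.norm_real, Real.norm_eq_abs, abs_of_pos hq0]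
      exact mul_le_of_le_one_right (norm_nonneg _) (pow_le_one₀ hq0.le hq1.le)
    linarith

/-- The poles lie inside the circle and `x^λ` is single-valued, so the integrand is holomorphic on
every larger annulus and the integral does not depend on the radius. -/
theorem globalForm_spec (hq0 : 0 < q) (hq1 : q < 1) (hlam : ∃ k : ℤ, lam = k) (β : Label n) :
    CircleIntegrable (globalForm q t lam (phi t (idx β) y) y) 0 (bigRadius y) ∧
    HasLoop lam (form q t (par y) (full (std n)) β)
      (∮ x in C(0, bigRadius y), globalForm q t lam (phi t (idx β) y) y x) := by
  have hr := bigRadius_pos y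
  have hd := fun x hx => differentiableAt_form_of_bigRadius_le (t := t) (y := y) hq0 hq1 hlam β
    (x := x) hx
  set F := fun x => x ^ (lam : ℂ) * form q t (par y) (full (std n)) β x with hF
  have hcont : ∀ R, bigRadius y ≤ R → ContinuousOn F (Metric.sphere 0 R) := fun R hR x hx =>
    (hd x (by rw [mem_sphere_zero_iff_norm] at hx; linarith)).continuousAt.continuousWithinAt
  have hcong : F =ᶠ[codiscreteWithin (Metric.sphere 0 |bigRadius y|)]
      globalForm q t lam (phi t (idx β) y) y := by
    filter_upwards [compl_finite_mem_codiscreteWithin (s := Metric.sphere (0 : ℂ) |bigRadius y|)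
      (finite_exceptional (fun c => t * par y c) (fun c => t * par y c))] with x hx
    simp only [Set.mem_compl_iff, Set.mem_ofPred_eq, not_or, not_exists] at hx
    have := phi_mul_jpProd hq0 hq1 t y β hx.1 hx.2.1
    rw [hF, globalForm]
    linear_combination (-x ^ (lam : ℂ)) * this
  refine ⟨((hcont _ le_rfl).circleIntegrable hr.le).congr_codiscreteWithin hcong, ?_⟩
  rw [← circleIntegral.circleIntegral_congr_codiscreteWithin hcong hr.ne']
  filter_upwards [eventually_ge_atTop (bigRadius y)] with R hR
  refine ⟨(hcont R hR).circleIntegrable (hr.le.trans hR), ?_⟩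
  refine Complex.circleIntegral_eq_of_differentiable_on_annulus_off_countable hr hR
    Set.countable_empty ?_ ?_
  · intro x hx
    refine (hd x ?_).continuousAt.continuousWithinAt
    simpa using hx.2
  · intro x hx
    refine hd x ?_
    have := hx.1.2
    simp only [Metric.mem_closedBall, dist_zero_right, not_le] at this
    exact this.le

theorem bracketConverges_phi (hq0 : 0 < q) (hq1 : q < 1) (ht : 0 < t)
    (hy : y ∈ genericPts n q t) (C : Cycle n q t lam) (β : Label n) :
    BracketConverges C (phi t (idx β) y) y :=
  ⟨fun j σ h => ⟨fun s => (poleIntegral_phi hq0 hq1 hy β (j, σ) s).1,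
    summable_poleIntegral hq0 hq1 ht hy (C.mult_support ⟨y, j, σ, h⟩) β (j, σ)⟩,
    fun h => (globalForm_spec hq0 hq1 (C.loop_support ⟨y, h⟩) β).1⟩

theorem hasBr_bracket (hq0 : 0 < q) (hq1 : q < 1) (ht : 0 < t)
    (hy : y ∈ genericPts n q t) (C : Cycle n q t lam) (β : Label n) :
    HasBr q lam (fun γ => C.mult y γ.1 γ.2) (C.loop y) y (form q t (par y) (full (std n)) β)
      (bracket C (phi t (idx β) y) y) := by
  refine ⟨fun γ => ∑' s : ℕ, poleIntegral q t lam (phi t (idx β) y) y γ.1 γ.2 s, _,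
    fun γ h => hasOrbit_phi hq0 hq1 ht hy (C.mult_support ⟨y, γ.1, γ.2, h⟩) β γ,
    fun h => (globalForm_spec hq0 hq1 (C.loop_support ⟨y, h⟩) β).2, ?_⟩
  rw [bracket, Fintype.sum_prod_type]

end Base

/-! ### Uniqueness of residues and integrals. -/

theorem HasRes.unique {f : ℂ → ℂ} {p r s : ℂ} (h : HasRes f p r) (h' : HasRes f p s) : r = s :=
  tendsto_nhds_unique h h'

theorem HasOrbit.unique {q lam : ℝ} {b : ℂ} {f : ℂ → ℂ} {v w : ℂ} (h : HasOrbit q lam b f v)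
    (h' : HasOrbit q lam b f w) : v = w := by
  obtain ⟨r, h1, h2⟩ := h
  obtain ⟨r', h1', h2'⟩ := h'
  have : r = r' := funext fun s => (h1 s).unique (h1' s)
  subst this
  exact h2.unique h2'

theorem HasLoop.unique {lam : ℝ} {f : ℂ → ℂ} {v w : ℂ} (h : HasLoop lam f v)
    (h' : HasLoop lam f w) : v = w := by
  obtain ⟨R, h1, h2⟩ := (h.and h').exists
  exact h1.2.symm.trans h2.2

/-- Orbit sums with multiplicity `0` are unconstrained in `HasBr`, but they do not enter the total.
Uniqueness turns an equality of integrands into the equality of the components of `Ψ`. -/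
theorem HasBr.unique {n : ℕ} {q lam : ℝ} {mult : Label n → ℂ} {loop : ℂ} {y : Torus n} {f : ℂ → ℂ}
    {v w : ℂ} (h : HasBr q lam mult loop y f v) (h' : HasBr q lam mult loop y f w) : v = w := by
  obtain ⟨a, b, h1, h2, rfl⟩ := h
  obtain ⟨a', b', h1', h2', rfl⟩ := h'
  congr 1
  · refine Finset.sum_congr rfl fun β _ => ?_
    by_cases hβ : mult β = 0
    · simp [hβ]
    · rw [(h1 β hβ).unique (h1' β hβ)]
  · by_cases hl : loop = 0
    · simp [hl]
    · rw [(h2 hl).unique (h2' hl)]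


/-! ### The vector `Ψ` and its translates -/

theorem idx_mem_Icc {n : ℕ} (β : Label n) : idx β ∈ Finset.Icc 1 (2 * n) := by
  have := β.1.2
  rw [Finset.mem_Icc, idx]
  split_ifs <;> omega

theorem exists_idx_eq {n i : ℕ} (h1 : 1 ≤ i) (h2 : i ≤ 2 * n) : ∃ β : Label n, idx β = i := by
  by_cases h : i ≤ n
  · exact ⟨(⟨i - 1, by omega⟩, 1), by rw [idx, if_pos rfl]; simp only; omega⟩
  · refine ⟨(⟨2 * n - i, by omega⟩, -1), ?_⟩
    rw [idx, if_neg (by decide : ¬ (-1 : ℤˣ) = 1)]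
    simp only; omega

section Labels

variable {n : ℕ} [NeZero n]

theorem pl_val_add_one (j : Fin n) : pl n (j + 1) = (j, 1) := by simp [pl]

theorem label_wRep_of_le {i : ℕ} (h1 : 1 ≤ i) (h2 : i ≤ n) : label (wRep n i) = pl n i := by
  induction i, h1 using Nat.le_induction with
  | base =>
    rw [wRep, label, actL_one]
    simp [pl]
  | succ k hk ih =>
    obtain ⟨k, rfl⟩ := Nat.exists_eq_add_of_le' hk
    rw [wRep, if_pos (by omega), simpleRoot, if_pos (by omega),
      eps_eq_pl (show 1 ≤ k + 1 by omega) (by omega),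
      eps_eq_pl (show 1 ≤ k + 1 + 1 by omega) (by omega),
      label_refl_mul (pl_ne (by omega) (by omega) (by omega) (by omega) (by omega)), ih (by omega)]
    simp [swapL]

/-- The representatives move `ε_1` along `ε_1, …, ε_n, -ε_n, …, -ε_1`; the long simple reflection is
used once, at the step from `ε_n` to `-ε_n`. -/
theorem label_wRep_add {k : ℕ} (h1 : 1 ≤ k) (h2 : k ≤ n) :
    label (wRep n (n + k)) = opp (pl n (n + 1 - k)) := by
  have hn : 1 ≤ n := h1.trans h2
  induction k, h1 using Nat.le_induction with
  | base =>
    have h := label_wRep_of_le hn le_rfl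
    obtain ⟨m, hm⟩ := Nat.exists_eq_add_of_le' hn
    have e : wRep n (n + 1) = refl (simpleRoot n n) * wRep n n := by
      conv_lhs => rw [show n + 1 = m + 2 by omega, wRep, if_pos (by omega), ← hm]
    rw [e, simpleRoot, if_neg (by omega), two_smul_eps_eq hn le_rfl,
      label_refl_mul (opp_ne _).symm, h]
    simp [swapL]
  | succ k hk ih =>
    have e : wRep n (n + (k + 1)) = refl (simpleRoot n (n - k)) * wRep n (n + k) := by
      obtain ⟨m, hm⟩ := Nat.exists_eq_add_of_le' (show 1 ≤ n + k by omega)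
      conv_lhs => rw [show n + (k + 1) = m + 2 by omega, wRep, if_neg (by omega), ← hm,
        show 2 * n - (n + k) = n - k by omega]
    have hne : pl n (n - k) ≠ pl n (n - k + 1) :=
      pl_ne (by omega) (by omega) (by omega) (by omega) (by omega)
    rw [e, simpleRoot, if_pos (by omega), eps_eq_pl (show 1 ≤ n - k by omega) (by omega),
      eps_eq_pl (show 1 ≤ n - k + 1 by omega) (by omega), label_refl_mul hne, ih (by omega),
      show n + 1 - k = n - k + 1 by omega, show n + 1 - (k + 1) = n - k by omega, swapL, if_neg,
      if_pos rfl]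
    intro h
    have := congrArg Prod.snd h
    simp [pl, opp] at this

theorem label_wRep_idx (β : Label n) : label (wRep n (idx β)) = β := by
  obtain ⟨j, σ⟩ := β
  have := j.2
  rcases Int.units_eq_one_or σ with rfl | rfl
  · rw [idx, if_pos rfl, label_wRep_of_le (by omega) (by simp only; omega), pl_val_add_one]
  · have hi : idx ((j, -1) : Label n) = n + (n - j) := by
      rw [idx, if_neg (by decide : ¬ (-1 : ℤˣ) = 1)]
      simp only; omega
    rw [hi, label_wRep_add (by omega) (by omega), show n + 1 - (n - (j : ℕ)) = j + 1 by omega,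
      pl_val_add_one]
    rfl

theorem eps_one_eq : eps n 1 = vec (0, 1) := by
  have := eps_eq_vec (0 : Fin n)
  simpa using this

theorem act_eps_one (w : WeylC n) : w.act (eps n 1) = vec (label w) := by
  rw [eps_one_eq, act_vec, label]

/-- A coset of the stabilizer of `ε_1` is determined by the image of `ε_1`. -/
theorem hBar_apply (i : ℕ) (w : WeylC n) (y : Torus n) :
    hBar n i w y = if label w = label (wRep n i) then 1 else 0 := by
  have key : (((wRep n i)⁻¹ * w).act (eps n 1) = eps n 1) ↔ label w = label (wRep n i) := by
    rw [act_eps_one, eps_one_eq, vec_injective.eq_iff, label, label, label, actL_mul]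
    constructor
    · intro h
      have := congrArg (actL (wRep n i)) h
      rwa [← actL_mul, mul_inv_cancel, actL_one] at this
    · intro h
      rw [h, actL_inv_actL]
  have hb : ∀ g : WeylC n, hBasis (wRep n i * g) w y = if g = (wRep n i)⁻¹ * w then 1 else 0 := by
    intro g
    by_cases h : g = (wRep n i)⁻¹ * w
    · rw [if_pos h, h, mul_inv_cancel_left, hBasis, Pi.single_eq_same]; rfl
    · rw [if_neg h, hBasis, Pi.single_eq_of_ne]
      · rfl
      · intro e
        exact h (by rw [e, inv_mul_cancel_left])
  rw [hBar, Finset.sum_apply, Finset.sum_apply]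
  simp only [hb]
  rw [Finset.sum_ite_eq']
  simp only [Finset.mem_filter, Finset.mem_univ, true_and, key]

theorem Psi_apply {q t lam : ℝ} (C : Cycle n q t lam) (w : WeylC n) (y : Torus n) :
    Psi C w y = bracket C (phi t (idx (label w)) y) y := by
  have h : Psi C w y = ∑ i ∈ Finset.Icc 1 (2 * n), bracket C (phi t i y) y * hBar n i w y := by
    rw [Psi, Finset.sum_apply, Finset.sum_apply]; rfl
  rw [h, Finset.sum_eq_single (idx (label w))]
  · rw [hBar_apply, label_wRep_idx, if_pos rfl, mul_one]
  · intro i hi hne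
    rw [Finset.mem_Icc] at hi
    obtain ⟨β, rfl⟩ := exists_idx_eq hi.1 hi.2
    rw [hBar_apply, label_wRep_idx, if_neg, mul_zero]
    rintro rfl
    exact hne rfl
  · intro h
    exact absurd (idx_mem_Icc _) h

theorem snd_of_mem_std {β : Label n} (h : β ∈ std n) : β.2 = 1 := by
  rw [std, List.mem_map] at h
  obtain ⟨k, _, rfl⟩ := h
  rfl

end Labels

/-! ### Translations of the torus and dilations of `x`. -/

section Translation

variable {n : ℕ} {q t : ℝ}

theorem qPow_zpow (q a : ℝ) (m : ℤ) : qPow q a ^ m = qPow q (a * m) := by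
  ext
  rw [Units.val_zpow_eq_zpow_val]
  simp only [qPow, Units.val_mk0]
  rw [← Complex.exp_int_mul]
  congr 1
  push_cast; ring

theorem prod_qPow {ι : Type*} (q : ℝ) (s : Finset ι) (f : ι → ℝ) :
    ∏ k ∈ s, qPow q (f k) = qPow q (∑ k ∈ s, f k) := by
  classical
  induction s using Finset.induction_on with
  | empty => simp [qPow_zero]
  | insert a s ha ih => rw [Finset.prod_insert ha, Finset.sum_insert ha, ih, qPow_add]

theorem expo_scale (q : ℝ) (μ : Fin n → ℝ) (α : Fin n → ℤ) (y : Torus n) :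
    expo α (scale q μ y) = qPow q (μ ⬝ᵥ toE α) * expo α y := by
  rw [expo, expo, ← Units.val_mul]
  congr 1
  simp only [scale, mul_zpow, qPow_zpow, Finset.prod_mul_distrib, prod_qPow]
  rfl

theorem genericPts.scale (hq0 : 0 < q) {y : Torus n} (hy : y ∈ genericPts n q t) {μ : Fin n → ℝ}
    (hμ : ∀ α ∈ roots n, ∃ k : ℤ, μ ⬝ᵥ toE α = k) : scale q μ y ∈ genericPts n q t := by
  intro α hα m
  obtain ⟨k, hk⟩ := hμ α hα
  have e : affExpo q α m (QKZ.scale q μ y) = affExpo q α (m + k) y := by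
    have hq : (q : ℂ) ≠ 0 := by exact_mod_cast hq0.ne'
    rw [affExpo, affExpo, expo_scale, hk, qPow_intCast hq0, zpow_add₀ hq, mul_assoc]
  rw [e]
  exact hy α hα (m + k)

theorem toE_mem_coweights (v : Fin n → ℤ) : toE v ∈ coweights n :=
  ⟨v, 0, by funext k; simp [toE]⟩

theorem halfSum_mem_coweights : halfSum n ∈ coweights n :=
  ⟨0, 1, by funext k; simp [halfSum]⟩

theorem halfSum_dotProduct_vec (β : Label n) :
    halfSum n ⬝ᵥ toE (vec β) = ((β.2 : ℤ) : ℝ) / 2 := by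
  rw [toE_vec_dotProduct, halfSum]; ring

/-- The half-sum pairs to `±1/2` with each `±ε_j`, yet integrally with the roots; this is what keeps
translated points generic. -/
theorem halfSum_dotProduct_roots [NeZero n] {α : Fin n → ℤ} (hα : α ∈ roots n) :
    ∃ k : ℤ, halfSum n ⬝ᵥ toE α = k := by
  have he : ∀ i, 1 ≤ i → i ≤ n → halfSum n ⬝ᵥ toE (eps n i) = 1 / 2 := by
    intro i h1 h2
    rw [eps_eq_pl h1 h2, halfSum_dotProduct_vec]
    simp [pl]
  have hadd : ∀ v w : Fin n → ℤ, toE (v + w) = toE v + toE w := by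
    intro v w; funext k; simp [toE]
  have pos : ∀ β ∈ posRoots n, ∃ k : ℤ, halfSum n ⬝ᵥ toE β = k := by
    rintro β (⟨i, j, hi, hij, hj, rfl | rfl⟩ | ⟨i, hi, hin, rfl⟩)
    · refine ⟨1, ?_⟩
      rw [hadd, dotProduct_add, he i hi (by omega), he j (by omega) hj]; norm_num
    · refine ⟨0, ?_⟩
      rw [toE_sub, dotProduct_sub, he i hi (by omega), he j (by omega) hj]; norm_num
    · refine ⟨1, ?_⟩
      rw [two_smul, hadd, dotProduct_add, he i hi hin]; norm_num
  rcases hα with h | h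
  · exact pos α h
  · obtain ⟨k, hk⟩ := pos _ h
    refine ⟨-k, ?_⟩
    have e : toE (-α) = -toE α := by funext k; simp [toE]
    rw [e, dotProduct_neg] at hk
    push_cast; linarith

theorem form_scale {L : Type*} [DecidableEq L] (q t : ℝ) {v v' : L → ℂ} (l : List L) (β : L)
    {c : ℂ} (hc : c ≠ 0) (h : ∀ e, v e = c * v' e) (x : ℂ) :
    c * form q t v l β (c * x) = form q t v' l β x := by
  have e : ∀ d, v d / (c * x) = v' d / x := fun d => by rw [h, mul_div_mul_left _ _ hc]
  unfold form
  simp only [e]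
  field_simp

end Translation

/-! ### The difference equations for `Ψ`. -/

section Solution

variable {n : ℕ} [NeZero n] {q t lam : ℝ} {y : Torus n}

theorem state_Psi (hq0 : 0 < q) (hq1 : q < 1) (ht : 0 < t) (hy : y ∈ genericPts n q t)
    (C : Cycle n q t lam) :
    State q t lam (fun γ => C.mult y γ.1 γ.2) (C.loop y) y 0 (std n) (Psi C) := by
  refine ⟨fun β => bracket C (phi t (idx β) y) y, fun β => ?_, fun w => ?_⟩
  · have e : vals q y 0 = par y := by
      funext β
      rw [vals, par, show toE (0 : Fin n → ℤ) = 0 by funext k; simp [toE], scale_zero]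
    rw [e]
    exact hasBr_bracket hq0 hq1 ht hy C β
  · rw [Psi_apply, zero_dotProduct, Int.cast_zero, mul_zero, qPow_zero, Units.val_one, one_mul]

/-- This is where the cycle being fixed is used: the multiplicities at `q^μ y` are those at `y`. -/
theorem hasBr_scale (hq0 : 0 < q) (hq1 : q < 1) (ht : 0 < t) (C : Cycle n q t lam)
    {μ : Fin n → ℝ} (hμ : μ ∈ coweights n) (hy : scale q μ y ∈ genericPts n q t) (β : Label n) :
    HasBr q lam (fun γ => C.mult y γ.1 γ.2) (C.loop y) (scale q μ y)
      (form q t (par (scale q μ y)) (full (std n)) β)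
      (bracket C (phi t (idx β) (scale q μ y)) (scale q μ y)) := by
  have h := hasBr_bracket hq0 hq1 ht hy C β
  rwa [C.mult_scale μ hμ, C.loop_scale μ hμ] at h

theorem rTau_symm_Psi (C : Cycle n q t lam) (μ : Fin n → ℝ) (w : WeylC n) :
    (rTau q ((-lam) • toE (eps n 1)) μ).symm (Psi C) w y =
      qPow q (lam * (μ ⬝ᵥ toE (vec (label w)))) *
        bracket C (phi t (idx (label w)) (scale q μ y)) (scale q μ y) := by
  have e : -μ ⬝ᵥ w.act ((-lam) • toE (eps n 1)) = lam * (μ ⬝ᵥ toE (vec (label w))) := by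
    have h : w.act ((-lam) • toE (eps n 1)) = (-lam) • w.act (toE (eps n 1)) := by
      funext k; simp [WeylC.act, mul_left_comm]
    rw [h, act_toE, act_eps_one, neg_dotProduct, dotProduct_smul, smul_eq_mul]; ring
  rw [← Psi_apply, ← e]
  rfl

theorem rTransl_Psi (hq0 : 0 < q) (hq1 : q < 1) (ht : 0 < t) (hy : y ∈ genericPts n q t)
    (C : Cycle n q t lam) {i : ℕ} (h1 : 1 ≤ i) (h2 : i ≤ n) (w : WeylC n) :
    (rTau q ((-lam) • toE (eps n 1)) (toE (eps n i))).symm (Psi C) w y =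
      rTransl n q t t ((-lam) • toE (eps n 1)) i (Psi C) w y := by
  obtain ⟨G, hG, hF⟩ := (state_Psi hq0 hq1 ht hy C).rTransl hq0 hq1 hy h1 h2
  have hy' : scale q (toE (eps n i)) y ∈ genericPts n q t :=
    genericPts.scale hq0 hy fun α _ => ⟨_, toE_dotProduct _ _⟩
  -- No dilation of `x` is needed. The base points move by integral powers of `q`, so the integral
  -- at `y` is also the one at the translated point.
  have h3 := (hG (label w)).scale (y' := scale q (toE (eps n i)) y) 0 fun β =>
    ⟨eps n i ⬝ᵥ vec β, by rw [point_scale, toE_dotProduct, sub_zero]⟩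
  have h4 := hasBr_scale hq0 hq1 ht C (toE_mem_coweights (eps n i)) hy' (label w)
  simp only [qPow_zero, zero_mul, neg_zero, Units.val_one, one_mul] at h3
  rw [hF, rTau_symm_Psi, toE_dotProduct, h3.unique h4]

theorem rHalf_Psi (hq0 : 0 < q) (hq1 : q < 1) (ht : 0 < t) (hy : y ∈ genericPts n q t)
    (C : Cycle n q t lam) (w : WeylC n) :
    (rTau q ((-lam) • toE (eps n 1)) (halfSum n)).symm (Psi C) w y =
      rHalf n q t t ((-lam) • toE (eps n 1)) (Psi C) w y := by
  have hq : (q : ℂ) ≠ 0 := by exact_mod_cast hq0.ne'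
  obtain ⟨G, hG, hF⟩ := (state_Psi hq0 hq1 ht hy C).rHalf hq0 hy
  set P := ((std n).map opp).reverse with hP
  have hfull : full P = P ++ std n := by
    rw [full, hP, List.map_reverse, List.reverse_reverse, List.map_map]
    congr 1
    exact (List.map_congr_left fun β _ => opp_opp β).trans (List.map_id _)
  have hmemP : ∀ β, β ∈ P ↔ opp β ∈ std n := by
    intro β
    rw [hP, List.mem_reverse, List.mem_map]
    constructor
    · rintro ⟨γ, h, rfl⟩; rwa [opp_opp]
    · exact fun h => ⟨_, h, opp_opp β⟩
  have hmem : ∀ β, β ∈ P ∧ β ∉ std n ∨ β ∉ P ∧ β ∈ std n := by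
    intro β
    rw [hmemP]
    exact ((isHalf_std (n := n)).mem_iff β).symm.imp And.symm And.symm
  have hneg : ∀ β ∈ P, β.2 = -1 := by
    intro β h
    have := snd_of_mem_std ((hmemP β).1 h)
    rw [← neg_neg β.2]
    exact congrArg _ this
  rw [hfull] at hG
  have hv : vals q y 0 = par y := by
    funext β
    rw [vals, par, show toE (0 : Fin n → ℤ) = 0 by funext k; simp [toE], scale_zero]
  rw [hv] at hG
  -- The ordering is `-ε_n, …, -ε_1, ε_1, …, ε_n`. Moving the positive half to the front restores
  -- the standard one, with the parameters of all `ε_j` divided by `q`.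
  have hR := hG.rotate hq0 hq1 (v' := fun c => if c ∈ P then par y c else par y c / q)
    (fun c hc => if_pos hc) (fun c hc => by
      rcases hmem c with h | h
      · exact absurd hc h.2
      · simp only [if_neg h.1]; field_simp) hmem
  set y' := scale q (halfSum n) y with hy'
  have hgen : y' ∈ genericPts n q t := genericPts.scale hq0 hy fun α hα => halfSum_dotProduct_roots hα
  have hpt : ∀ β, point y' β = qPow q (((β.2 : ℤ) : ℝ) / 2) * point y β := by
    intro β
    rw [hy', point_scale, halfSum_dotProduct_vec]
  -- The new parameters are `q^{-1/2}` times those at the translated point, in both halves, and a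
  -- dilation of `x` removes this common factor. The base points move by `q^{±1/2} = q^{k+1/2}` with
  -- `k = 0` or `k = -1`.
  have h3 := (hR (label w)).scale (y' := y') (-(1 / 2)) fun β => by
    rw [hpt]
    rcases Int.units_eq_one_or β.2 with h | h
    · exact ⟨0, by rw [h]; norm_num⟩
    · exact ⟨-1, by rw [h]; norm_num⟩
  have h4 := hasBr_scale hq0 hq1 ht C halfSum_mem_coweights hgen (label w)
  rw [show (fun x => (qPow q (-(1 / 2)) : ℂ) *
      form q t (fun c => if c ∈ P then par y c else par y c / q) (std n ++ P) (label w)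
        (qPow q (-(1 / 2)) * x)) = form q t (par y') (full (std n)) (label w) from
    funext fun x => form_scale q t _ _ (Units.ne_zero _) (fun c => by
      rw [par, par, hpt]
      rcases hmem c with h | h
      · rw [if_pos h.1, ← mul_assoc, ← Units.val_mul, ← qPow_add, opp, hneg c h.1]
        norm_num [qPow_zero]
      · rw [if_neg h.1, ← mul_assoc, ← Units.val_mul, ← qPow_add]
        have : (opp c).2 = -1 := congrArg Neg.neg (snd_of_mem_std h.2)
        rw [this, show (-(1 / 2) + ((((-1 : ℤˣ) : ℤ) : ℝ)) / 2) = -1 by norm_num, qPow_neg,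
          Units.val_inv_eq_inv_val, qPow_one hq0]
        ring) x] at h3
  rw [hF, rTau_symm_Psi, ← hy', ← h3.unique h4, halfSum_dotProduct_vec, zero_dotProduct,
    Int.cast_zero, mul_zero, qPow_zero, Units.val_one, one_mul]
  beta_reduce
  -- Balance of the exponents: `-λ/2 + λ/2 = 0` on the negative half, and `λ/2 + λ/2 - λ = 0` on the
  -- positive half, with `-λ` coming from the rotation.
  rcases hmem (label w) with h | h
  · rw [if_pos h.1, hneg _ h.1, ← mul_assoc, ← Units.val_mul, ← qPow_add,
      show lam * ((((-1 : ℤˣ) : ℤ) : ℝ) / 2) + -(-(1 / 2) * lam) = 0 by push_cast; ring, qPow_zero,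
      Units.val_one, one_mul]
  · rw [if_neg h.1, snd_of_mem_std h.2, ← mul_assoc, ← mul_assoc, ← Units.val_mul, ← qPow_add,
      ← Units.val_mul, ← qPow_add,
      show lam * ((((1 : ℤˣ) : ℤ) : ℝ) / 2) + -(-(1 / 2) * lam) + -lam = 0 by push_cast; ring,
      qPow_zero, Units.val_one, one_mul]

end Solution

end

end QKZ

theorem theorem3p2 (n : ℕ) (hn : 1 ≤ n) (q t lam : ℝ) (hq0 : 0 < q) (hq1 : q < 1) (ht : 0 < t)
    (hlam : 0 < lam) (C : QKZ.Cycle n q t lam) :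
    (∀ y ∈ QKZ.genericPts n q t, ∀ i : ℕ, 1 ≤ i → i ≤ 2 * n →
      QKZ.BracketConverges C (QKZ.phi t i y) y) ∧
    QKZ.SolvesQKZ n q t t ((-lam) • QKZ.toE (QKZ.eps n 1)) (QKZ.genericPts n q t)
      (QKZ.Psi C) := by
  have : NeZero n := ⟨by omega⟩
  refine ⟨fun y hy i h1 h2 => ?_, fun i h1 h2 y hy w => ?_, fun y hy w => ?_⟩
  · obtain ⟨β, rfl⟩ := QKZ.exists_idx_eq h1 h2
    exact QKZ.bracketConverges_phi hq0 hq1 ht hy C β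
  · exact QKZ.rTransl_Psi hq0 hq1 ht hy C h1 h2 w
  · exact QKZ.rHalf_Psi hq0 hq1 ht hy C w
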